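/- **Setting.** Let $\varphi=(\varphi_p)_{p\in\mathbb N}$ be an acceptable programming system (an effective enumeration of the partial computable functions $\mathbb N\rightharpoonup\mathbb N$ into which every uniformly partial computable sequence of such functions can be computably translated), and let $W_p=\mathrm{dom}(\varphi_p)$. A language is a computably enumerable set $L\subseteq\mathbb N$. A text for $L$ is a sequence $T:\mathbb N\to\mathbb N\cup\{\#\}$ with $\mathrm{content}(T):=\mathrm{ran}(T)\setminus\{\#\}=L$; $T[t]$ denotes the finite sequence $T(0),\dots,T(t-1)$. A *bounded memory states learner* $M$ is given by partial computable functions $h_M:\mathbb N\times(\mathbb N\cup\{\#\})\rightharpoonup\mathbb N\cup\{?\}$ and $s_M:\mathbb N\times(\mathbb N\cup\{\#\})\rightharpoonup\mathbb N$ with the same domain. Put $s_M^*(\epsilon)=0$, $s_M^*(\sigma x)=s_M(s_M^*(\sigma),x)$, $M(\epsilon)=\,?$ and $M(\sigma x)=h_M(s_M^*(\sigma),x)$. Its learning sequence on $T$ is $h_t=M(T[t])$, $t\in\mathbb N$, which is required to be defined for all $t$. The symbol $?$ stands for "no (new) hypothesis"; in the conditions below all hypotheses whose languages are mentioned are supposed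 to be different from $?$. * $\mathbf{Ex}$: there is $t_0$ with $W_{h_{t_0}}=\mathrm{content}(T)$ and, for all $t\ge t_0$, $h_t\ne\,?$ implies $h_t=h_{t_0}$. * $\mathbf{NU}$ (non-U-shaped): for all $r\le s\le t$, $W_{h_r}=W_{h_t}=\mathrm{content}(T)$ implies $W_{h_r}=W_{h_s}$. * $\mathbf{Dec}$ (decisive): for all $r\le s\le t$, $W_{h_r}=W_{h_t}$ implies $W_{h_r}=W_{h_s}$. * $\mathbf{WMon}$ (weakly monotonic): for all $s\le t$, $\mathrm{content}(T[t])\subseteq W_{h_s}$ implies $W_{h_s}\subseteq W_{h_t}$. * $\mathbf{Caut}$ (cautious): for all $s\le t$, not $W_{h_t}\subsetneq W_{h_s}$. * $\mathbf{Mon}$ (monotonic): for all $s\le t$, $W_{h_s}\cap\mathrm{content}(T)\subseteq W_{h_t}\cap\mathrm{content}(T)$. * $\mathbf{SMon}$ (strongly monotonic): for all $s\le t$, $W_{h_s}\subseteq W_{h_t}$. For a restriction $\delta$ from this list, $[\mathbf{Txt}\,\mathbf{BMS}_*\,\delta\,\mathbf{Ex}]$ denotes the set of all collections $\mathcal L$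 of languages for which there is a bounded memory states learner $M$ such that, for every $L\in\mathcal L$ and every text $T$ for $L$, the set $\{s_M^*(T[t]) : t\in\mathbb N\}$ is finite and the learning sequence of $M$ on $T$ satisfies $\delta$ and $\mathbf{Ex}$; $[\mathbf{Txt}\,\mathbf{BMS}_*\,\mathbf{Ex}]$ is the same without $\delta$. **Theorem.** 1. $[\mathbf{Txt}\,\mathbf{BMS}_*\,\mathbf{NU}\,\mathbf{Ex}]=[\mathbf{Txt}\,\mathbf{BMS}_*\,\mathbf{Ex}]$. 2. $[\mathbf{Txt}\,\mathbf{BMS}_*\,\mathbf{Dec}\,\mathbf{Ex}]=[\mathbf{Txt}\,\mathbf{BMS}_*\,\mathbf{WMon}\,\mathbf{Ex}]=[\mathbf{Txt}\,\mathbf{BMS}_*\,\mathbf{Caut}\,\mathbf{Ex}]=[\mathbf{Txt}\,\mathbf{BMS}_*\,\mathbf{Ex}]$. 3. $[\mathbf{Txt}\,\mathbf{BMS}_*\,\mathbf{Mon}\,\mathbf{Ex}]\subsetneq[\mathbf{Txt}\,\mathbf{BMS}_*\,\mathbf{Ex}]$. 4. $[\mathbf{Txt}\,\mathbf{BMS}_*\,\mathbf{SMon}\,\mathbf{Ex}]\subsetneq[\mathbf{Txt}\,\mathbf{BMS}_*\,\mathbf{Mon}\,\mathbf{Ex}]$.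 -/

import Mathlib

namespace BMSLearning

/-- An acceptable programming system: a uniformly partial computable family `φ 0, φ 1, …` of unary
partial functions into which every such family can be translated computably. -/
structure IsAcceptable (φ : ℕ → ℕ →. ℕ) : Prop where
  partrec : Partrec₂ φ
  translate : ∀ ψ : ℕ → ℕ →. ℕ, Partrec₂ ψ →
    ∃ f : ℕ → ℕ, Computable f ∧ ∀ p x, φ (f p) x = ψ p x

/-- `W φ p` is the domain of `φ p`. -/
def W (φ : ℕ → ℕ →. ℕ) (p : ℕ) : Set ℕ := (φ p).Dom

/-- The input alphabet `ℕ ∪ {#}`; the pause symbol `#` is `none`. -/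
abbrev Datum : Type := Option ℕ

/-- The output alphabet `ℕ ∪ {?}`; the symbol `?` is `none`. -/
abbrev Hyp : Type := Option ℕ

/-- The content of an infinite sequence. -/
def content (T : ℕ → Datum) : Set ℕ := {n | ∃ t, T t = some n}

/-- The content of a finite sequence. -/
def seqContent (σ : List Datum) : Set ℕ := {n | some n ∈ σ}

/-- `T` is a text for `L`. -/
def IsText (T : ℕ → Datum) (L : Set ℕ) : Prop := content T = L

/-- The initial segment `T[t]`, consisting of `T 0, …, T (t - 1)`. -/
def initSeg (T : ℕ → Datum) (t : ℕ) : List Datum := (List.range t).map T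

/-- The data of a bounded memory states learner: a partial computable hypothesis generating
function and a partial computable state transition function with the same domain. -/
structure BMSLearner where
  h : ℕ × Datum →. Hyp
  s : ℕ × Datum →. ℕ
  partrec_h : Partrec h
  partrec_s : Partrec s
  dom_eq : h.Dom = s.Dom

namespace BMSLearner

variable (M : BMSLearner)

/-- The state reached from the initial state `0` after reading a finite sequence. -/
def sStar (σ : List Datum) : Part ℕ :=
  σ.foldl (fun q x => q.bind fun a => M.s (a, x)) (Part.some 0)

/-- The learner as a partial function on finite sequences: on `σ` followed by `x` it outputs
`h (s* σ, x)`. On the empty sequence it outputs `?`. -/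
def hStar (σ : List Datum) : Part Hyp :=
  match σ.getLast? with
  | none => Part.some none
  | some x => (M.sStar σ.dropLast).bind fun a => M.h (a, x)

theorem sStar_nil : M.sStar [] = Part.some 0 := rfl

theorem sStar_concat (σ : List Datum) (x : Datum) :
    M.sStar (σ ++ [x]) = (M.sStar σ).bind fun a => M.s (a, x) := by
  simp [sStar]

theorem hStar_nil : M.hStar [] = Part.some none := rfl

theorem hStar_concat (σ : List Datum) (x : Datum) :
    M.hStar (σ ++ [x]) = (M.sStar σ).bind fun a => M.h (a, x) := by
  simp [hStar]

/-- `h` is the learning sequence of `M` on `T`; in particular `M` is defined on every initial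
segment of `T`. -/
def IsLearningSeq (T : ℕ → Datum) (h : ℕ → Hyp) : Prop :=
  ∀ t, M.hStar (initSeg T t) = Part.some (h t)

/-- `M` uses finitely many memory states on `T`. -/
def UsesFinitelyManyStates (T : ℕ → Datum) : Prop :=
  {q : ℕ | ∃ t, q ∈ M.sStar (initSeg T t)}.Finite

end BMSLearner

/-- A condition on a learning sequence `h` for a text `T`, given the map from indices to
languages. In the conditions below only proper hypotheses (those different from `?`) are
compared. -/
abbrev Restriction : Type := (ℕ → Set ℕ) → (ℕ → Hyp) → (ℕ → Datum) → Prop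

/-- Explanatory convergence. -/
def Ex : Restriction := fun V h T =>
  ∃ t₀ p, h t₀ = some p ∧ V p = content T ∧ ∀ t, t₀ ≤ t → h t ≠ none → h t = h t₀

/-- No restriction. -/
def NoRestriction : Restriction := fun _ _ _ => True

/-- Non-U-shaped. -/
def NU : Restriction := fun V h T =>
  ∀ r s t, r ≤ s → s ≤ t → ∀ a b c, h r = some a → h s = some b → h t = some c →
    V a = V c → V c = content T → V a = V b

/-- Decisive. -/
def Dec : Restriction := fun V h _ =>
  ∀ r s t, r ≤ s → s ≤ t → ∀ a b c, h r = some a → h s = some b → h t = some c →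
    V a = V c → V a = V b

/-- Weakly monotonic. -/
def WMon : Restriction := fun V h T =>
  ∀ s t, s ≤ t → ∀ a b, h s = some a → h t = some b →
    seqContent (initSeg T t) ⊆ V a → V a ⊆ V b

/-- Cautious. -/
def Caut : Restriction := fun V h _ =>
  ∀ s t, s ≤ t → ∀ a b, h s = some a → h t = some b → ¬ V b ⊂ V a

/-- Monotonic. -/
def Mon : Restriction := fun V h T =>
  ∀ s t, s ≤ t → ∀ a b, h s = some a → h t = some b →
    V a ∩ content T ⊆ V b ∩ content T

/-- Strongly monotonic. -/
def SMon : Restriction := fun V h _ =>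
  ∀ s t, s ≤ t → ∀ a b, h s = some a → h t = some b → V a ⊆ V b

/-- `[Txt BMS_* δ Ex]`: the collections of computably enumerable languages for which a single
bounded memory states learner, on every text for every member, uses only finitely many states,
converges explanatorily and satisfies `δ`. -/
def TxtBMSStarEx (φ : ℕ → ℕ →. ℕ) (δ : Restriction) : Set (Set (Set ℕ)) :=
  {C | (∀ L ∈ C, REPred fun n => n ∈ L) ∧
    ∃ M : BMSLearner, ∀ L ∈ C, ∀ T, IsText T L →
      M.UsesFinitelyManyStates T ∧
      ∃ h, M.IsLearningSeq T h ∧ δ (W φ) h T ∧ Ex (W φ) h T}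

end BMSLearning

namespace BMSLearning

open Encodable

/-! ### Primitive recursive list operations and approximation in stages -/

section Primitive

variable {α β : Type*} [Primcodable α] [Primcodable β]

/-! The first two claims come from one normal form, `exists_consistent_learner`: whenever a
hypothesis `b` follows a hypothesis `a`, either `W a ⊆ W b`, or some datum already seen lies outside
`W a` and belongs to `W b` and to all later hypotheses. Weak monotonicity, caution and decisiveness
are then set inclusions, and decisiveness implies non-U-shapedness.

The given learner is first made to carry its latest hypothesis in its state. The new learner
simulates not one run but a history of finite sets of states (components), any two states of a
component being connected by data for the target `L`. A datum mapping the newest component into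
itself is absorbed and need not be remembered. A datum leading out of it starts a new component or,
when an old state recurs, merges the cycle just closed. Walks through the components can be spliced
into texts for `L` (`Succeeds.of_words`), on which the given learner must succeed. Hence the history
changes only finitely often (`not_frequently_break`), and a component that absorbs `#` and all but
finitely many elements of `L` carries a correct hypothesis, provided that the exceptions can be
placed earlier in the text (`Valid.index_correct`).

Announcing that hypothesis directly would not be consistent. Instead, by the recursion theorem, each
memory gets a language that contains its stored data and admits a finite set `E` only if `#` and
every element of `E` either keep the memory or lead to a memory whose language contains `E`. So data
from the announced language can only enlarge it, and a datum outside it that changes the memory is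
stored for good (`IsTarget.step`). No correctness is lost: from the final memory, data for `L` in
any order cause only finitely many changes (`Settled.acc`), and well-founded induction shows that
the announced language is `L` (`Settled.target_eq`).

The delicate point is that this quantifies over all data for `L`, while a datum absorbed only by an
older component need not recur in the text. Such data, once the current index predicts them, are
tolerated: they are stored without changing the history. They are found by a search whose length is
the code of the current datum, which grows without bound if `L` is infinite; for finite `L`
termination holds without it.

For the strict inclusions, `lang []` is the set of even numbers, and a learner of it and of all
`lang [n]` can be led from a hypothesis for `lang []` to one for some `lang [n]`, which lacks `n +
1`. This refutes strong monotonicity, and also monotonicity if `lang [n, n + 2]`, which contains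
`lang [n]` and `n + 1`, is to be learned too. -/

theorem primrec_filter {f : α → List β} {p : α → β → Bool} (hf : Primrec f) (hp : Primrec₂ p) :
    Primrec fun a => (f a).filter (p a) := by
  have : ∀ a, (f a).filter (p a) = (f a).filterMap (fun b => cond (p a b) (some b) none) := by
    intro a
    rw [← List.filterMap_eq_filter]
    congr 1
    funext b
    cases h : p a b <;> simp [Option.guard, h]
  simp only [this]
  exact Primrec.listFilterMap hf
    (Primrec.cond hp (Primrec.option_some.comp Primrec.snd) (Primrec.const none))

theorem primrec_all {f : α → List β} {p : α → β → Bool} (hf : Primrec f) (hp : Primrec₂ p) :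
    Primrec fun a => (f a).all (p a) := by
  have h := primrec_filter hf hp
  have : Primrec fun a => decide (((f a).filter (p a)).length = (f a).length) :=
    (PrimrecRel.comp Primrec.eq (Primrec.list_length.comp h) (Primrec.list_length.comp hf)).decide
  refine this.of_eq fun a => ?_
  rw [Bool.eq_iff_iff]
  simp

theorem primrec_any {f : α → List β} {p : α → β → Bool} (hf : Primrec f) (hp : Primrec₂ p) :
    Primrec fun a => (f a).any (p a) := by
  have h : Primrec₂ fun a b => !p a b := Primrec.not.comp hp
  refine (Primrec.not.comp (primrec_all hf h)).of_eq fun a => ?_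
  rw [← List.not_any_eq_all_not, Bool.not_not]

theorem primrec_mem {f : α → β} {g : α → List β} [∀ a, Decidable (f a ∈ g a)] (hf : Primrec f)
    (hg : Primrec g) : Primrec fun a => decide (f a ∈ g a) := by
  classical
  have h : Primrec₂ fun (a : α) (b : β) => decide (b = f a) :=
    (PrimrecRel.comp Primrec.eq Primrec.snd (hf.comp Primrec.fst)).decide
  refine (primrec_any hg h).of_eq fun a => ?_
  rw [Bool.eq_iff_iff]
  simp

theorem primrec_decide_eq {f g : α → β} [∀ a, Decidable (f a = g a)] (hf : Primrec f)
    (hg : Primrec g) : Primrec fun a => decide (f a = g a) :=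
  PrimrecPred.decide (PrimrecRel.comp Primrec.eq hf hg)

theorem primrec_bite {c : α → Bool} {f g : α → β} (hc : Primrec c) (hf : Primrec f)
    (hg : Primrec g) : Primrec fun a => if c a then f a else g a :=
  (Primrec.cond hc hf hg).of_eq fun a => by cases c a <;> rfl

/-- A partial computable function has a primitive recursive, monotone approximation in stages. -/
theorem exists_stage {f : α →. ℕ} (hf : Partrec f) :
    ∃ g : ℕ → α → Option ℕ, Primrec₂ g ∧
      (∀ k k' a q, k ≤ k' → g k a = some q → g k' a = some q) ∧
      ∀ a q, q ∈ f a ↔ ∃ k, g k a = some q := by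
  obtain ⟨c, hc⟩ := Nat.Partrec.Code.exists_code.1 hf
  refine ⟨fun k a => Nat.Partrec.Code.evaln k c (encode a), ?_, ?_, ?_⟩
  · exact Nat.Partrec.Code.primrec_evaln.comp
      ((Primrec.fst.pair (Primrec.const c)).pair (Primrec.encode.comp Primrec.snd))
  · intro k k' a q hk h
    exact Nat.Partrec.Code.evaln_mono hk h
  · intro a q
    have := @Nat.Partrec.Code.evaln_complete c (encode a) q
    simp only [Option.mem_def] at this
    rw [← this, hc]
    simp

end Primitive

/-! ### The transformed transition function and its primitive recursiveness -/

section Stages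

/-- The successors of the states in `R` under `u` that are known at stage `k`. -/
def images (nx : ℕ → ℕ × Datum → Option ℕ) (k : ℕ) (R : List ℕ) (u : Datum) : List ℕ :=
  R.filterMap fun r => nx k (r, u)

/-- If `q` occurs in a component of the history (newest first), the union of all components since
the last one containing `q`. -/
def absorb (hist : List (List ℕ)) (q : ℕ) : Option (List ℕ) :=
  hist.foldr (fun R acc => if decide (q ∈ R) then some R else acc.map fun R' => R ++ R') none

/-- Enter the state `q`: start a new component, or close a cycle through older ones. -/
def push (hist : List (List ℕ)) (q : ℕ) : List (List ℕ) :=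
  (absorb hist q).getD [q] :: hist

/-- The effect of `u` on a history: no change if the newest component is closed under `u`. -/
def feed (nx : ℕ → ℕ × Datum → Option ℕ) (k : ℕ) (hist : List (List ℕ)) (u : Datum) :
    Option (List (List ℕ)) :=
  if decide ((images nx k hist.headI u).length = hist.headI.length) then
    some ((((images nx k hist.headI u).filter fun q => !decide (q ∈ hist.headI)).head?.map
      (push hist)).getD hist)
  else none

/-- Feed a list of data. -/
def feedAll (nx : ℕ → ℕ × Datum → Option ℕ) (k : ℕ) (hist : List (List ℕ)) (us : List Datum) :
    Option (List (List ℕ)) :=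
  us.foldl (fun o u => o.bind fun h => feed nx k h u) (some hist)

/-- At stage `k`, the set `R` is seen to be closed under `u`. -/
def closedAt (nx : ℕ → ℕ × Datum → Option ℕ) (k : ℕ) (R : List ℕ) (u : Datum) : Bool :=
  decide ((images nx k R u).length = R.length) && (images nx k R u).all fun q => decide (q ∈ R)

/-- At stage `k`, the set `R` is seen not to be closed under `u`. -/
def openAt (nx : ℕ → ℕ × Datum → Option ℕ) (k : ℕ) (R : List ℕ) (u : Datum) : Bool :=
  (images nx k R u).any fun q => !decide (q ∈ R)

/-- The index attached to a history. -/
def outIdx (hist : List (List ℕ)) : ℕ := hist.headI.headI.unpair.2 - 1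

/-- The data which, at stage `N`, are known to be predicted, not to be absorbed by the newest
component, and to be absorbed by some older one. -/
def tolerated (nx : ℕ → ℕ × Datum → Option ℕ) (wv : ℕ → ℕ × ℕ → Option ℕ)
    (hist : List (List ℕ)) (N : ℕ) : List Datum :=
  ((List.range N).filter fun y => (wv N (outIdx hist, y)).isSome &&
    (openAt nx N hist.headI (some y) && hist.any fun R => closedAt nx N R (some y))).map some

/-- The states of the transformed learner: a history of components, the stored data, and the
stage up to which tolerated data have been computed. -/
abbrev Memory : Type := List (List ℕ) × List Datum × ℕ

/-- The datum `x` makes new tolerated data visible. -/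
def reveals (nx : ℕ → ℕ × Datum → Option ℕ) (wv : ℕ → ℕ × ℕ → Option ℕ) (st : Memory)
    (x : Datum) : Bool :=
  (tolerated nx wv st.1 (encode x)).any fun y =>
    !decide (y ∈ tolerated nx wv st.1 st.2.2) && !decide (y ∈ st.2.1)

/-- The new memory, given the effects `h₀`, `h₁`, `h₂` of the pause symbol, of the datum `x`, and
of all data stored on the history. -/
def next (nx : ℕ → ℕ × Datum → Option ℕ) (wv : ℕ → ℕ × ℕ → Option ℕ) (st : Memory) (x : Datum)
    (h₀ h₁ h₂ : List (List ℕ)) : Memory :=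
  if !decide (h₀ = st.1) || (!decide (x ∈ st.2.1) &&
      ((!decide (h₁ = st.1) && !decide (x ∈ tolerated nx wv st.1 st.2.2)) ||
        (reveals nx wv st x && !decide (h₂ = st.1)))) then
    (h₂, x :: st.2.1, 0)
  else if !decide (x ∈ st.2.1) && (!decide (h₁ = st.1) || reveals nx wv st x) then
    (st.1, x :: st.2.1, if reveals nx wv st x then encode x else st.2.2)
  else st

/-- One step of the transformed learner, computed in `k` stages. -/
def step (nx : ℕ → ℕ × Datum → Option ℕ) (wv : ℕ → ℕ × ℕ → Option ℕ) (k : ℕ) (st : Memory)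
    (x : Datum) : Option Memory :=
  (feed nx k st.1 none).bind fun h₀ => (feed nx k st.1 x).bind fun h₁ =>
    (feedAll nx k st.1 (none :: x :: st.2.1)).map fun h₂ => next nx wv st x h₀ h₁ h₂

variable {α : Type*} [Primcodable α] {nx : ℕ → ℕ × Datum → Option ℕ}
  {wv : ℕ → ℕ × ℕ → Option ℕ}

theorem primrec_images (hnx : Primrec₂ nx) {k : α → ℕ} {R : α → List ℕ} {u : α → Datum}
    (hk : Primrec k) (hR : Primrec R) (hu : Primrec u) :
    Primrec fun a => images nx (k a) (R a) (u a) :=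
  Primrec.listFilterMap hR (hnx.comp (hk.comp Primrec.fst)
    (Primrec.snd.pair (hu.comp Primrec.fst)))

theorem primrec_absorb {h : α → List (List ℕ)} {q : α → ℕ} (hh : Primrec h) (hq : Primrec q) :
    Primrec fun a => absorb (h a) (q a) := by
  refine Primrec.list_foldr (h := fun a p =>
    if decide (q a ∈ p.1) then some p.1 else p.2.map fun R' => p.1 ++ R') hh (Primrec.const none) ?_
  refine primrec_bite (primrec_mem (hq.comp Primrec.fst) (Primrec.fst.comp Primrec.snd))
    (Primrec.option_some.comp (Primrec.fst.comp Primrec.snd)) ?_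
  exact Primrec.option_map (Primrec.snd.comp Primrec.snd) (Primrec.list_append.comp
    (Primrec.fst.comp (Primrec.snd.comp Primrec.fst)) Primrec.snd)

theorem primrec_push {h : α → List (List ℕ)} {q : α → ℕ} (hh : Primrec h) (hq : Primrec q) :
    Primrec fun a => push (h a) (q a) :=
  Primrec.list_cons.comp (Primrec.option_getD.comp (primrec_absorb hh hq)
    (Primrec.list_cons.comp hq (Primrec.const []))) hh

theorem primrec_feed (hnx : Primrec₂ nx) {k : α → ℕ} {h : α → List (List ℕ)} {u : α → Datum}
    (hk : Primrec k) (hh : Primrec h) (hu : Primrec u) :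
    Primrec fun a => feed nx (k a) (h a) (u a) := by
  have hd := Primrec.list_headI.comp hh
  have hi := primrec_images hnx hk hd hu
  refine primrec_bite (primrec_decide_eq (Primrec.list_length.comp hi)
    (Primrec.list_length.comp hd)) (Primrec.option_some.comp (Primrec.option_getD.comp
      (Primrec.option_map (Primrec.list_head?.comp (primrec_filter hi ?_)) ?_) hh))
    (Primrec.const none)
  · exact Primrec.not.comp (primrec_mem Primrec.snd (hd.comp Primrec.fst))
  · exact primrec_push (hh.comp Primrec.fst) Primrec.snd

theorem primrec_feedAll (hnx : Primrec₂ nx) {k : α → ℕ} {h : α → List (List ℕ)}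
    {us : α → List Datum} (hk : Primrec k) (hh : Primrec h) (hu : Primrec us) :
    Primrec fun a => feedAll nx (k a) (h a) (us a) := by
  refine Primrec.list_foldl (h := fun a p => p.1.bind fun h => feed nx (k a) h p.2) hu
    (Primrec.option_some.comp hh) ?_
  exact Primrec.option_bind (Primrec.fst.comp Primrec.snd)
    (primrec_feed hnx (hk.comp (Primrec.fst.comp Primrec.fst)) Primrec.snd
      (Primrec.snd.comp (Primrec.snd.comp Primrec.fst)))

theorem primrec_closedAt (hnx : Primrec₂ nx) {k : α → ℕ} {R : α → List ℕ} {u : α → Datum}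
    (hk : Primrec k) (hR : Primrec R) (hu : Primrec u) :
    Primrec fun a => closedAt nx (k a) (R a) (u a) := by
  have hi := primrec_images hnx hk hR hu
  exact Primrec.and.comp (primrec_decide_eq (Primrec.list_length.comp hi)
    (Primrec.list_length.comp hR))
    (primrec_all hi (primrec_mem Primrec.snd (hR.comp Primrec.fst)))

theorem primrec_openAt (hnx : Primrec₂ nx) {k : α → ℕ} {R : α → List ℕ} {u : α → Datum}
    (hk : Primrec k) (hR : Primrec R) (hu : Primrec u) :
    Primrec fun a => openAt nx (k a) (R a) (u a) := by
  have hi := primrec_images hnx hk hR hu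
  exact primrec_any hi (Primrec.not.comp (primrec_mem Primrec.snd (hR.comp Primrec.fst)))

theorem primrec_outIdx : Primrec outIdx :=
  Primrec.nat_sub.comp (Primrec.snd.comp (Primrec.unpair.comp
    (Primrec.list_headI.comp Primrec.list_headI))) (Primrec.const 1)

theorem primrec_tolerated (hnx : Primrec₂ nx) (hwv : Primrec₂ wv) {h : α → List (List ℕ)}
    {N : α → ℕ} (hh : Primrec h) (hN : Primrec N) :
    Primrec fun a => tolerated nx wv (h a) (N a) := by
  refine Primrec.list_map (primrec_filter (Primrec.list_range.comp hN) ?_)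
    (Primrec.option_some.comp Primrec.snd)
  have hN' : Primrec fun p : α × ℕ => N p.1 := hN.comp Primrec.fst
  have hh' : Primrec fun p : α × ℕ => h p.1 := hh.comp Primrec.fst
  have hy : Primrec fun p : α × ℕ => (some p.2 : Datum) := Primrec.option_some.comp Primrec.snd
  refine Primrec.and.comp (Primrec.option_isSome.comp (hwv.comp hN'
    ((primrec_outIdx.comp hh').pair Primrec.snd))) (Primrec.and.comp
      (primrec_openAt hnx hN' (Primrec.list_headI.comp hh') hy) (primrec_any hh' ?_))
  exact primrec_closedAt hnx (hN'.comp Primrec.fst) Primrec.snd (hy.comp Primrec.fst)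

theorem primrec_reveals (hnx : Primrec₂ nx) (hwv : Primrec₂ wv) {s : α → Memory}
    {x : α → Datum} (hs : Primrec s) (hx : Primrec x) :
    Primrec fun a => reveals nx wv (s a) (x a) := by
  have h1 : Primrec fun a => (s a).1 := Primrec.fst.comp hs
  have h2 : Primrec fun a => (s a).2.1 := Primrec.fst.comp (Primrec.snd.comp hs)
  have h3 : Primrec fun a => (s a).2.2 := Primrec.snd.comp (Primrec.snd.comp hs)
  refine primrec_any (primrec_tolerated hnx hwv h1 (Primrec.encode.comp hx)) ?_
  exact Primrec.and.comp
    (Primrec.not.comp (primrec_mem Primrec.snd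
      ((primrec_tolerated hnx hwv h1 h3).comp Primrec.fst)))
    (Primrec.not.comp (primrec_mem Primrec.snd (h2.comp Primrec.fst)))

theorem primrec_next (hnx : Primrec₂ nx) (hwv : Primrec₂ wv) {s : α → Memory} {x : α → Datum}
    {h₀ h₁ h₂ : α → List (List ℕ)} (hs : Primrec s) (hx : Primrec x) (hh₀ : Primrec h₀)
    (hh₁ : Primrec h₁) (hh₂ : Primrec h₂) :
    Primrec fun a => next nx wv (s a) (x a) (h₀ a) (h₁ a) (h₂ a) := by
  have h1 : Primrec fun a => (s a).1 := Primrec.fst.comp hs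
  have h2 : Primrec fun a => (s a).2.1 := Primrec.fst.comp (Primrec.snd.comp hs)
  have h3 : Primrec fun a => (s a).2.2 := Primrec.snd.comp (Primrec.snd.comp hs)
  have ht := primrec_tolerated hnx hwv h1 h3
  have hr := primrec_reveals hnx hwv hs hx
  have e0 := Primrec.not.comp (primrec_decide_eq hh₀ h1)
  have e1 := Primrec.not.comp (primrec_decide_eq hh₁ h1)
  have e2 := Primrec.not.comp (primrec_decide_eq hh₂ h1)
  have m1 := Primrec.not.comp (primrec_mem hx h2)
  have m2 := Primrec.not.comp (primrec_mem hx ht)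
  refine primrec_bite (Primrec.or.comp e0 (Primrec.and.comp m1 (Primrec.or.comp
    (Primrec.and.comp e1 m2) (Primrec.and.comp hr e2))))
    (hh₂.pair ((Primrec.list_cons.comp hx h2).pair (Primrec.const 0)))
    (primrec_bite (Primrec.and.comp m1 (Primrec.or.comp e1 hr))
      (h1.pair ((Primrec.list_cons.comp hx h2).pair
        (primrec_bite hr (Primrec.encode.comp hx) h3))) hs)

/-- The stage bound makes the step total, so that it can be used both in an unbounded search and
inside the self-referential definition of the announced languages. -/
theorem primrec_step (hnx : Primrec₂ nx) (hwv : Primrec₂ wv) {k : α → ℕ} {s : α → Memory}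
    {x : α → Datum} (hk : Primrec k) (hs : Primrec s) (hx : Primrec x) :
    Primrec fun a => step nx wv (k a) (s a) (x a) := by
  have h1 : Primrec fun a => (s a).1 := Primrec.fst.comp hs
  have h2 : Primrec fun a => (s a).2.1 := Primrec.fst.comp (Primrec.snd.comp hs)
  have f0 := primrec_feed hnx hk h1 (Primrec.const none)
  have f1 := primrec_feed hnx hk h1 hx
  have f2 := primrec_feedAll hnx hk h1 (Primrec.list_cons.comp (Primrec.const (none : Datum))
    (Primrec.list_cons.comp hx h2))
  refine Primrec.option_bind f0 (Primrec.option_bind (f1.comp Primrec.fst) (Primrec.option_map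
    (f2.comp (Primrec.fst.comp Primrec.fst)) ?_))
  exact primrec_next hnx hwv (hs.comp (Primrec.fst.comp (Primrec.fst.comp Primrec.fst)))
    (hx.comp (Primrec.fst.comp (Primrec.fst.comp Primrec.fst)))
    (Primrec.snd.comp (Primrec.fst.comp Primrec.fst)) (Primrec.snd.comp Primrec.fst) Primrec.snd

end Stages

end BMSLearning

namespace BMSLearning

open Encodable

/-! ### Runs, and texts assembled from words -/

section Runs

/-- `w` leads from `q` to `q'`. -/
def Run (tr : ℕ × Datum →. ℕ) : ℕ → List Datum → ℕ → Prop
  | q, [], q' => q = q'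
  | q, x :: w, q' => ∃ q₁ ∈ tr (q, x), Run tr q₁ w q'

/-- `x` may occur in a text for `L`. -/
def Legal (L : Set ℕ) (x : Datum) : Prop := ∀ n, x = some n → n ∈ L

/-- `q'` can be reached from `q` by data for `L`. -/
def Conn (tr : ℕ × Datum →. ℕ) (L : Set ℕ) (q q' : ℕ) : Prop :=
  ∃ w : List Datum, (∀ x ∈ w, Legal L x) ∧ Run tr q w q'

/-- `r` is visited on the way along `w` from `p`. -/
def Visited (tr : ℕ × Datum →. ℕ) (p : ℕ) (w : List Datum) (r : ℕ) : Prop :=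
  ∃ w₁ w₂, w = w₁ ++ w₂ ∧ Run tr p w₁ r

/-- `R` is closed under `u`. -/
def Closed (tr : ℕ × Datum →. ℕ) (R : List ℕ) (u : Datum) : Prop :=
  ∀ r ∈ R, ∃ q ∈ tr (r, u), q ∈ R

/-- `tr` converges to a correct output on every text for `L`, visiting finitely many states. -/
def Succeeds (φ : ℕ → ℕ →. ℕ) (tr : ℕ × Datum →. ℕ) (L : Set ℕ) : Prop :=
  ∀ T, IsText T L → ∃ q : ℕ → ℕ, q 0 = 0 ∧ (∀ t, q (t + 1) ∈ tr (q t, T t)) ∧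
    (Set.range q).Finite ∧ ∃ e t₀, W φ e = L ∧ ∀ t, t₀ ≤ t → (q t).unpair.2 = e + 1

variable {φ : ℕ → ℕ →. ℕ} {tr : ℕ × Datum →. ℕ} {L : Set ℕ}

theorem legal_none : Legal L none := fun _ h => by cases h

theorem legal_some {n : ℕ} : Legal L (some n) ↔ n ∈ L :=
  ⟨fun h => h n rfl, fun h m hm => by cases hm; exact h⟩

theorem Run.append {q q' q'' : ℕ} {w w' : List Datum} (h : Run tr q w q')
    (h' : Run tr q' w' q'') : Run tr q (w ++ w') q'' := by
  induction w generalizing q with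
  | nil => cases h; exact h'
  | cons x w ih => obtain ⟨q₁, h₁, h₂⟩ := h; exact ⟨q₁, h₁, ih h₂⟩

theorem run_append {q q'' : ℕ} {w w' : List Datum} :
    Run tr q (w ++ w') q'' ↔ ∃ q', Run tr q w q' ∧ Run tr q' w' q'' := by
  refine ⟨fun h => ?_, fun ⟨q', h, h'⟩ => h.append h'⟩
  induction w generalizing q with
  | nil => exact ⟨q, rfl, h⟩
  | cons x w ih =>
    obtain ⟨q₁, h₁, h₂⟩ := h
    obtain ⟨q', h₃, h₄⟩ := ih h₂
    exact ⟨q', ⟨q₁, h₁, h₃⟩, h₄⟩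

theorem run_singleton {q q' : ℕ} {x : Datum} : Run tr q [x] q' ↔ q' ∈ tr (q, x) := by
  simp [Run]

theorem Run.unique {q a b : ℕ} {w : List Datum} (h : Run tr q w a) (h' : Run tr q w b) :
    a = b := by
  induction w generalizing q with
  | nil => cases h; exact h'
  | cons x w ih =>
    obtain ⟨q₁, h₁, h₂⟩ := h
    obtain ⟨q₂, h₃, h₄⟩ := h'
    obtain rfl := Part.mem_unique h₁ h₃
    exact ih h₂ h₄

theorem Conn.refl (q : ℕ) : Conn tr L q q := ⟨[], by simp, rfl⟩

theorem Conn.trans {a b c : ℕ} (h : Conn tr L a b) (h' : Conn tr L b c) : Conn tr L a c := by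
  obtain ⟨w, h₁, h₂⟩ := h
  obtain ⟨w', h₃, h₄⟩ := h'
  refine ⟨w ++ w', ?_, h₂.append h₄⟩
  intro x hx
  rcases List.mem_append.1 hx with hx | hx
  exacts [h₁ x hx, h₃ x hx]

theorem Conn.single {q q' : ℕ} {x : Datum} (hx : Legal L x) (h : q' ∈ tr (q, x)) :
    Conn tr L q q' :=
  ⟨[x], by simpa using hx, run_singleton.2 h⟩

theorem Visited.append_left {p r : ℕ} {w w' : List Datum} (h : Visited tr p w r) :
    Visited tr p (w ++ w') r := by
  obtain ⟨w₁, w₂, rfl, h⟩ := h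
  exact ⟨w₁, w₂ ++ w', by simp, h⟩

theorem Visited.append_right {p p' r : ℕ} {w w' : List Datum} (h : Run tr p w p')
    (h' : Visited tr p' w' r) : Visited tr p (w ++ w') r := by
  obtain ⟨w₁, w₂, rfl, h'⟩ := h'
  exact ⟨w ++ w₁, w₂, by simp, h.append h'⟩

theorem initSeg_length (T : ℕ → Datum) (t : ℕ) : (initSeg T t).length = t := by simp [initSeg]

theorem initSeg_succ (T : ℕ → Datum) (t : ℕ) : initSeg T (t + 1) = initSeg T t ++ [T t] := by
  simp [initSeg, List.range_succ]

theorem run_initSeg {T : ℕ → Datum} {q : ℕ → ℕ} (h0 : q 0 = 0)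
    (hq : ∀ t, q (t + 1) ∈ tr (q t, T t)) (t : ℕ) : Run tr 0 (initSeg T t) (q t) := by
  induction t with
  | zero => exact h0.symm
  | succ t ih => rw [initSeg_succ]; exact ih.append (run_singleton.2 (hq t))

/-- Every legal sequence is an initial segment of a text. -/
theorem exists_text_extending (w : List Datum) (hw : ∀ x ∈ w, Legal L x) :
    ∃ T, IsText T L ∧ initSeg T w.length = w := by
  classical
  -- After `w`, position `w.length + n` carries `n` if `n ∈ L`, and `#` otherwise.
  refine ⟨fun t => if h : t < w.length then w[t] else
    if t - w.length ∈ L then some (t - w.length) else none, ?_, ?_⟩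
  · ext n
    constructor
    · rintro ⟨t, ht⟩
      dsimp only at ht
      split_ifs at ht with h h'
      · exact hw _ (List.getElem_mem h) n ht
      · cases ht; exact h'
    · intro hn
      refine ⟨w.length + n, ?_⟩
      simp [hn]
  · apply List.ext_getElem
    · simp [initSeg]
    · intro i h1 h2
      simp [initSeg, h2]

theorem Succeeds.exists_run (hS : Succeeds φ tr L) (w : List Datum) (hw : ∀ x ∈ w, Legal L x) :
    ∃ q, Run tr 0 w q := by
  obtain ⟨T, hT, hTw⟩ := exists_text_extending w hw
  obtain ⟨q, h0, hq, -⟩ := hS T hT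
  exact ⟨q w.length, by simpa [hTw] using run_initSeg h0 hq w.length⟩

/-- A word reaching `r`, followed by `x`, begins some text for `L`, and the learner must be defined
along it. -/
theorem Succeeds.exists_next (hS : Succeeds φ tr L) {r : ℕ} (hr : Conn tr L 0 r) {x : Datum}
    (hx : Legal L x) : ∃ q, q ∈ tr (r, x) := by
  obtain ⟨w, hw, hwr⟩ := hr
  obtain ⟨q, hq⟩ := hS.exists_run (w ++ [x]) (by
    intro y hy
    rcases List.mem_append.1 hy with hy | hy
    · exact hw y hy
    · simp only [List.mem_singleton] at hy; exact hy ▸ hx)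
  obtain ⟨q', h1, h2⟩ := run_append.1 hq
  obtain rfl := hwr.unique h1
  exact ⟨q, run_singleton.1 h2⟩

/-- The concatenation of the first `n` words. -/
def concat (u : ℕ → List Datum) (n : ℕ) : List Datum := ((List.range n).map u).flatten

theorem concat_succ (u : ℕ → List Datum) (n : ℕ) : concat u (n + 1) = concat u n ++ u n := by
  simp [concat, List.range_succ]

theorem concat_prefix (u : ℕ → List Datum) {m n : ℕ} (h : m ≤ n) : concat u m <+: concat u n := by
  induction n, h using Nat.le_induction with
  | base => exact List.prefix_rfl
  | succ n _ ih => exact ih.trans (by rw [concat_succ]; exact List.prefix_append _ _)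

theorem le_length_concat {u : ℕ → List Datum} (hu : ∀ n, u n ≠ []) (n : ℕ) :
    n ≤ (concat u n).length := by
  induction n with
  | zero => simp
  | succ n ih =>
    rw [concat_succ, List.length_append]
    have := List.length_pos_iff.2 (hu n)
    omega

/-- Nonempty legal words covering `L` can be concatenated to a text. -/
theorem Succeeds.of_words (hS : Succeeds φ tr L) {u : ℕ → List Datum} {p : ℕ → ℕ}
    (hu : ∀ n, u n ≠ []) (hL : ∀ n, ∀ x ∈ u n, Legal L x)
    (hcov : ∀ l ∈ L, ∃ n, some l ∈ u n) (hp : p 0 = 0) (hrun : ∀ n, Run tr (p n) (u n) (p (n + 1))) :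
    ∃ S : Set ℕ, S.Finite ∧ (∀ n r, Visited tr (p n) (u n) r → r ∈ S) ∧
      ∃ e n₀, W φ e = L ∧ ∀ n, n₀ ≤ n → (p n).unpair.2 = e + 1 := by
  have hlen := le_length_concat hu
  have hget : ∀ i, i < (concat u (i + 1)).length := fun i => hlen (i + 1)
  -- As no word is empty, the first `i + 1` words have more than `i` symbols, and position `i` is
  -- the same in all longer concatenations.
  let T : ℕ → Datum := fun i => (concat u (i + 1))[i]'(hget i)
  have hTn : ∀ n, initSeg T (concat u n).length = concat u n := by
    intro n
    apply List.ext_getElem (by simp [initSeg])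
    intro i h1 h2
    simp only [initSeg, List.getElem_map, List.getElem_range, T]
    rcases le_total (i + 1) n with h | h
    · exact (concat_prefix u h).getElem _
    · exact ((concat_prefix u h).getElem _).symm
  have hmem : ∀ n, ∀ x ∈ concat u n, ∃ i, x ∈ u i := by
    intro n x hx
    simp only [concat, List.mem_flatten, List.mem_map, List.mem_range] at hx
    obtain ⟨l, ⟨i, -, rfl⟩, hx⟩ := hx
    exact ⟨i, hx⟩
  have hT : IsText T L := by
    ext l
    constructor
    · rintro ⟨t, ht⟩
      obtain ⟨i, hi⟩ := hmem (t + 1) (T t) (List.getElem_mem _)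
      exact hL i _ hi l ht
    · intro hl
      obtain ⟨n, hn⟩ := hcov l hl
      have : some l ∈ initSeg T (concat u (n + 1)).length := by
        rw [hTn, concat_succ]; exact List.mem_append_right _ hn
      simp only [initSeg, List.mem_map] at this
      obtain ⟨t, -, ht⟩ := this
      exact ⟨t, ht⟩
  obtain ⟨q, h0, hq, hfin, e, t₀, he, ht₀⟩ := hS T hT
  have hrq : ∀ w w' n, concat u n = w ++ w' → Run tr 0 w (q w.length) := by
    intro w w' n h
    have h1 := run_initSeg h0 hq w.length
    have h2 : initSeg T w.length = w := by
      have h3 : initSeg T w.length <+: initSeg T (concat u n).length := by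
        rw [h]
        simp only [initSeg, List.length_append, List.range_add, List.map_append]
        exact List.prefix_append _ _
      rw [hTn] at h3
      have h4 : w <+: concat u n := by rw [h]; exact List.prefix_append _ _
      exact (List.prefix_of_prefix_length_le h3 h4 (by simp [initSeg])).eq_of_length
        (by simp [initSeg])
    rwa [h2] at h1
  have hpn : ∀ n, Run tr 0 (concat u n) (p n) := by
    intro n
    induction n with
    | zero => exact hp.symm
    | succ n ih => rw [concat_succ]; exact ih.append (hrun n)
  refine ⟨Set.range q, hfin, ?_, e, t₀, he, ?_⟩
  · rintro n r ⟨w₁, w₂, hw, hr⟩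
    have h1 := (hpn n).append hr
    have h2 := hrq (concat u n ++ w₁) w₂ (n + 1) (by rw [concat_succ, hw, List.append_assoc])
    exact ⟨_, h2.unique h1⟩
  · intro n hn
    have h1 := hrq (concat u n) [] n (by simp)
    rw [(hpn n).unique h1]
    exact ht₀ _ (hn.trans (hlen n))

end Runs

end BMSLearning

namespace BMSLearning

open Encodable

/-- `nx` approximates the transition function `tr` in stages. -/
structure IsStage (nx : ℕ → ℕ × Datum → Option ℕ) (tr : ℕ × Datum →. ℕ) : Prop where
  mono : ∀ k k' a q, k ≤ k' → nx k a = some q → nx k' a = some q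
  spec : ∀ a q, q ∈ tr a ↔ ∃ k, nx k a = some q

/-! ### Histories of components -/

section Histories

variable {φ : ℕ → ℕ →. ℕ} {tr : ℕ × Datum →. ℕ} {L : Set ℕ} {nx : ℕ → ℕ × Datum → Option ℕ}

/-- Comparing lengths is the decidable test that all successors of a component are known at the
current stage. -/
theorem length_filterMap_eq {α β : Type*} (f : α → Option β) (l : List α) :
    (l.filterMap f).length = l.length ↔ ∀ a ∈ l, ∃ b, f a = some b := by
  induction l with
  | nil => simp
  | cons a l ih =>
    cases h : f a with
    | none =>
      have := List.length_filterMap_le f l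
      simp only [List.filterMap_cons, h, List.length_cons, List.mem_cons, forall_eq_or_imp]
      constructor
      · intro h'; omega
      · rintro ⟨⟨b, hb⟩, -⟩; cases hb
    | some b => simp [h, ih]

theorem mem_images {k : ℕ} {R : List ℕ} {u : Datum} {q : ℕ} :
    q ∈ images nx k R u ↔ ∃ r ∈ R, nx k (r, u) = some q := by
  simp [images]

theorem length_images {k : ℕ} {R : List ℕ} {u : Datum} :
    (images nx k R u).length = R.length ↔ ∀ r ∈ R, ∃ q, nx k (r, u) = some q :=
  length_filterMap_eq _ _

theorem feed_eq_some {k : ℕ} {hist h' : List (List ℕ)} {u : Datum} :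
    feed nx k hist u = some h' ↔ (∀ r ∈ hist.headI, ∃ q, nx k (r, u) = some q) ∧
      ((((images nx k hist.headI u).filter fun q => !decide (q ∈ hist.headI)).head?.map
      (push hist)).getD hist) = h' := by
  unfold feed
  rw [← length_images]
  split_ifs with h <;> simp_all

theorem images_mono (hst : IsStage nx tr) {k k' : ℕ} (hk : k ≤ k') {R : List ℕ} {u : Datum}
    (h : ∀ r ∈ R, ∃ q, nx k (r, u) = some q) : images nx k' R u = images nx k R u := by
  apply List.filterMap_congr
  intro r hr
  obtain ⟨q, hq⟩ := h r hr
  rw [hq, hst.mono k k' _ _ hk hq]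

/-- No result is given before all successors of the newest component are known, so later stages
cannot revise which state is chosen to leave it. -/
theorem feed_mono (hst : IsStage nx tr) {k k' : ℕ} (hk : k ≤ k') {hist h' : List (List ℕ)}
    {u : Datum} (h : feed nx k hist u = some h') : feed nx k' hist u = some h' := by
  rw [feed_eq_some] at h ⊢
  refine ⟨fun r hr => ?_, ?_⟩
  · obtain ⟨q, hq⟩ := h.1 r hr
    exact ⟨q, hst.mono k k' _ _ hk hq⟩
  · rw [images_mono hst hk h.1]; exact h.2

theorem feed_spec (hst : IsStage nx tr) {k : ℕ} {hist h' : List (List ℕ)} {u : Datum}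
    (h : feed nx k hist u = some h') : (h' = hist ∧ Closed tr hist.headI u) ∨
      ∃ r ∈ hist.headI, ∃ q ∈ tr (r, u), q ∉ hist.headI ∧ h' = push hist q := by
  rw [feed_eq_some] at h
  obtain ⟨h1, h2⟩ := h
  cases hh : ((images nx k hist.headI u).filter fun q => !decide (q ∈ hist.headI)).head? with
  | none =>
    rw [hh] at h2
    refine Or.inl ⟨h2.symm, fun r hr => ?_⟩
    rw [List.head?_eq_none_iff, List.filter_eq_nil_iff] at hh
    obtain ⟨q, hq⟩ := h1 r hr
    refine ⟨q, (hst.spec _ _).2 ⟨k, hq⟩, ?_⟩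
    simpa using hh q (mem_images.2 ⟨r, hr, hq⟩)
  | some q =>
    rw [hh] at h2
    have h3 := List.mem_of_mem_head? hh
    simp only [List.mem_filter, Bool.not_eq_eq_eq_not, Bool.not_true, decide_eq_false_iff_not] at h3
    obtain ⟨r, hr, hq⟩ := mem_images.1 h3.1
    exact Or.inr ⟨r, hr, q, (hst.spec _ _).2 ⟨k, hq⟩, h3.2, h2.symm⟩

theorem exists_stage_forall (hst : IsStage nx tr) {R : List ℕ} {u : Datum}
    (h : ∀ r ∈ R, ∃ q, q ∈ tr (r, u)) : ∃ k, ∀ k', k ≤ k' → ∀ r ∈ R, ∃ q, nx k' (r, u) = some q := by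
  induction R with
  | nil => exact ⟨0, by simp⟩
  | cons r R ih =>
    obtain ⟨k, hk⟩ := ih fun r hr => h r (List.mem_cons_of_mem _ hr)
    obtain ⟨q, hq⟩ := h r (List.mem_cons_self ..)
    obtain ⟨k', hk'⟩ := (hst.spec _ _).1 hq
    refine ⟨max k k', fun m hm r' hr' => ?_⟩
    rcases List.mem_cons.1 hr' with rfl | hr'
    · exact ⟨q, hst.mono _ _ _ _ (by omega) hk'⟩
    · exact hk m (by omega) r' hr'

theorem exists_feed (hst : IsStage nx tr) {hist : List (List ℕ)} {u : Datum}
    (h : ∀ r ∈ hist.headI, ∃ q, q ∈ tr (r, u)) : ∃ k h', feed nx k hist u = some h' := by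
  obtain ⟨k, hk⟩ := exists_stage_forall hst h
  exact ⟨k, _, feed_eq_some.2 ⟨hk k le_rfl, rfl⟩⟩

theorem feedAll_cons {k : ℕ} {hist : List (List ℕ)} {u : Datum} {us : List Datum} :
    feedAll nx k hist (u :: us) = (feed nx k hist u).bind fun h => feedAll nx k h us := by
  simp only [feedAll, List.foldl_cons, Option.bind_some]
  cases feed nx k hist u with
  | some h => rfl
  | none =>
    simp only [Option.bind_none]
    induction us with
    | nil => rfl
    | cons u us ih => simpa using ih

theorem feedAll_mono (hst : IsStage nx tr) {k k' : ℕ} (hk : k ≤ k') {us : List Datum}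
    {hist h' : List (List ℕ)} (h : feedAll nx k hist us = some h') :
    feedAll nx k' hist us = some h' := by
  induction us generalizing hist with
  | nil => exact h
  | cons u us ih =>
    rw [feedAll_cons, Option.bind_eq_some_iff] at h ⊢
    obtain ⟨h1, h2, h3⟩ := h
    exact ⟨h1, feed_mono hst hk h2, ih h3⟩

theorem push_length (hist : List (List ℕ)) (q : ℕ) :
    (push hist q).length = hist.length + 1 := rfl

theorem feed_length (hst : IsStage nx tr) {k : ℕ} {hist h' : List (List ℕ)} {u : Datum}
    (h : feed nx k hist u = some h') : h' = hist ∧ Closed tr hist.headI u ∨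
      h' ≠ hist ∧ ¬ Closed tr hist.headI u ∧ hist.length < h'.length := by
  rcases feed_spec hst h with h | ⟨r, hr, q, hq, hq', rfl⟩
  · exact Or.inl h
  · refine Or.inr ⟨fun h => ?_, fun h => ?_, by simp [push_length]⟩
    · have := congrArg List.length h
      simp [push_length] at this
    · obtain ⟨q', h1, h2⟩ := h r hr
      exact hq' (Part.mem_unique hq h1 ▸ h2)

theorem feed_eq_self_iff (hst : IsStage nx tr) {k : ℕ} {hist h' : List (List ℕ)} {u : Datum}
    (h : feed nx k hist u = some h') : h' = hist ↔ Closed tr hist.headI u := by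
  rcases feed_length hst h with h | h <;> tauto

/-- Every push lengthens the history, so the history is unchanged only if nothing was pushed, that
is, if each datum is absorbed by the original newest component. -/
theorem feedAll_length (hst : IsStage nx tr) {k : ℕ} {us : List Datum} {hist h' : List (List ℕ)}
    (h : feedAll nx k hist us = some h') : hist.length ≤ h'.length ∧
      (h' = hist ↔ ∀ u ∈ us, Closed tr hist.headI u) := by
  induction us generalizing hist with
  | nil => cases h; simp
  | cons u us ih =>
    rw [feedAll_cons, Option.bind_eq_some_iff] at h
    obtain ⟨h1, h2, h3⟩ := h
    obtain ⟨h4, h5⟩ := ih h3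
    rcases feed_length hst h2 with ⟨rfl, h⟩ | ⟨ha, hb, hc⟩
    · refine ⟨h4, h5.trans ?_⟩
      simp [h]
    · refine ⟨by omega, ?_⟩
      constructor
      · rintro rfl; omega
      · intro h; exact absurd (h u (List.mem_cons_self ..)) hb

/-! ### Absorption -/

theorem absorb_cons (R : List ℕ) (hist : List (List ℕ)) (q : ℕ) : absorb (R :: hist) q =
    if q ∈ R then some R else (absorb hist q).map fun R' => R ++ R' := by
  simp [absorb]

theorem absorb_eq_none {hist : List (List ℕ)} {q : ℕ} (h : absorb hist q = none) :
    ∀ R ∈ hist, q ∉ R := by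
  induction hist with
  | nil => simp
  | cons R hist ih =>
    rw [absorb_cons] at h
    split_ifs at h with hq
    simp only [Option.map_eq_none_iff] at h
    simp only [List.mem_cons, forall_eq_or_imp]
    exact ⟨hq, ih h⟩

theorem absorb_eq_some {hist : List (List ℕ)} {q : ℕ} {R' : List ℕ} (h : absorb hist q = some R') :
    q ∈ R' ∧ (∀ r ∈ R', ∃ R ∈ hist, r ∈ R) ∧ ∀ r ∈ hist.headI, r ∈ R' := by
  induction hist generalizing R' with
  | nil => simp [absorb] at h
  | cons R hist ih =>
    rw [absorb_cons] at h
    split_ifs at h with hq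
    · cases h
      exact ⟨hq, fun r hr => ⟨R, List.mem_cons_self .., hr⟩, fun r hr => hr⟩
    · rw [Option.map_eq_some_iff] at h
      obtain ⟨R'', h1, rfl⟩ := h
      obtain ⟨h2, h3, -⟩ := ih h1
      refine ⟨List.mem_append_right _ h2, fun r hr => ?_, fun r hr => List.mem_append_left _ hr⟩
      rcases List.mem_append.1 hr with hr | hr
      · exact ⟨R, List.mem_cons_self .., hr⟩
      · obtain ⟨R₁, h4, h5⟩ := h3 r hr
        exact ⟨R₁, List.mem_cons_of_mem _ h4, h5⟩

/-- Older components lead to newer ones, so a state `q` of an older component reaches every state of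
the components collected since then. Together with a step from the newest component to `q`, this
makes the union strongly connected. -/
theorem absorb_conn {hist : List (List ℕ)} {q : ℕ} {R' : List ℕ}
    (hin : ∀ R ∈ hist, ∀ r ∈ R, ∀ r' ∈ R, Conn tr L r r')
    (hpw : hist.Pairwise fun R R' => ∀ r ∈ R, ∀ r' ∈ R', Conn tr L r' r)
    (h : absorb hist q = some R') : ∀ r ∈ R', Conn tr L q r := by
  induction hist generalizing R' with
  | nil => simp [absorb] at h
  | cons R hist ih =>
    rw [absorb_cons] at h
    split_ifs at h with hq
    · cases h
      exact fun r hr => hin R (List.mem_cons_self ..) q hq r hr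
    · rw [Option.map_eq_some_iff] at h
      obtain ⟨R'', h1, rfl⟩ := h
      rw [List.pairwise_cons] at hpw
      intro r hr
      rcases List.mem_append.1 hr with hr | hr
      · obtain ⟨h2, h3, -⟩ := absorb_eq_some h1
        obtain ⟨R₁, h4, h5⟩ := h3 q h2
        exact hpw.1 R₁ h4 r hr q h5
      · exact ih (fun R hR => hin R (List.mem_cons_of_mem _ hR)) hpw.2 h1 r hr

theorem push_headI (hist : List (List ℕ)) (q : ℕ) :
    (push hist q).headI = (absorb hist q).getD [q] := rfl

theorem mem_push_headI (hist : List (List ℕ)) (q : ℕ) : q ∈ (push hist q).headI := by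
  rw [push_headI]
  cases h : absorb hist q with
  | none => simp
  | some R' => exact (absorb_eq_some h).1

theorem push_headI_subset {hist : List (List ℕ)} {q r : ℕ} (hr : r ∈ (push hist q).headI) :
    r = q ∨ ∃ R ∈ hist, r ∈ R := by
  rw [push_headI] at hr
  cases h : absorb hist q with
  | none => rw [h] at hr; left; simpa using hr
  | some R' => rw [h] at hr; exact Or.inr ((absorb_eq_some h).2.1 r hr)

/-! ### Valid histories -/

/-- A history that arises from data for `L`; `D` are stored data. -/
structure Valid (tr : ℕ × Datum →. ℕ) (L : Set ℕ) (hist : List (List ℕ)) (D : List Datum) :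
    Prop where
  ne : hist.headI ≠ []
  ne' : hist ≠ []
  inner : ∀ R ∈ hist, ∀ r ∈ R, ∀ r' ∈ R, Conn tr L r r'
  pairwise : hist.Pairwise fun R R' => ∀ r ∈ R, ∀ r' ∈ R', Conn tr L r' r
  reach : ∀ R ∈ hist, ∀ r ∈ R, Conn tr L 0 r
  legal : ∀ d ∈ D, Legal L d
  cover : ∀ B : List Datum, (∀ b ∈ B, Legal L b ∧ (b ∈ D ∨ ∃ R ∈ hist, Closed tr R b)) →
    ∃ r ∈ hist.headI, ∃ w, (∀ x ∈ w, Legal L x) ∧ Run tr 0 w r ∧ ∀ b ∈ B, b ∈ w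

variable {hist : List (List ℕ)} {D : List Datum}

theorem headI_mem (h : hist ≠ []) : hist.headI ∈ hist := by
  cases hist with
  | nil => exact absurd rfl h
  | cons R hist => exact List.mem_cons_self ..

theorem Valid.headI_mem (h : Valid tr L hist D) : hist.headI ∈ hist := BMSLearning.headI_mem h.ne'

theorem Valid.conn_headI (h : Valid tr L hist D) {R : List ℕ} (hR : R ∈ hist) {r r' : ℕ}
    (hr : r ∈ R) (hr' : r' ∈ hist.headI) : Conn tr L r r' := by
  have hpw := h.pairwise
  have hin := h.inner
  cases hist with
  | nil => simp at hR
  | cons R₀ hist =>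
    rcases List.mem_cons.1 hR with rfl | hR
    · exact hin _ (List.mem_cons_self ..) r hr r' hr'
    · exact (List.pairwise_cons.1 hpw).1 R hR r' hr' r hr

/-- Feeding data under which `R` is closed keeps the state in `R`. -/
theorem exists_run_closed {R : List ℕ} {B : List Datum} (hB : ∀ b ∈ B, Closed tr R b) {r : ℕ}
    (hr : r ∈ R) : ∃ r' ∈ R, Run tr r B r' := by
  induction B generalizing r with
  | nil => exact ⟨r, hr, rfl⟩
  | cons b B ih =>
    obtain ⟨q, hq, hqR⟩ := hB b (List.mem_cons_self ..) r hr
    obtain ⟨r', hr', h⟩ := ih (fun b hb => hB b (List.mem_cons_of_mem _ hb)) hqR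
    exact ⟨r', hr', q, hq, h⟩

/-- The invariant `cover` treats stored and absorbed data alike, so storing an absorbed datum
demands nothing new. -/
theorem Valid.stored (h : Valid tr L hist D) {u : Datum} (hu : Legal L u)
    (hc : ∃ R ∈ hist, Closed tr R u) : Valid tr L hist (u :: D) where
  ne := h.ne
  ne' := h.ne'
  inner := h.inner
  pairwise := h.pairwise
  reach := h.reach
  legal := by simpa using ⟨hu, h.legal⟩
  cover := by
    intro B hB
    refine h.cover B fun b hb => ⟨(hB b hb).1, ?_⟩
    rcases (hB b hb).2 with hbD | hbR
    · rcases List.mem_cons.1 hbD with rfl | hbD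
      exacts [Or.inr hc, Or.inl hbD]
    · exact Or.inr hbR

theorem Valid.subset {D' : List Datum} (h : Valid tr L hist D) (hD : ∀ d ∈ D', d ∈ D) :
    Valid tr L hist D' where
  ne := h.ne
  ne' := h.ne'
  inner := h.inner
  pairwise := h.pairwise
  reach := h.reach
  legal := fun d hd => h.legal d (hD d hd)
  cover := by
    intro B hB
    refine h.cover B fun b hb => ⟨(hB b hb).1, ?_⟩
    rcases (hB b hb).2 with hbD | hbR
    · exact Or.inl (hD b hbD)
    · exact Or.inr hbR

/-- All old states lead to `r`, hence to `q`, and `q` leads to every state of the component it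
enters. This yields connectedness. -/
theorem Valid.push (h : Valid tr L hist D) {u : Datum} (hu : Legal L u) {r q : ℕ}
    (hr : r ∈ hist.headI) (hq : q ∈ tr (r, u)) :
    Valid tr L (push hist q) (u :: D) := by
  have hrq : Conn tr L r q := Conn.single hu hq
  have hqr' : ∀ r' ∈ (BMSLearning.push hist q).headI, Conn tr L q r' := by
    intro r' hr'
    rw [push_headI] at hr'
    cases ha : absorb hist q with
    | none =>
      rw [ha] at hr'
      obtain rfl : r' = q := by simpa using hr'
      exact Conn.refl _
    | some R' =>
      rw [ha] at hr'
      exact absorb_conn h.inner h.pairwise ha r' hr'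
  have hsr' : ∀ R ∈ hist, ∀ s ∈ R, ∀ r' ∈ (BMSLearning.push hist q).headI, Conn tr L s r' :=
    fun R hR s hs r' hr' => ((h.conn_headI hR hs hr).trans hrq).trans (hqr' r' hr')
  refine ⟨fun he => ?_, by simp [BMSLearning.push], ?_, ?_, ?_, ?_, ?_⟩
  · have := mem_push_headI hist q
    rw [he] at this
    simp at this
  · intro R hR s hs s' hs'
    rcases List.mem_cons.1 hR with rfl | hR
    · rcases push_headI_subset (hist := hist) hs with rfl | ⟨R₁, h1, h2⟩
      · exact hqr' s' hs'
      · exact hsr' R₁ h1 s h2 s' hs'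
    · exact h.inner R hR s hs s' hs'
  · refine List.pairwise_cons.2 ⟨fun R hR r' hr' s hs => hsr' R hR s hs r' hr', h.pairwise⟩
  · intro R hR s hs
    rcases List.mem_cons.1 hR with rfl | hR
    · exact ((h.reach _ h.headI_mem r hr).trans hrq).trans (hqr' s hs)
    · exact h.reach R hR s hs
  · simpa using ⟨hu, h.legal⟩
  · intro B hB
    classical
    -- The covering word is a word for the data covered already by the old history, a walk to `r`,
    -- the datum `u`, and then the data absorbed by the new component, which are read without
    -- leaving it.
    obtain ⟨r₁, hr₁, w₁, hw₁, hrun₁, hc₁⟩ := h.cover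
      (B.filter fun b => b ∈ D ∨ ∃ R ∈ hist, Closed tr R b) (by
        intro b hb
        simp only [List.mem_filter, decide_eq_true_eq] at hb
        exact ⟨(hB b hb.1).1, hb.2⟩)
    obtain ⟨w₂, hw₂, hrun₂⟩ := h.inner _ h.headI_mem r₁ hr₁ r hr
    obtain ⟨r₃, hr₃, hrun₃⟩ := exists_run_closed (tr := tr)
      (R := (BMSLearning.push hist q).headI)
      (B := B.filter fun b => Closed tr (BMSLearning.push hist q).headI b)
      (by intro b hb; simpa using (List.mem_filter.1 hb).2) (mem_push_headI hist q)
    refine ⟨r₃, hr₃, w₁ ++ (w₂ ++ ([u] ++ B.filter _)), ?_,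
      hrun₁.append (hrun₂.append ((run_singleton.2 hq).append hrun₃)), ?_⟩
    · intro x hx
      simp only [List.mem_append, List.mem_singleton, List.mem_filter] at hx
      rcases hx with hx | hx | rfl | hx
      exacts [hw₁ x hx, hw₂ x hx, hu, (hB x hx.1).1]
    · intro b hb
      simp only [List.mem_append, List.mem_singleton, List.mem_filter, decide_eq_true_eq]
      rcases (hB b hb).2 with hbD | ⟨R, hR, hbR⟩
      · rcases List.mem_cons.1 hbD with rfl | hbD
        · exact Or.inr (Or.inr (Or.inl rfl))
        · exact Or.inl (hc₁ b (by simp [hb, hbD]))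
      · rcases List.mem_cons.1 hR with rfl | hR
        · exact Or.inr (Or.inr (Or.inr ⟨hb, hbR⟩))
        · refine Or.inl (hc₁ b ?_)
          simp only [List.mem_filter, hb, decide_eq_true_eq, true_and]
          exact Or.inr ⟨R, hR, hbR⟩

/-- A change of the history is realized by an actual walk: from any state of the newest component go
to the state that `u` drives out, and read `u`. The only state that may be new to the history is the
end of that walk, so a text containing the walk visits it. -/
theorem Valid.feed (hst : IsStage nx tr) (h : Valid tr L hist D) {k : ℕ} {u : Datum}
    (hu : Legal L u) {h' : List (List ℕ)} (hf : feed nx k hist u = some h') {p : ℕ}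
    (hp : p ∈ hist.headI) : Valid tr L h' (u :: D) ∧ ∃ w, (∀ x ∈ w, Legal L x) ∧
      ∃ p' ∈ h'.headI, Run tr p w p' ∧ u ∈ w ∧
        ∀ R ∈ h', ∀ r ∈ R, (∃ R ∈ hist, r ∈ R) ∨ Visited tr p w r := by
  rcases feed_spec hst hf with ⟨rfl, hc⟩ | ⟨r, hr, q, hq, -, rfl⟩
  · refine ⟨h.stored hu ⟨_, h.headI_mem, hc⟩, [u], by simpa using hu, ?_⟩
    obtain ⟨q, hq, hq'⟩ := hc p hp
    exact ⟨q, hq', run_singleton.2 hq, by simp, fun R hR r hr => Or.inl ⟨R, hR, hr⟩⟩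
  · refine ⟨h.push hu hr hq, ?_⟩
    obtain ⟨w, hw, hrun⟩ := h.inner _ h.headI_mem p hp r hr
    have hrun' := hrun.append (run_singleton.2 hq)
    refine ⟨w ++ [u], ?_, q, mem_push_headI hist q, hrun', by simp, ?_⟩
    · intro x hx
      rcases List.mem_append.1 hx with hx | hx
      · exact hw x hx
      · simp only [List.mem_singleton] at hx; exact hx ▸ hu
    · intro R hR s hs
      rcases List.mem_cons.1 hR with rfl | hR
      · rcases push_headI_subset (hist := hist) hs with rfl | h
        · exact Or.inr ⟨w ++ [u], [], by simp, hrun'⟩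
        · exact Or.inl h
      · exact Or.inl ⟨R, hR, hs⟩

theorem Valid.feedAll (hst : IsStage nx tr) {k : ℕ} {us : List Datum}
    {h' : List (List ℕ)} {p : ℕ} (h : Valid tr L hist D) (hu : ∀ u ∈ us, Legal L u)
    (hf : feedAll nx k hist us = some h') (hp : p ∈ hist.headI) {D' : List Datum}
    (hD' : ∀ d ∈ D', d ∈ us ∨ d ∈ D) : Valid tr L h' D' ∧ ∃ w, (∀ x ∈ w, Legal L x) ∧
      ∃ p' ∈ h'.headI, Run tr p w p' ∧ (∀ u ∈ us, u ∈ w) ∧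
        ∀ R ∈ h', ∀ r ∈ R, (∃ R ∈ hist, r ∈ R) ∨ Visited tr p w r := by
  induction us generalizing hist D p with
  | nil =>
    cases hf
    exact ⟨h.subset fun d hd => by simpa using hD' d hd, [], by simp, p, hp, rfl, by simp,
      fun R hR r hr => Or.inl ⟨R, hR, hr⟩⟩
  | cons u us ih =>
    rw [feedAll_cons, Option.bind_eq_some_iff] at hf
    obtain ⟨h₁, hf₁, hf₂⟩ := hf
    obtain ⟨hv, w, hw, p', hp', hrun, huw, hvis⟩ := h.feed hst (hu u (List.mem_cons_self ..)) hf₁ hp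
    obtain ⟨hv', w', hw', p'', hp'', hrun', huw', hvis'⟩ :=
      ih hv (fun u hu' => hu u (List.mem_cons_of_mem _ hu')) hf₂ hp' (fun d hd => by
        rcases hD' d hd with hd | hd
        · rcases List.mem_cons.1 hd with rfl | hd
          exacts [Or.inr (List.mem_cons_self ..), Or.inl hd]
        · exact Or.inr (List.mem_cons_of_mem _ hd))
    refine ⟨hv', w ++ w', ?_, p'', hp'', hrun.append hrun', ?_, ?_⟩
    · intro x hx
      rcases List.mem_append.1 hx with hx | hx
      exacts [hw x hx, hw' x hx]
    · intro v hv
      rcases List.mem_cons.1 hv with rfl | hv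
      · exact List.mem_append_left _ huw
      · exact List.mem_append_right _ (huw' v hv)
    · intro R hR r hr
      rcases hvis' R hR r hr with ⟨R₁, h1, h2⟩ | h1
      · rcases hvis R₁ h1 r h2 with h3 | h3
        · exact Or.inl h3
        · exact Or.inr h3.append_left
      · exact Or.inr (Visited.append_right hrun h1)

theorem Valid.exists_feed (hS : Succeeds φ tr L) (hst : IsStage nx tr) (h : Valid tr L hist D)
    {u : Datum} (hu : Legal L u) : ∃ k h', BMSLearning.feed nx k hist u = some h' :=
  BMSLearning.exists_feed hst fun r hr => hS.exists_next (h.reach _ h.headI_mem r hr) hu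

theorem Valid.exists_feedAll (hS : Succeeds φ tr L) (hst : IsStage nx tr) {us : List Datum}
    (h : Valid tr L hist D) (hu : ∀ u ∈ us, Legal L u) :
    ∃ k h', BMSLearning.feedAll nx k hist us = some h' := by
  induction us generalizing hist D with
  | nil => exact ⟨0, hist, rfl⟩
  | cons u us ih =>
    obtain ⟨k, h', hf⟩ := h.exists_feed hS hst (hu u (List.mem_cons_self ..))
    obtain ⟨p, hp⟩ := List.exists_mem_of_ne_nil _ h.ne
    have hv := (h.feed hst (hu u (List.mem_cons_self ..)) hf hp).1
    obtain ⟨k', h'', hf'⟩ := ih hv fun u hu' => hu u (List.mem_cons_of_mem _ hu')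
    refine ⟨max k k', h'', ?_⟩
    rw [feedAll_cons, feed_mono hst (le_max_left k k') hf]
    exact feedAll_mono hst (le_max_right k k') hf'

end Histories

end BMSLearning

namespace BMSLearning

open Encodable

/-- `wv` approximates the domains `W φ e` in stages. -/
structure IsEnum (φ : ℕ → ℕ →. ℕ) (wv : ℕ → ℕ × ℕ → Option ℕ) : Prop where
  mono : ∀ k k' a, k ≤ k' → (wv k a).isSome → (wv k' a).isSome
  spec : ∀ e n, n ∈ W φ e ↔ ∃ k, (wv k (e, n)).isSome

/-- `x` leads from the memory `st` to the memory `st'`. -/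
def Step (nx : ℕ → ℕ × Datum → Option ℕ) (wv : ℕ → ℕ × ℕ → Option ℕ) (st : Memory) (x : Datum)
    (st' : Memory) : Prop :=
  ∃ k, step nx wv k st x = some st'

/-! ### Single steps of the new learner -/

section Steps

variable {φ : ℕ → ℕ →. ℕ} {tr : ℕ × Datum →. ℕ} {L : Set ℕ} {nx : ℕ → ℕ × Datum → Option ℕ}
  {wv : ℕ → ℕ × ℕ → Option ℕ}

theorem feedAll_eq_or_lt (hst : IsStage nx tr) {k : ℕ} {us : List Datum}
    {hist h' : List (List ℕ)} (h : feedAll nx k hist us = some h') :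
    h' = hist ∨ hist.length < h'.length := by
  induction us generalizing hist with
  | nil => cases h; exact Or.inl rfl
  | cons u us ih =>
    rw [feedAll_cons, Option.bind_eq_some_iff] at h
    obtain ⟨h1, h2, h3⟩ := h
    rcases feed_length hst h2 with ⟨rfl, -⟩ | ⟨-, -, h4⟩
    · exact ih h3
    · rcases ih h3 with rfl | h5
      · exact Or.inr h4
      · exact Or.inr (by omega)

theorem step_mono (hst : IsStage nx tr) {k k' : ℕ} (hk : k ≤ k') {st st' : Memory} {x : Datum}
    (h : step nx wv k st x = some st') : step nx wv k' st x = some st' := by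
  simp only [step, Option.bind_eq_some_iff, Option.map_eq_some_iff] at h ⊢
  obtain ⟨h₀, e0, h₁, e1, h₂, e2, h⟩ := h
  exact ⟨h₀, feed_mono hst hk e0, h₁, feed_mono hst hk e1, h₂, feedAll_mono hst hk e2, h⟩

theorem Step.unique (hst : IsStage nx tr) {st a b : Memory} {x : Datum}
    (h : Step nx wv st x a) (h' : Step nx wv st x b) : a = b := by
  obtain ⟨k, h⟩ := h
  obtain ⟨k', h'⟩ := h'
  have h1 := step_mono hst (le_max_left k k') h
  have h2 := step_mono hst (le_max_right k k') h'
  rw [h1] at h2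
  exact Option.some.inj h2

theorem closedAt_iff {k : ℕ} {R : List ℕ} {u : Datum} :
    closedAt nx k R u ↔ ∀ r ∈ R, ∃ q ∈ R, nx k (r, u) = some q := by
  simp only [closedAt, Bool.and_eq_true, decide_eq_true_eq, length_images, List.all_eq_true,
    mem_images]
  constructor
  · rintro ⟨h1, h2⟩ r hr
    obtain ⟨q, hq⟩ := h1 r hr
    exact ⟨q, h2 q ⟨r, hr, hq⟩, hq⟩
  · intro h
    refine ⟨fun r hr => ?_, ?_⟩
    · obtain ⟨q, -, hq⟩ := h r hr
      exact ⟨q, hq⟩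
    · rintro q ⟨r, hr, hq⟩
      obtain ⟨q', h1, h2⟩ := h r hr
      rw [hq] at h2
      cases h2; exact h1

theorem openAt_iff {k : ℕ} {R : List ℕ} {u : Datum} :
    openAt nx k R u ↔ ∃ r ∈ R, ∃ q, q ∉ R ∧ nx k (r, u) = some q := by
  simp only [openAt, List.any_eq_true, mem_images, Bool.not_eq_eq_eq_not, Bool.not_true,
    decide_eq_false_iff_not]
  constructor
  · rintro ⟨q, ⟨r, hr, hq⟩, h⟩; exact ⟨r, hr, q, h, hq⟩
  · rintro ⟨r, hr, q, h, hq⟩; exact ⟨q, ⟨r, hr, hq⟩, h⟩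

theorem mem_tolerated {hist : List (List ℕ)} {N : ℕ} {x : Datum} :
    x ∈ tolerated nx wv hist N ↔ ∃ y, x = some y ∧ y < N ∧ (wv N (outIdx hist, y)).isSome ∧
      openAt nx N hist.headI (some y) ∧ ∃ R ∈ hist, closedAt nx N R (some y) := by
  simp only [tolerated, List.mem_map, List.mem_filter, List.mem_range, Bool.and_eq_true,
    List.any_eq_true]
  constructor
  · rintro ⟨y, ⟨h1, h2, h3, h4⟩, rfl⟩; exact ⟨y, rfl, h1, h2, h3, h4⟩
  · rintro ⟨y, rfl, h1, h2, h3, h4⟩; exact ⟨y, ⟨h1, h2, h3, h4⟩, rfl⟩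

theorem tolerated_mono (hst : IsStage nx tr) (hen : IsEnum φ wv) {hist : List (List ℕ)} {N N' : ℕ}
    (hN : N ≤ N') {x : Datum} (hx : x ∈ tolerated nx wv hist N) :
    x ∈ tolerated nx wv hist N' := by
  rw [mem_tolerated] at hx ⊢
  obtain ⟨y, rfl, h1, h2, h3, R, hR, h4⟩ := hx
  refine ⟨y, rfl, by omega, hen.mono _ _ _ hN h2, ?_, R, hR, ?_⟩
  · rw [openAt_iff] at h3 ⊢
    obtain ⟨r, hr, q, hq, h⟩ := h3
    exact ⟨r, hr, q, hq, hst.mono _ _ _ _ hN h⟩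
  · rw [closedAt_iff] at h4 ⊢
    intro r hr
    obtain ⟨q, hq, h⟩ := h4 r hr
    exact ⟨q, hq, hst.mono _ _ _ _ hN h⟩

theorem closed_of_closedAt (hst : IsStage nx tr) {k : ℕ} {R : List ℕ} {u : Datum}
    (h : closedAt nx k R u) : Closed tr R u := by
  intro r hr
  obtain ⟨q, hq, h⟩ := closedAt_iff.1 h r hr
  exact ⟨q, (hst.spec _ _).2 ⟨k, h⟩, hq⟩

theorem exists_closedAt (hst : IsStage nx tr) {R : List ℕ} {u : Datum} (h : Closed tr R u) :
    ∃ k, ∀ k', k ≤ k' → closedAt nx k' R u := by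
  obtain ⟨k, hk⟩ := exists_stage_forall hst fun r hr => (h r hr).imp fun q hq => hq.1
  refine ⟨k, fun k' hk' => closedAt_iff.2 fun r hr => ?_⟩
  obtain ⟨q, hq⟩ := hk k' hk' r hr
  obtain ⟨q', h1, h2⟩ := h r hr
  obtain rfl := Part.mem_unique h1 ((hst.spec _ _).2 ⟨k', hq⟩)
  exact ⟨q', h2, hq⟩

/-- This is soundness of the staged tests; `exists_tolerated` is the matching completeness. The test
`openAt` needs a known successor outside the component, so absence of information never makes a
datum tolerated. -/
theorem tolerated_spec (hst : IsStage nx tr) (hen : IsEnum φ wv) {hist : List (List ℕ)} {N : ℕ}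
    {x : Datum} (hx : x ∈ tolerated nx wv hist N) : ∃ y, x = some y ∧ y ∈ W φ (outIdx hist) ∧
      ¬ Closed tr hist.headI x ∧ ∃ R ∈ hist, Closed tr R x := by
  obtain ⟨y, rfl, h1, h2, h3, R, hR, h4⟩ := mem_tolerated.1 hx
  refine ⟨y, rfl, (hen.spec _ _).2 ⟨N, h2⟩, ?_, R, hR, closed_of_closedAt hst h4⟩
  obtain ⟨r, hr, q, hq, h⟩ := openAt_iff.1 h3
  intro hc
  obtain ⟨q', h5, h6⟩ := hc r hr
  exact hq (Part.mem_unique ((hst.spec _ _).2 ⟨N, h⟩) h5 ▸ h6)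

theorem exists_tolerated (hst : IsStage nx tr) (hen : IsEnum φ wv) {hist : List (List ℕ)}
    {y : ℕ} (hy : y ∈ W φ (outIdx hist)) (hdef : ∀ r ∈ hist.headI, ∃ q, q ∈ tr (r, some y))
    (ho : ¬ Closed tr hist.headI (some y)) (hc : ∃ R ∈ hist, Closed tr R (some y)) :
    ∃ N, some y ∈ tolerated nx wv hist N := by
  obtain ⟨R, hR, hc⟩ := hc
  obtain ⟨k₁, hk₁⟩ := exists_closedAt hst hc
  obtain ⟨k₂, hk₂⟩ := (hen.spec _ _).1 hy
  simp only [Closed, not_forall, not_exists, not_and] at ho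
  obtain ⟨r, hr, ho⟩ := ho
  obtain ⟨q, hq⟩ := hdef r hr
  obtain ⟨k₃, hk₃⟩ := (hst.spec _ _).1 hq
  refine ⟨k₁ + k₂ + k₃ + y + 1, mem_tolerated.2 ⟨y, rfl, by omega, hen.mono _ _ _ (by omega) hk₂,
    openAt_iff.2 ⟨r, hr, q, ho q hq, hst.mono _ _ _ _ (by omega) hk₃⟩, R, hR,
    hk₁ _ (by omega)⟩⟩

theorem reveals_iff {st : Memory} {x : Datum} : reveals nx wv st x ↔
    ∃ y ∈ tolerated nx wv st.1 (encode x), y ∉ tolerated nx wv st.1 st.2.2 ∧ y ∉ st.2.1 := by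
  simp [reveals]

/-- The outcomes are: nothing happens, a tolerated datum is stored, the search bound for tolerated
data is raised, or the history grows. The bound is raised only when all stored data are absorbed by
the newest component; this condition is what makes the memory converge. -/
theorem step_cases (hst : IsStage nx tr) {st st' : Memory} {x : Datum}
    (h : Step nx wv st x st') :
    (st' = st ∧ Closed tr st.1.headI none ∧
      (x ∈ st.2.1 ∨ Closed tr st.1.headI x ∧ ¬ reveals nx wv st x)) ∨
    (st' = (st.1, x :: st.2.1, st.2.2) ∧ x ∉ st.2.1 ∧ Closed tr st.1.headI none ∧
      ¬ Closed tr st.1.headI x ∧ x ∈ tolerated nx wv st.1 st.2.2 ∧ ¬ reveals nx wv st x) ∨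
    (st' = (st.1, x :: st.2.1, encode x) ∧ x ∉ st.2.1 ∧ Closed tr st.1.headI none ∧
      Closed tr st.1.headI x ∧ (∀ d ∈ st.2.1, Closed tr st.1.headI d) ∧ reveals nx wv st x) ∨
    (∃ k h₂, st' = (h₂, x :: st.2.1, 0) ∧
      feedAll nx k st.1 (none :: x :: st.2.1) = some h₂ ∧ st.1.length < h₂.length ∧
      (¬ Closed tr st.1.headI none ∨ x ∉ st.2.1 ∧
        (¬ Closed tr st.1.headI x ∧ x ∉ tolerated nx wv st.1 st.2.2 ∨ reveals nx wv st x))) := by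
  obtain ⟨k, h⟩ := h
  simp only [step, Option.bind_eq_some_iff, Option.map_eq_some_iff] at h
  obtain ⟨h₀, e0, h₁, e1, h₂, e2, h⟩ := h
  have c0 := feed_eq_self_iff hst e0
  have c1 := feed_eq_self_iff hst e1
  have c2 := (feedAll_length hst e2).2
  have hlt := feedAll_eq_or_lt hst e2
  simp only [List.mem_cons, forall_eq_or_imp] at c2
  unfold next at h
  by_cases m1 : x ∈ st.2.1 <;> by_cases m2 : x ∈ tolerated nx wv st.1 st.2.2 <;>
    by_cases hr : reveals nx wv st x <;> by_cases b0 : h₀ = st.1 <;> by_cases b1 : h₁ = st.1 <;>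
    by_cases b2 : h₂ = st.1 <;>
    simp [m1, m2, hr, b0, b1, b2] at h <;> grind

theorem Valid.exists_step (hS : Succeeds φ tr L) (hst : IsStage nx tr) {st : Memory}
    (h : Valid tr L st.1 st.2.1) {x : Datum} (hx : Legal L x) : ∃ st', Step nx wv st x st' := by
  obtain ⟨k₀, h₀, e0⟩ := h.exists_feed hS hst legal_none
  obtain ⟨k₁, h₁, e1⟩ := h.exists_feed hS hst hx
  obtain ⟨k₂, h₂, e2⟩ := h.exists_feedAll (us := none :: x :: st.2.1) hS hst (by
    simp only [List.mem_cons, forall_eq_or_imp]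
    exact ⟨legal_none, hx, h.legal⟩)
  refine ⟨next nx wv st x h₀ h₁ h₂, max k₀ (max k₁ k₂), ?_⟩
  simp only [step, feed_mono hst (show k₀ ≤ max k₀ (max k₁ k₂) by omega) e0,
    feed_mono hst (show k₁ ≤ max k₀ (max k₁ k₂) by omega) e1,
    feedAll_mono hst (show k₂ ≤ max k₀ (max k₁ k₂) by omega) e2, Option.bind_some, Option.map_some]

theorem step_stored (hst : IsStage nx tr) {st st' : Memory} {x : Datum}
    (h : Step nx wv st x st') : st' = st ∨ st'.2.1 = x :: st.2.1 := by
  rcases step_cases hst h with ⟨rfl, -⟩ | ⟨rfl, -⟩ | ⟨rfl, -⟩ | ⟨k, h₂, rfl, -⟩ <;> simp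

theorem step_stored_subset (hst : IsStage nx tr) {st st' : Memory} {x : Datum}
    (h : Step nx wv st x st') {d : Datum} (hd : d ∈ st.2.1) : d ∈ st'.2.1 := by
  rcases step_stored hst h with rfl | h
  · exact hd
  · rw [h]; exact List.mem_cons_of_mem _ hd

/-- Each step is matched by a nonempty walk of the given learner. A datum that the walk omits has
been stored, and when the history changes the walk reads all stored data; so infinitely many changes
leave nothing out. -/
theorem Valid.step (hst : IsStage nx tr) (hen : IsEnum φ wv) {st st' : Memory} {x : Datum}
    {p : ℕ} (hv : Valid tr L st.1 st.2.1) (hx : Legal L x) (h : Step nx wv st x st')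
    (hp : p ∈ st.1.headI) : Valid tr L st'.1 st'.2.1 ∧ ∃ w, w ≠ [] ∧ (∀ x ∈ w, Legal L x) ∧
      ∃ p' ∈ st'.1.headI, Run tr p w p' ∧ (x ∈ w ∨ x ∈ st'.2.1) ∧
        (st'.1 ≠ st.1 → ∀ d ∈ st'.2.1, d ∈ w) ∧
        ∀ R ∈ st'.1, ∀ r ∈ R, (∃ R ∈ st.1, r ∈ R) ∨ Visited tr p w r := by
  -- If the history stays the same, the walk reads a single absorbed symbol: `x` itself, or `#` when
  -- `x` is stored for later.
  have key : ∀ (D : List Datum) (N : ℕ), ∀ u, Legal L u → Closed tr st.1.headI u → (x = u ∨ x ∈ D) →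
      ∃ w, w ≠ [] ∧ (∀ x ∈ w, Legal L x) ∧
      ∃ p' ∈ (st.1, D, N).1.headI, Run tr p w p' ∧ (x ∈ w ∨ x ∈ (st.1, D, N).2.1) ∧
        ((st.1, D, N).1 ≠ st.1 → ∀ d ∈ (st.1, D, N).2.1, d ∈ w) ∧
        ∀ R ∈ (st.1, D, N).1, ∀ r ∈ R, (∃ R ∈ st.1, r ∈ R) ∨ Visited tr p w r := by
    intro D N u hu hcu hxu
    obtain ⟨q, hq, hq'⟩ := hcu p hp
    refine ⟨[u], by simp, by simpa using hu, q, hq', run_singleton.2 hq, by simpa using hxu,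
      fun h => absurd rfl h, fun R hR r hr => Or.inl ⟨R, hR, hr⟩⟩
  rcases step_cases hst h with ⟨rfl, h0, h1⟩ | ⟨rfl, -, h0, -, h1, -⟩ | ⟨rfl, -, h0, h1, -⟩ |
    ⟨k, h₂, rfl, h0, h1, -⟩
  · refine ⟨hv, ?_⟩
    rcases h1 with h1 | ⟨h1, -⟩
    · exact key _ st'.2.2 none legal_none h0 (Or.inr h1)
    · exact key _ st'.2.2 x hx h1 (Or.inl rfl)
  · obtain ⟨y, -, -, -, hc⟩ := tolerated_spec (tr := tr) hst hen h1
    exact ⟨hv.stored hx hc, key _ _ none legal_none h0 (Or.inr (List.mem_cons_self ..))⟩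
  · exact ⟨hv.stored hx ⟨_, hv.headI_mem, h1⟩,
      key _ _ none legal_none h0 (Or.inr (List.mem_cons_self ..))⟩
  · obtain ⟨hv', w, hw, p', hp', hrun, hc, hvis⟩ := hv.feedAll hst (us := none :: x :: st.2.1)
      (D' := x :: st.2.1) (by
        simp only [List.mem_cons, forall_eq_or_imp]
        exact ⟨legal_none, hx, hv.legal⟩) h0 hp (by
        intro d hd; exact Or.inl (List.mem_cons_of_mem _ hd))
    refine ⟨hv', w, ?_, hw, p', hp', hrun, Or.inr (List.mem_cons_self ..), fun _ d hd =>
      hc d (List.mem_cons_of_mem _ hd), hvis⟩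
    rintro rfl
    simpa using hc none (List.mem_cons_self ..)

/-! ### Correctness of the attached index -/

/-- Loops through a fixed state of the newest component can read every absorbed element of `L`,
while the finitely many others are read on the way to that component. The result is a text for `L`
on which this state recurs forever, so the hypothesis recorded in it is the limit hypothesis. -/
theorem Valid.index_correct (hS : Succeeds φ tr L) {hist : List (List ℕ)} {D : List Datum}
    (h : Valid tr L hist D) (hnone : Closed tr hist.headI none)
    (hcov : ∀ l ∈ L, some l ∈ D ∨ ∃ R ∈ hist, Closed tr R (some l))
    (hfin : {l | l ∈ L ∧ ¬ Closed tr hist.headI (some l)}.Finite) :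
    W φ (outIdx hist) = L := by
  classical
  obtain ⟨r, hr, w₀, hw₀, hrun₀, hc₀⟩ := h.cover (hfin.toFinset.toList.map some) (by
    intro b hb
    simp only [List.mem_map, Finset.mem_toList, Set.Finite.mem_toFinset, Set.mem_ofPred_eq] at hb
    obtain ⟨l, ⟨hl, -⟩, rfl⟩ := hb
    exact ⟨legal_some.2 hl, hcov l hl⟩)
  have hh : hist.headI.headI ∈ hist.headI := by
    have := h.ne
    cases hR : hist.headI with
    | nil => exact absurd hR this
    | cons a l => exact List.mem_cons_self ..
  have key : ∀ p ∈ hist.headI, ∀ y, Legal L y → Closed tr hist.headI y →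
      ∃ w, (∀ x ∈ w, Legal L x) ∧ y ∈ w ∧ Run tr p w hist.headI.headI := by
    intro p hp y hy hcy
    obtain ⟨q, hq, hq'⟩ := hcy p hp
    obtain ⟨w, hw, hrun⟩ := h.inner _ h.headI_mem q hq' _ hh
    refine ⟨y :: w, ?_, by simp, q, hq, hrun⟩
    simp only [List.mem_cons, forall_eq_or_imp]
    exact ⟨hy, hw⟩
  obtain ⟨w₁, hw₁, hn₁, hrun₁⟩ := key r hr none legal_none hnone
  -- The `n`-th loop reads `n` if it is an absorbed element of `L`; otherwise it reads `#`, so that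
  -- the loop is not empty.
  let y : ℕ → Datum := fun n =>
    if n ∈ L ∧ Closed tr hist.headI (some n) then some n else none
  have hy : ∀ n, Legal L (y n) ∧ Closed tr hist.headI (y n) := by
    intro n
    simp only [y]
    split_ifs with hn
    exacts [⟨legal_some.2 hn.1, hn.2⟩, ⟨legal_none, hnone⟩]
  choose v hv hyv hrunv using fun n => key _ hh (y n) (hy n).1 (hy n).2
  obtain ⟨S, -, -, e, n₀, he, hn₀⟩ := hS.of_words
    (u := fun n => Nat.casesOn n (w₀ ++ w₁) v)
    (p := fun n => Nat.casesOn n 0 fun _ => hist.headI.headI)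
    (by
      rintro (_ | n) hn
      · change w₀ ++ w₁ = [] at hn
        rw [(List.append_eq_nil_iff.1 hn).2] at hn₁; simp at hn₁
      · have := hyv n
        dsimp only at hn
        rw [hn] at this
        simp at this)
    (by
      rintro (_ | n) x hx
      · rcases List.mem_append.1 hx with hx | hx
        exacts [hw₀ x hx, hw₁ x hx]
      · exact hv n x hx)
    (by
      intro l hl
      by_cases hc : Closed tr hist.headI (some l)
      · refine ⟨l + 1, ?_⟩
        have := hyv l
        simp only [y, if_pos (And.intro hl hc)] at this
        exact this
      · refine ⟨0, List.mem_append_left _ (hc₀ _ ?_)⟩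
        simp only [List.mem_map, Finset.mem_toList, Set.Finite.mem_toFinset, Set.mem_ofPred_eq]
        exact ⟨l, ⟨hl, hc⟩, rfl⟩)
    rfl
    (by
      rintro (_ | n)
      · exact hrun₀.append hrun₁
      · exact hrunv n)
  have := hn₀ (n₀ + 1) (by omega)
  dsimp only at this
  rw [outIdx, this]
  simpa using he

/-! ### Termination -/

theorem headI_toFinset_subset (hist : List (List ℕ)) :
    hist.headI.toFinset ⊆ hist.flatten.toFinset := by
  intro r hr
  cases hist with
  | nil => exact absurd (List.mem_toFinset.1 hr) List.not_mem_nil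
  | cons R hist =>
    simp only [List.headI_cons, List.mem_toFinset, List.flatten_cons, List.mem_append] at hr ⊢
    exact Or.inl hr

/-- A push either adds a state to the whole history or keeps the total from shrinking while strictly
enlarging the newest component. In the first case the newest component may shrink to one state,
which the weight `c + 1` outweighs, since no component has more than `c` states. -/
theorem absorb_measure {hist : List (List ℕ)} {q c : ℕ} (hq : q ∉ hist.headI)
    (hc : (push hist q).flatten.toFinset.card ≤ c) :
    hist.flatten.toFinset.card * (c + 1) + hist.headI.toFinset.card <
      (push hist q).flatten.toFinset.card * (c + 1) + (push hist q).headI.toFinset.card := by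
  have hsub : hist.flatten.toFinset ⊆ (push hist q).flatten.toFinset := by
    intro r
    simp only [push, List.mem_toFinset, List.flatten_cons, List.mem_append]
    exact Or.inr
  have hhead := headI_toFinset_subset hist
  have h1 := Finset.card_le_card hsub
  have h2 := Finset.card_le_card hhead
  cases ha : absorb hist q with
  | none =>
    have hnew : q ∉ hist.flatten.toFinset := by
      simp only [List.mem_toFinset, List.mem_flatten, not_exists, not_and]
      exact absorb_eq_none ha
    have h3 : insert q hist.flatten.toFinset ⊆ (push hist q).flatten.toFinset := by
      rw [Finset.insert_subset_iff]
      exact ⟨by simp [push, ha], hsub⟩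
    have h4 := Finset.card_le_card h3
    rw [Finset.card_insert_of_notMem hnew] at h4
    have h5 : (hist.flatten.toFinset.card + 1) * (c + 1) ≤
      (push hist q).flatten.toFinset.card * (c + 1) := Nat.mul_le_mul_right _ h4
    have h6 : (push hist q).headI.toFinset.card = 1 := by simp [push, ha]
    rw [h6]
    nlinarith
  | some R' =>
    obtain ⟨h3, -, h4⟩ := absorb_eq_some ha
    have h5 : insert q hist.headI.toFinset ⊆ (push hist q).headI.toFinset := by
      rw [Finset.insert_subset_iff]
      refine ⟨by simp [push, ha, h3], fun r hr => ?_⟩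
      simp only [push, ha, Option.getD_some, List.headI_cons, List.mem_toFinset] at hr ⊢
      exact h4 r hr
    have h6 := Finset.card_le_card h5
    rw [Finset.card_insert_of_notMem (by simpa using hq)] at h6
    have h7 : hist.flatten.toFinset.card * (c + 1) ≤
      (push hist q).flatten.toFinset.card * (c + 1) := Nat.mul_le_mul_right _ h1
    omega

theorem feedAll_measure (hst : IsStage nx tr) {k c : ℕ} {us : List Datum}
    {hist h' : List (List ℕ)} (h : feedAll nx k hist us = some h')
    (hc : h'.flatten.toFinset.card ≤ c) :
    hist.flatten.toFinset ⊆ h'.flatten.toFinset ∧ (h' ≠ hist →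
    hist.flatten.toFinset.card * (c + 1) + hist.headI.toFinset.card <
      h'.flatten.toFinset.card * (c + 1) + h'.headI.toFinset.card) := by
  induction us generalizing hist with
  | nil => cases h; simp
  | cons u us ih =>
    rw [feedAll_cons, Option.bind_eq_some_iff] at h
    obtain ⟨h1, h2, h3⟩ := h
    obtain ⟨h4, h5⟩ := ih h3
    rcases feed_spec hst h2 with ⟨rfl, -⟩ | ⟨r, hr, q, hq, hq', rfl⟩
    · exact ⟨h4, h5⟩
    · have h6 := absorb_measure hq' ((Finset.card_le_card h4).trans hc)
      refine ⟨fun r hr => h4 ?_, fun _ => ?_⟩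
      · simp only [push, List.mem_toFinset, List.flatten_cons, List.mem_append] at hr ⊢
        exact Or.inr hr
      · by_cases h7 : h' = push hist q
        · rw [h7]; exact h6
        · exact h6.trans (h5 h7)

theorem not_frequently_increasing {f : ℕ → ℕ} {c : ℕ} (hmono : ∀ n, f n ≤ f (n + 1))
    (hinf : ∀ n, ∃ m, n ≤ m ∧ f m < f (m + 1)) (hc : ∀ n, f n ≤ c) : False := by
  have hm := monotone_nat_of_le_succ hmono
  have : ∀ j, ∃ n, j ≤ f n := by
    intro j
    induction j with
    | zero => exact ⟨0, Nat.zero_le _⟩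
    | succ j ih =>
      obtain ⟨n, hn⟩ := ih
      obtain ⟨m, h1, h2⟩ := hinf n
      exact ⟨m + 1, by have := hm h1; omega⟩
  obtain ⟨n, hn⟩ := this (c + 1)
  have := hc n
  omega

/-- Along data for `L` covering `L`, the history changes only finitely often. -/
theorem not_frequently_break (hS : Succeeds φ tr L) (hst : IsStage nx tr) (hen : IsEnum φ wv)
    {st : ℕ → Memory} {x : ℕ → Datum} (hstep : ∀ n, Step nx wv (st n) (x n) (st (n + 1)))
    (hx : ∀ n, Legal L (x n)) (hv : Valid tr L (st 0).1 (st 0).2.1) {B : List Datum}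
    (hB : ∀ b ∈ B, Legal L b ∧ (b ∈ (st 0).2.1 ∨ ∃ R ∈ (st 0).1, Closed tr R b))
    (hcov : ∀ l ∈ L, some l ∈ B ∨ ∃ n, x n = some l)
    (hinf : ∀ n, ∃ m, n ≤ m ∧ (st (m + 1)).1 ≠ (st m).1) : False := by
  have hvn : ∀ n, Valid tr L (st n).1 (st n).2.1 := by
    intro n
    induction n with
    | zero => exact hv
    | succ n ih =>
      obtain ⟨p, hp⟩ := List.exists_mem_of_ne_nil _ ih.ne
      exact (ih.step hst hen (hx n) (hstep n) hp).1
  obtain ⟨r₀, hr₀, w₀, hw₀, hrun₀, hc₀⟩ := hv.cover B hB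
  choose! w hne hL p' hp' hrun hxw hbr hvis using
    fun n p hp => ((hvn n).step hst hen (hx n) (hstep n) (p := p) hp).2
  -- The position of the given learner, moved along the walks that accompany the steps.
  let pos : ℕ → ℕ := fun n => Nat.rec r₀ (fun n p => p' n p) n
  have hpos : ∀ n, pos n ∈ (st n).1.headI := by
    intro n
    induction n with
    | zero => exact hr₀
    | succ n ih => exact hp' n _ ih
  have hDmono : ∀ n m, n ≤ m → ∀ d ∈ (st n).2.1, d ∈ (st m).2.1 := by
    intro n m hnm d hd
    induction m, hnm using Nat.le_induction with
    | base => exact hd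
    | succ m _ ih => exact step_stored_subset hst (hstep m) ih
  obtain ⟨S, hSf, hSv, -⟩ := hS.of_words
    (u := fun n => Nat.casesOn n (w₀ ++ w 0 (pos 0)) fun n => w (n + 1) (pos (n + 1)))
    (p := fun n => Nat.casesOn n 0 fun n => pos (n + 1))
    (by
      rintro (_ | n)
      · simp [hne 0 _ (hpos 0)]
      · exact hne _ _ (hpos _))
    (by
      rintro (_ | n) y hy
      · rcases List.mem_append.1 hy with hy | hy
        exacts [hw₀ y hy, hL 0 _ (hpos 0) y hy]
      · exact hL _ _ (hpos _) y hy)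
    (by
      intro l hl
      have : ∀ n, some l ∈ w n (pos n) → ∃ n, some l ∈ (Nat.casesOn n (w₀ ++ w 0 (pos 0))
          fun n => w (n + 1) (pos (n + 1)) : List Datum) := by
        rintro (_ | n) hn
        · exact ⟨0, List.mem_append_right _ hn⟩
        · exact ⟨n + 1, hn⟩
      rcases hcov l hl with h | ⟨n, hn⟩
      · exact ⟨0, List.mem_append_left _ (hc₀ _ h)⟩
      · rcases hxw n _ (hpos n) with h | h
        · rw [hn] at h; exact this n h
        · obtain ⟨m, hm, hne'⟩ := hinf (n + 1)
          refine this m (hbr m _ (hpos m) hne' _ (hDmono (n + 1) _ (by omega) _ ?_))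
          rw [← hn]; exact h)
    rfl
    (by
      rintro (_ | n)
      · exact hrun₀.append (hrun 0 _ (hpos 0))
      · exact hrun _ _ (hpos _))
  have hSv' : ∀ n r, Visited tr (pos n) (w n (pos n)) r → r ∈ S := by
    rintro (_ | n) r hr
    · exact hSv 0 r (Visited.append_right hrun₀ hr)
    · exact hSv (n + 1) r hr
  -- The assembled text visits only finitely many states, and every state entering a history is
  -- visited on it; so all histories live in one finite set, which bounds the measure.
  let F : Finset ℕ := hSf.toFinset ∪ (st 0).1.flatten.toFinset
  have hF : ∀ n, (st n).1.flatten.toFinset ⊆ F := by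
    intro n
    induction n with
    | zero => exact Finset.subset_union_right
    | succ n ih =>
      intro r hr
      simp only [List.mem_toFinset, List.mem_flatten] at hr
      obtain ⟨R, hR, hrR⟩ := hr
      rcases hvis n _ (hpos n) R hR r hrR with ⟨R', h1, h2⟩ | h1
      · exact ih (by simpa using ⟨R', h1, h2⟩)
      · exact Finset.mem_union_left _ (by simpa using hSv' n r h1)
  have hcard : ∀ n, (st n).1.flatten.toFinset.card ≤ F.card :=
    fun n => Finset.card_le_card (hF n)
  have hlt : ∀ m, (st (m + 1)).1 ≠ (st m).1 →
      (st m).1.flatten.toFinset.card * (F.card + 1) + (st m).1.headI.toFinset.card <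
      (st (m + 1)).1.flatten.toFinset.card * (F.card + 1) +
        (st (m + 1)).1.headI.toFinset.card := by
    intro m hm
    rcases step_cases hst (hstep m) with ⟨h, -⟩ | ⟨h, -⟩ | ⟨h, -⟩ | ⟨k, h₂, h, h1, -⟩
    · rw [h] at hm; exact absurd rfl hm
    · rw [h] at hm; exact absurd rfl hm
    · rw [h] at hm; exact absurd rfl hm
    · have hc := hcard (m + 1)
      rw [h] at hm hc ⊢
      exact (feedAll_measure hst h1 hc).2 hm
  refine not_frequently_increasing (f := fun n =>
    (st n).1.flatten.toFinset.card * (F.card + 1) + (st n).1.headI.toFinset.card)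
    (c := F.card * (F.card + 1) + F.card) (fun m => ?_) (fun n => ?_) (fun n => ?_)
  · by_cases hm : (st (m + 1)).1 = (st m).1
    · rw [hm]
    · exact (hlt m hm).le
  · obtain ⟨m, h1, h2⟩ := hinf n
    exact ⟨m, h1, hlt m h2⟩
  · have h1 := headI_toFinset_subset (st n).1
    have h2 := (Finset.card_le_card h1).trans (hcard n)
    have h3 := Nat.mul_le_mul_right (F.card + 1) (hcard n)
    omega

end Steps

end BMSLearning

namespace BMSLearning

open Encodable

/-! ### The announced languages, defined by self-reference -/

section Targets

/-- Finite approximation of the language to be announced: the stored data, and what is enumerated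
by the index of the history if `st'` is `st`, and by `V` for the memory `st'` otherwise. -/
def approx (wv : ℕ → ℕ × ℕ → Option ℕ) (V : ℕ → Memory × ℕ → Bool) (s : ℕ) (st st' : Memory) :
    List ℕ :=
  st.2.1.filterMap id ++ (List.range s).filter fun y =>
    if decide (st' = st) then (wv s (outIdx st.1, y)).isSome else V s (st', y)

/-- At stages `s` and `k`, the number `n` is accepted for the memory `st`, provided that `V`
accepts the whole approximation for all memories reached from `st` by its elements. -/
def accepts (nx : ℕ → ℕ × Datum → Option ℕ) (wv : ℕ → ℕ × ℕ → Option ℕ)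
    (V : ℕ → Memory × ℕ → Bool) (st : Memory) (n s k : ℕ) : Bool :=
  decide (some n ∈ st.2.1) || ((step nx wv k st none).map fun st₀ =>
    decide (n ∈ approx wv V s st st₀) && (none :: (approx wv V s st st₀).map some).all fun x =>
      ((step nx wv k st x).map fun st' => decide (st' = st) ||
        (approx wv V s st st₀).all fun w => V k (st', w)).getD false).getD false

/-- `Wg` assigns languages to memories, approximated by `E`. -/
structure IsTarget (φ : ℕ → ℕ →. ℕ) (nx : ℕ → ℕ × Datum → Option ℕ)
    (wv : ℕ → ℕ × ℕ → Option ℕ) (Wg : Memory → Set ℕ)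
    (E : ℕ → Memory → Memory → List ℕ) : Prop where
  mem_iff : ∀ st n, n ∈ Wg st ↔ some n ∈ st.2.1 ∨ ∃ s st₀, Step nx wv st none st₀ ∧
    n ∈ E s st st₀ ∧ ∀ x ∈ none :: (E s st st₀).map some, ∃ st', Step nx wv st x st' ∧
      (st' = st ∨ ∀ w ∈ E s st st₀, w ∈ Wg st')
  mono : ∀ s s' st st₀ n, s ≤ s' → n ∈ E s st st₀ → n ∈ E s' st st₀
  stored : ∀ s st st₀ n, some n ∈ st.2.1 → n ∈ E s st st₀
  of_self : ∀ st n, (∃ s, n ∈ E s st st) ↔ some n ∈ st.2.1 ∨ n ∈ W φ (outIdx st.1)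
  of_ne : ∀ st st₀ n, st₀ ≠ st → ((∃ s, n ∈ E s st st₀) ↔ some n ∈ st.2.1 ∨ n ∈ Wg st₀)

variable {α : Type*} [Primcodable α] {nx : ℕ → ℕ × Datum → Option ℕ}
  {wv : ℕ → ℕ × ℕ → Option ℕ}

theorem primrec_approx (hwv : Primrec₂ wv) {V : α → ℕ → Memory × ℕ → Bool}
    (hV : Primrec fun p : α × ℕ × (Memory × ℕ) => V p.1 p.2.1 p.2.2) {s : α → ℕ}
    {st st' : α → Memory} (hs : Primrec s) (hst : Primrec st) (hst' : Primrec st') :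
    Primrec fun a => approx wv (V a) (s a) (st a) (st' a) := by
  refine Primrec.list_append.comp (Primrec.listFilterMap
    (Primrec.fst.comp (Primrec.snd.comp hst)) Primrec.snd)
    (primrec_filter (Primrec.list_range.comp hs) ?_)
  refine primrec_bite (primrec_decide_eq (hst'.comp Primrec.fst) (hst.comp Primrec.fst))
    (Primrec.option_isSome.comp (hwv.comp (hs.comp Primrec.fst) ((primrec_outIdx.comp
      (Primrec.fst.comp (hst.comp Primrec.fst))).pair Primrec.snd))) ?_
  exact hV.comp (Primrec.fst.pair ((hs.comp Primrec.fst).pair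
    ((hst'.comp Primrec.fst).pair Primrec.snd)))

theorem primrec_accepts (hnx : Primrec₂ nx) (hwv : Primrec₂ wv) {V : α → ℕ → Memory × ℕ → Bool}
    (hV : Primrec fun p : α × ℕ × (Memory × ℕ) => V p.1 p.2.1 p.2.2) {st : α → Memory}
    {n s k : α → ℕ} (hst : Primrec st) (hn : Primrec n) (hs : Primrec s) (hk : Primrec k) :
    Primrec fun a => accepts nx wv (V a) (st a) (n a) (s a) (k a) := by
  have hf : Primrec fun p : α × Memory => p.1 := Primrec.fst
  have hV' : Primrec fun p : (α × Memory) × ℕ × (Memory × ℕ) => V p.1.1 p.2.1 p.2.2 :=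
    hV.comp ((Primrec.fst.comp Primrec.fst).pair Primrec.snd)
  have ha : Primrec fun p : α × Memory => approx wv (V p.1) (s p.1) (st p.1) p.2 :=
    primrec_approx hwv (V := fun p => V p.1) hV' (hs.comp hf) (hst.comp hf) Primrec.snd
  refine Primrec.or.comp (primrec_mem (Primrec.option_some.comp hn)
    (Primrec.fst.comp (Primrec.snd.comp hst))) (Primrec.option_getD.comp (Primrec.option_map
      (primrec_step hnx hwv hk hst (Primrec.const none)) ?_) (Primrec.const false))
  refine Primrec.and.comp (primrec_mem (hn.comp hf) ha) (primrec_all (Primrec.list_cons.comp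
    (Primrec.const none) (Primrec.list_map ha (Primrec.option_some.comp Primrec.snd))) ?_)
  have hg : Primrec fun p : (α × Memory) × Datum => p.1.1 := Primrec.fst.comp Primrec.fst
  refine Primrec.option_getD.comp (Primrec.option_map
    (primrec_step hnx hwv (hk.comp hg) (hst.comp hg) Primrec.snd) ?_) (Primrec.const false)
  refine Primrec.or.comp (primrec_decide_eq Primrec.snd (hst.comp (hg.comp Primrec.fst)))
    (primrec_all (ha.comp (Primrec.fst.comp Primrec.fst)) ?_)
  have hh : Primrec fun p : (((α × Memory) × Datum) × Memory) × ℕ => p.1.1.1.1 :=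
    hg.comp (Primrec.fst.comp Primrec.fst)
  exact hV.comp (hh.pair ((hk.comp hh).pair ((Primrec.snd.comp Primrec.fst).pair Primrec.snd)))

theorem exists_forall_stage {β : Type*} {P : ℕ → β → Prop} (hP : ∀ k k' b, k ≤ k' → P k b → P k' b)
    (l : List β) (h : ∀ b ∈ l, ∃ k, P k b) : ∃ k, ∀ b ∈ l, P k b := by
  induction l with
  | nil => exact ⟨0, by simp⟩
  | cons b l ih =>
    obtain ⟨k, hk⟩ := ih fun b hb => h b (List.mem_cons_of_mem _ hb)
    obtain ⟨k', hk'⟩ := h b (List.mem_cons_self ..)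
    refine ⟨max k k', ?_⟩
    simp only [List.mem_cons, forall_eq_or_imp]
    exact ⟨hP _ _ _ (le_max_right ..) hk', fun b hb => hP _ _ _ (le_max_left ..) (hk b hb)⟩

theorem mem_approx {V : ℕ → Memory × ℕ → Bool} {s : ℕ} {st st' : Memory} {n : ℕ} :
    n ∈ approx wv V s st st' ↔ some n ∈ st.2.1 ∨ n < s ∧
      (if st' = st then (wv s (outIdx st.1, n)).isSome else V s (st', n)) := by
  simp only [approx, List.mem_append, List.mem_filterMap, id_eq, exists_eq_right, List.mem_filter,
    List.mem_range, decide_eq_true_eq]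

theorem accepts_iff {V : ℕ → Memory × ℕ → Bool} {st : Memory} {n s k : ℕ} :
    accepts nx wv V st n s k ↔ some n ∈ st.2.1 ∨ ∃ st₀, step nx wv k st none = some st₀ ∧
      n ∈ approx wv V s st st₀ ∧ ∀ x ∈ none :: (approx wv V s st st₀).map some,
        ∃ st', step nx wv k st x = some st' ∧
          (st' = st ∨ ∀ w ∈ approx wv V s st st₀, V k (st', w)) := by
  rw [accepts, Bool.or_eq_true, decide_eq_true_eq]
  refine or_congr Iff.rfl ?_
  cases h0 : step nx wv k st none with
  | none => simp
  | some st₀ =>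
    simp only [Option.map_some, Option.getD_some, Bool.and_eq_true, decide_eq_true_eq,
      List.all_eq_true, Option.some.injEq, exists_eq_left']
    refine and_congr Iff.rfl (forall₂_congr fun x _ => ?_)
    cases step nx wv k st x with
    | none => simp
    | some st' => simp

/-- Kleene's recursion theorem for unbounded search: the search may refer to its own code. -/
theorem exists_code_search {A : Nat.Partrec.Code → ℕ → ℕ → Bool}
    (hA : Primrec fun p : Nat.Partrec.Code × ℕ × ℕ => A p.1 p.2.1 p.2.2) :
    ∃ c : Nat.Partrec.Code, ∀ m, (c.eval m).Dom ↔ ∃ j, A c m j := by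
  have hf : Partrec₂ fun (c : Nat.Partrec.Code) (m : ℕ) =>
      Nat.rfind fun j => Part.some (A c m j) := by
    refine Partrec.rfind (p := fun (a : Nat.Partrec.Code × ℕ) j => Part.some (A a.1 a.2 j)) ?_
    exact Computable.partrec (hA.comp ((Primrec.fst.comp Primrec.fst).pair
      ((Primrec.snd.comp Primrec.fst).pair Primrec.snd))).to_comp
  obtain ⟨c, hc⟩ := Nat.Partrec.Code.fixed_point₂ hf
  refine ⟨c, fun m => ?_⟩
  rw [hc]
  exact Nat.rfind_dom.trans (by simp)

/-- The announced languages occur only positively in the condition `mem_iff`: finitely many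
memberships in languages of other memories are required. So membership is found by an unbounded
search that runs its own code for boundedly many stages. -/
theorem exists_target {φ : ℕ → ℕ →. ℕ} {tr : ℕ × Datum →. ℕ} (hnx : Primrec₂ nx)
    (hwv : Primrec₂ wv) (hst : IsStage nx tr) (hen : IsEnum φ wv) :
    ∃ (ψ : ℕ → ℕ →. ℕ) (E : ℕ → Memory → Memory → List ℕ), Partrec₂ ψ ∧
      IsTarget φ nx wv (fun st => W ψ (encode st)) E := by
  let V : Nat.Partrec.Code → ℕ → Memory × ℕ → Bool :=
    fun c k p => (Nat.Partrec.Code.evaln k c (encode p)).isSome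
  have hVp : Primrec fun p : Nat.Partrec.Code × ℕ × (Memory × ℕ) => V p.1 p.2.1 p.2.2 :=
    Primrec.option_isSome.comp (Nat.Partrec.Code.primrec_evaln.comp
      (((Primrec.fst.comp Primrec.snd).pair Primrec.fst).pair
        (Primrec.encode.comp (Primrec.snd.comp Primrec.snd))))
  let dec : ℕ → Memory × ℕ := fun m => (decode (α := Memory × ℕ) m).getD (([], [], 0), 0)
  have hdec : Primrec dec := Primrec.option_getD.comp Primrec.decode (Primrec.const _)
  obtain ⟨c, hc⟩ := exists_code_search
    (A := fun c m j => accepts nx wv (V c) (dec m).1 (dec m).2 j.unpair.1 j.unpair.2) (by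
      have h1 := hdec.comp (Primrec.fst.comp (Primrec.snd
        (α := Nat.Partrec.Code) (β := ℕ × ℕ)))
      have h2 := Primrec.unpair.comp (Primrec.snd.comp (Primrec.snd
        (α := Nat.Partrec.Code) (β := ℕ × ℕ)))
      exact primrec_accepts hnx hwv (V := fun a : Nat.Partrec.Code × ℕ × ℕ => V a.1)
        (hVp.comp ((Primrec.fst.comp Primrec.fst).pair Primrec.snd))
        (Primrec.fst.comp h1) (Primrec.snd.comp h1) (Primrec.fst.comp h2) (Primrec.snd.comp h2))
  have hVmono : ∀ k k' p, k ≤ k' → V c k p → V c k' p := by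
    intro k k' p hk h
    obtain ⟨a, ha⟩ := Option.isSome_iff_exists.1 h
    exact Option.isSome_iff_exists.2 ⟨a, Nat.Partrec.Code.evaln_mono hk ha⟩
  have hVspec : ∀ st n, n ∈ W (fun p x => c.eval (Nat.pair p x)) (encode st) ↔
      ∃ k, V c k (st, n) := by
    intro st n
    change (c.eval (encode (st, n))).Dom ↔ _
    simp only [Part.dom_iff_mem, Nat.Partrec.Code.evaln_complete, V, Option.isSome_iff_exists,
      Option.mem_def]
    exact exists_comm
  refine ⟨fun p x => c.eval (Nat.pair p x), approx wv (V c), ?_, ⟨?_, ?_, ?_, ?_, ?_⟩⟩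
  · exact (Nat.Partrec.Code.eval_part.comp (Computable.const c) Computable.id).comp
      Primrec₂.natPair.to_comp
  · intro st n
    have h1 : n ∈ W (fun p x => c.eval (Nat.pair p x)) (encode st) ↔
        ∃ j, accepts nx wv (V c) st n (Nat.unpair j).1 (Nat.unpair j).2 := by
      change (c.eval (encode (st, n))).Dom ↔ _
      have h2 : dec (encode (st, n)) = (st, n) := by
        simp only [dec, encodek, Option.getD_some]
      rw [hc, h2]
    rw [h1]
    have h2 : (∃ j, accepts nx wv (V c) st n (Nat.unpair j).1 (Nat.unpair j).2) ↔
        ∃ s k, accepts nx wv (V c) st n s k :=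
      ⟨fun ⟨j, h⟩ => ⟨_, _, h⟩, fun ⟨s, k, h⟩ => ⟨Nat.pair s k, by simpa using h⟩⟩
    rw [h2]
    simp only [accepts_iff]
    constructor
    · rintro ⟨s, k, h | ⟨st₀, h3, h4, h5⟩⟩
      · exact Or.inl h
      · refine Or.inr ⟨s, st₀, ⟨k, h3⟩, h4, fun x hx => ?_⟩
        obtain ⟨st', h6, h7⟩ := h5 x hx
        refine ⟨st', ⟨k, h6⟩, h7.imp id fun h w hw => (hVspec _ _).2 ⟨k, h w hw⟩⟩
    · rintro (h | ⟨s, st₀, ⟨k, h3⟩, h4, h5⟩)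
      · exact ⟨0, 0, Or.inl h⟩
      · obtain ⟨k', hk'⟩ := exists_forall_stage (P := fun k x => ∃ st',
          step nx wv k st x = some st' ∧ (st' = st ∨ ∀ w ∈ approx wv (V c) s st st₀, V c k (st', w)))
          (by
            rintro k k' x hk ⟨st', h6, h7⟩
            exact ⟨st', step_mono hst hk h6, h7.imp id fun h w hw => hVmono _ _ _ hk (h w hw)⟩)
          _ (by
            intro x hx
            obtain ⟨st', ⟨k₁, h6⟩, h7⟩ := h5 x hx
            rcases h7 with h7 | h7
            · exact ⟨k₁, st', h6, Or.inl h7⟩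
            · obtain ⟨k₂, hk₂⟩ := exists_forall_stage (P := fun k w => V c k (st', w))
                (fun k k' w => hVmono k k' _) _ fun w hw => (hVspec _ _).1 (h7 w hw)
              exact ⟨max k₁ k₂, st', step_mono hst (le_max_left ..) h6,
                Or.inr fun w hw => hVmono _ _ _ (le_max_right ..) (hk₂ w hw)⟩)
        refine ⟨s, max k k', Or.inr ⟨st₀, step_mono hst (le_max_left ..) h3, h4, fun x hx => ?_⟩⟩
        obtain ⟨st', h6, h7⟩ := hk' x hx
        exact ⟨st', step_mono hst (le_max_right ..) h6,
          h7.imp id fun h w hw => hVmono _ _ _ (le_max_right ..) (h w hw)⟩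
  · intro s s' st st₀ n hs hn
    rw [mem_approx] at hn ⊢
    refine hn.imp id fun ⟨h1, h2⟩ => ⟨by omega, ?_⟩
    split_ifs at h2 ⊢
    exacts [hen.mono _ _ _ hs h2, hVmono _ _ _ hs h2]
  · intro s st st₀ n hn
    exact mem_approx.2 (Or.inl hn)
  · intro st n
    simp only [mem_approx, if_true]
    constructor
    · rintro ⟨s, h | ⟨-, h⟩⟩
      exacts [Or.inl h, Or.inr ((hen.spec _ _).2 ⟨s, h⟩)]
    · rintro (h | h)
      · exact ⟨0, Or.inl h⟩
      · obtain ⟨k, hk⟩ := (hen.spec _ _).1 h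
        exact ⟨k + n + 1, Or.inr ⟨by omega, hen.mono _ _ _ (by omega) hk⟩⟩
  · intro st st₀ n hne
    simp only [mem_approx, if_neg hne]
    constructor
    · rintro ⟨s, h | ⟨-, h⟩⟩
      exacts [Or.inl h, Or.inr ((hVspec _ _).2 ⟨s, h⟩)]
    · rintro (h | h)
      · exact ⟨0, Or.inl h⟩
      · obtain ⟨k, hk⟩ := (hVspec _ _).1 h
        exact ⟨k + n + 1, Or.inr ⟨by omega, hVmono _ _ _ (by omega) hk⟩⟩

end Targets

end BMSLearning

namespace BMSLearning

open Encodable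

/-! ### Settled memories announce the target -/

section Correctness

variable {φ : ℕ → ℕ →. ℕ} {tr : ℕ × Datum →. ℕ} {L : Set ℕ} {nx : ℕ → ℕ × Datum → Option ℕ}
  {wv : ℕ → ℕ × ℕ → Option ℕ}

/-- Every element of `L` is stored or absorbed by some component of the history. -/
def Covered (tr : ℕ × Datum →. ℕ) (L : Set ℕ) (st : Memory) : Prop :=
  ∀ l ∈ L, some l ∈ st.2.1 ∨ ∃ R ∈ st.1, Closed tr R (some l)

/-- The newest component is closed under the pause symbol, and all elements of `L` not absorbed by
it are stored or tolerated. -/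
def Saturated (tr : ℕ × Datum →. ℕ) (nx : ℕ → ℕ × Datum → Option ℕ)
    (wv : ℕ → ℕ × ℕ → Option ℕ) (L : Set ℕ) (st : Memory) : Prop :=
  Closed tr st.1.headI none ∧ ∀ l ∈ L, Closed tr st.1.headI (some l) ∨ some l ∈ st.2.1 ∨
    some l ∈ tolerated nx wv st.1 st.2.2

theorem feedAll_subset (hst : IsStage nx tr) {k : ℕ} {us : List Datum}
    {hist h' : List (List ℕ)} (h : feedAll nx k hist us = some h') : ∀ R ∈ hist, R ∈ h' := by
  induction us generalizing hist with
  | nil => cases h; exact fun R hR => hR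
  | cons u us ih =>
    rw [feedAll_cons, Option.bind_eq_some_iff] at h
    obtain ⟨h1, h2, h3⟩ := h
    rcases feed_spec hst h2 with ⟨rfl, -⟩ | ⟨r, hr, q, hq, hq', rfl⟩
    · exact ih h3
    · exact fun R hR => ih h3 R (List.mem_cons_of_mem _ hR)

theorem step_hist_subset (hst : IsStage nx tr) {st st' : Memory} {x : Datum}
    (h : Step nx wv st x st') : ∀ R ∈ st.1, R ∈ st'.1 := by
  rcases step_cases hst h with ⟨rfl, -⟩ | ⟨rfl, -⟩ | ⟨rfl, -⟩ | ⟨k, h₂, rfl, h, -⟩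
  · exact fun R hR => hR
  · exact fun R hR => hR
  · exact fun R hR => hR
  · exact feedAll_subset hst h

theorem stored_or_closed_of_step (hst : IsStage nx tr) {st st' : Memory} {x : Datum}
    (h : Step nx wv st x st') (hne : st.1 ≠ []) :
    x ∈ st'.2.1 ∨ ∃ R ∈ st'.1, Closed tr R x := by
  rcases step_cases hst h with ⟨rfl, -, h | ⟨h, -⟩⟩ | ⟨rfl, -⟩ | ⟨rfl, -⟩ | ⟨k, h₂, rfl, h, -⟩
  · exact Or.inl h
  · exact Or.inr ⟨_, headI_mem hne, h⟩
  all_goals exact Or.inl (List.mem_cons_self ..)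

theorem Covered.step (hst : IsStage nx tr) {st st' : Memory} {x : Datum}
    (hc : Covered tr L st) (h : Step nx wv st x st') : Covered tr L st' := by
  intro l hl
  rcases hc l hl with h1 | ⟨R, hR, h1⟩
  · exact Or.inl (step_stored_subset hst h h1)
  · exact Or.inr ⟨R, step_hist_subset hst h R hR, h1⟩

/-- The set of tolerated data grows with the stage, so only a stage beyond the current one can
reveal something. -/
theorem lt_encode_of_reveals (hst : IsStage nx tr) (hen : IsEnum φ wv) {st : Memory} {x : Datum}
    (h : reveals nx wv st x) : st.2.2 < encode x := by
  obtain ⟨y, h1, h2, -⟩ := reveals_iff.1 h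
  by_contra hle
  exact h2 (tolerated_mono hst hen (not_lt.1 hle) h1)

/-- The elements of `L` not absorbed by the newest component are stored or tolerated at one fixed
stage, hence finitely many. -/
theorem Saturated.index_correct (hS : Succeeds φ tr L) {st : Memory}
    (hv : Valid tr L st.1 st.2.1) (hc : Covered tr L st) (hs : Saturated tr nx wv L st) :
    W φ (outIdx st.1) = L := by
  refine hv.index_correct hS hs.1 hc ?_
  have : ((st.2.1 ++ tolerated nx wv st.1 st.2.2).toFinset : Set Datum).Finite :=
    Finset.finite_toSet _
  refine Set.Finite.subset (this.preimage (f := some) (Option.some_injective ℕ).injOn) ?_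
  rintro l ⟨hl, ho⟩
  simpa using (hs.2 l hl).resolve_left ho

/-- From a saturated memory, data for `L` only lead to storing tolerated data. -/
theorem Saturated.step (hS : Succeeds φ tr L) (hst : IsStage nx tr) (hen : IsEnum φ wv)
    {st st' : Memory} {x : Datum} (hv : Valid tr L st.1 st.2.1) (hc : Covered tr L st)
    (hs : Saturated tr nx wv L st) (hx : Legal L x) (h : Step nx wv st x st') :
    st' = st ∨ st' = (st.1, x :: st.2.1, st.2.2) ∧ x ∉ st.2.1 ∧
      x ∈ tolerated nx wv st.1 st.2.2 := by
  have hidx := hs.index_correct hS hv hc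
  -- A revealed datum is predicted by the index, so it lies in `L`; saturation then says that it is
  -- absorbed, stored or tolerated already.
  have hnr : ¬ reveals nx wv st x := by
    intro hr
    obtain ⟨y, h1, h2, h3⟩ := reveals_iff.1 hr
    obtain ⟨n, rfl, hn, ho, -⟩ := tolerated_spec (tr := tr) hst hen h1
    rw [hidx] at hn
    rcases hs.2 n hn with h | h | h
    exacts [ho h, h3 h, h2 h]
  rcases step_cases hst h with ⟨rfl, -⟩ | ⟨rfl, h1, -, -, h2, -⟩ | ⟨rfl, -, -, -, -, h1⟩ |
    ⟨k, h₂, rfl, -, -, h1⟩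
  · exact Or.inl rfl
  · exact Or.inr ⟨rfl, h1, h2⟩
  · exact absurd h1 hnr
  · rcases h1 with h1 | ⟨h1, ⟨h2, h3⟩ | h2⟩
    · exact absurd hs.1 h1
    · cases x with
      | none => exact absurd hs.1 h2
      | some l =>
        rcases hs.2 l (hx l rfl) with h | h | h
        exacts [absurd h h2, absurd h h1, absurd h h3]
    · exact absurd h2 hnr

theorem Saturated.preserved (hS : Succeeds φ tr L) (hst : IsStage nx tr) (hen : IsEnum φ wv)
    {st st' : Memory} {x : Datum} (hv : Valid tr L st.1 st.2.1) (hc : Covered tr L st)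
    (hs : Saturated tr nx wv L st) (hx : Legal L x) (h : Step nx wv st x st') :
    Saturated tr nx wv L st' := by
  rcases hs.step hS hst hen hv hc hx h with rfl | ⟨rfl, -, -⟩
  · exact hs
  · exact ⟨hs.1, fun l hl => (hs.2 l hl).imp id (Or.imp (List.mem_cons_of_mem _) id)⟩

/-- The memory is final for `L`. -/
structure Settled (tr : ℕ × Datum →. ℕ) (nx : ℕ → ℕ × Datum → Option ℕ)
    (wv : ℕ → ℕ × ℕ → Option ℕ) (L : Set ℕ) (st : Memory) : Prop where
  valid : Valid tr L st.1 st.2.1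
  covered : Covered tr L st
  finite_or : L.Finite ∨ Saturated tr nx wv L st

theorem Settled.step (hS : Succeeds φ tr L) (hst : IsStage nx tr) (hen : IsEnum φ wv)
    {st st' : Memory} {x : Datum} (h : Settled tr nx wv L st) (hx : Legal L x)
    (hstep : Step nx wv st x st') : Settled tr nx wv L st' := by
  obtain ⟨p, hp⟩ := List.exists_mem_of_ne_nil _ h.valid.ne
  exact ⟨(h.valid.step hst hen hx hstep hp).1, h.covered.step hst hstep,
    h.finite_or.imp id fun hs => hs.preserved hS hst hen h.valid h.covered hx hstep⟩

theorem card_stored_of_step (hst : IsStage nx tr) {st st' : Memory} {x : Datum}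
    (h : Step nx wv st x st') (hne : st' ≠ st) (hhist : st'.1 = st.1) :
    st'.2.1.toFinset.card = st.2.1.toFinset.card + 1 := by
  rcases step_cases hst h with ⟨rfl, -⟩ | ⟨rfl, h1, -⟩ | ⟨rfl, h1, -⟩ | ⟨k, h₂, rfl, -, h1, -⟩
  · exact absurd rfl hne
  · simp [h1]
  · simp [h1]
  · dsimp only at hhist
    rw [hhist] at h1
    exact absurd h1 (lt_irrefl _)

theorem card_stored_mono (hst : IsStage nx tr) {st st' : Memory} {x : Datum}
    (h : Step nx wv st x st') : st.2.1.toFinset.card ≤ st'.2.1.toFinset.card := by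
  refine Finset.card_le_card fun d hd => ?_
  simp only [List.mem_toFinset] at hd ⊢
  exact step_stored_subset hst h hd

/-- Changes of the memory, by data for `L`. -/
def Change (nx : ℕ → ℕ × Datum → Option ℕ) (wv : ℕ → ℕ × ℕ → Option ℕ) (L : Set ℕ)
    (st' st : Memory) : Prop :=
  st' ≠ st ∧ ∃ x, Legal L x ∧ Step nx wv st x st'

/-- Changes that keep the history store a new datum each time, so finitely many candidates for
storage suffice. If `L` is finite, these are `#` and `L`, and the history can change only finitely
often because `L` is covered from the start. If the memory is saturated, the history is frozen and
only data tolerated at a fixed stage are added. -/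
theorem Settled.acc (hS : Succeeds φ tr L) (hst : IsStage nx tr) (hen : IsEnum φ wv)
    {st : Memory} (h : Settled tr nx wv L st) : Acc (Change nx wv L) st := by
  classical
  by_contra hacc
  obtain ⟨f, hf0, hf⟩ := not_acc_iff_exists_descending_chain.1 hacc
  subst hf0
  choose hne x hx hstep using hf
  have hset : ∀ n, Settled tr nx wv L (f n) := by
    intro n
    induction n with
    | zero => exact h
    | succ n ih => exact ih.step hS hst hen (hx n) (hstep n)
  have hfin : ∀ (K : Finset Datum) (n₀ : ℕ), (∀ n, n₀ ≤ n → (f (n + 1)).1 = (f n).1) →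
      (∀ n, n₀ ≤ n → ∀ d ∈ (f n).2.1, d ∈ K) → False := by
    intro K n₀ h1 h2
    have h3 : ∀ n, (f (n₀ + n)).2.1.toFinset.card < (f (n₀ + (n + 1))).2.1.toFinset.card := by
      intro n
      have := card_stored_of_step hst (hstep (n₀ + n)) (hne _) (h1 _ (by omega))
      rw [← add_assoc]; omega
    refine not_frequently_increasing (f := fun n => (f (n₀ + n)).2.1.toFinset.card)
      (c := K.card) (fun n => (h3 n).le) (fun n => ⟨n, le_rfl, h3 n⟩) fun n => ?_
    exact Finset.card_le_card fun d hd => h2 (n₀ + n) (by omega) d (by simpa using hd)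
  rcases h.finite_or with hL | hs
  · have hlegal : ∀ y, Legal L y → y ∈ insert none (hL.toFinset.image some) := by
      rintro (_ | l) hl
      · simp
      · simpa using hl l rfl
    by_cases hinf : ∀ n, ∃ m, n ≤ m ∧ (f (m + 1)).1 ≠ (f m).1
    · refine not_frequently_break hS hst hen hstep hx h.valid
        (B := hL.toFinset.toList.map some) ?_ ?_ hinf
      · intro b hb
        simp only [List.mem_map, Finset.mem_toList, Set.Finite.mem_toFinset] at hb
        obtain ⟨l, hl, rfl⟩ := hb
        exact ⟨legal_some.2 hl, h.covered l hl⟩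
      · intro l hl
        left
        simpa using hl
    · push Not at hinf
      obtain ⟨n₀, hn₀⟩ := hinf
      exact hfin _ n₀ hn₀ fun n _ d hd => hlegal d ((hset n).valid.legal d hd)
  · have key : ∀ n, Saturated tr nx wv L (f n) ∧ (f n).1 = (f 0).1 ∧ (f n).2.2 = (f 0).2.2 ∧
        ∀ d ∈ (f n).2.1, d ∈ ((f 0).2.1 ++ tolerated nx wv (f 0).1 (f 0).2.2).toFinset := by
      intro n
      induction n with
      | zero =>
        exact ⟨hs, rfl, rfl, fun d hd => List.mem_toFinset.2 (List.mem_append_left _ hd)⟩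
      | succ n ih =>
        obtain ⟨h1, h2, h3, h4⟩ := ih
        refine ⟨h1.preserved hS hst hen (hset n).valid (hset n).covered (hx n) (hstep n), ?_⟩
        rcases h1.step hS hst hen (hset n).valid (hset n).covered (hx n) (hstep n) with
          h5 | ⟨h5, -, h6⟩
        · exact absurd h5 (hne n)
        · rw [h5]
          refine ⟨h2, h3, ?_⟩
          simp only [List.mem_cons, forall_eq_or_imp]
          refine ⟨?_, h4⟩
          rw [h2, h3] at h6
          exact List.mem_toFinset.2 (List.mem_append_right _ h6)
    exact hfin _ 0 (fun n _ => (key (n + 1)).2.1.trans (key n).2.1.symm) fun n _ => (key n).2.2.2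

/-- Well-founded induction along changes: the other memories reached by data for `L` announce `L`
already. Hence every requirement made of finite parts of `L` is met, and the approximations exhaust
exactly `L`. -/
theorem Settled.target_eq (hS : Succeeds φ tr L) (hst : IsStage nx tr) (hen : IsEnum φ wv)
    {Wg : Memory → Set ℕ} {E : ℕ → Memory → Memory → List ℕ} (hT : IsTarget φ nx wv Wg E)
    {st : Memory} (h : Settled tr nx wv L st) : Wg st = L := by
  have hacc := h.acc hS hst hen
  induction hacc with
  | intro st _ ih =>
    have ih' : ∀ x, Legal L x → ∀ st', Step nx wv st x st' → st' ≠ st → Wg st' = L :=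
      fun x hx st' h1 h2 => ih st' ⟨h2, x, hx, h1⟩ (h.step hS hst hen hx h1)
    obtain ⟨st₀, hst₀⟩ := h.valid.exists_step (wv := wv) hS hst (legal_none (L := L))
    have hD : ∀ n, some n ∈ st.2.1 → n ∈ L := fun n hn => legal_some.1 (h.valid.legal _ hn)
    have hE : ∀ n, (∃ s, n ∈ E s st st₀) ↔ n ∈ L := by
      intro n
      -- If `#` keeps the memory, the newest component absorbs `#` and its index is correct.
      -- Otherwise that index may be wrong, and the approximation follows the language of the
      -- `#`-successor.
      by_cases hne : st₀ = st
      · subst hne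
        have hidx : W φ (outIdx st₀.1) = L := by
          rcases step_cases hst hst₀ with ⟨-, h1, -⟩ | ⟨h1, -⟩ | ⟨h1, -⟩ | ⟨k, h₂, h1, -, h2, -⟩
          · rcases h.finite_or with hL | hs
            · exact h.valid.index_correct hS h1 h.covered (hL.subset fun l hl => hl.1)
            · exact hs.index_correct hS h.valid h.covered
          · exact absurd (congrArg (fun s : Memory => s.2.1.length) h1) (by simp)
          · exact absurd (congrArg (fun s : Memory => s.2.1.length) h1) (by simp)
          · exact absurd (congrArg (fun s : Memory => s.2.1.length) h1) (by simp)
        rw [hT.of_self, hidx]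
        exact ⟨fun h => h.elim (hD n) id, Or.inr⟩
      · rw [hT.of_ne _ _ _ hne, ih' none legal_none st₀ hst₀ hne]
        exact ⟨fun h => h.elim (hD n) id, Or.inr⟩
    ext n
    rw [hT.mem_iff]
    constructor
    · rintro (h1 | ⟨s, st₁, h1, h2, -⟩)
      · exact hD n h1
      · obtain rfl := h1.unique hst hst₀
        exact (hE n).1 ⟨s, h2⟩
    · intro hn
      obtain ⟨s, hs⟩ := (hE n).2 hn
      refine Or.inr ⟨s, st₀, hst₀, hs, fun x hx => ?_⟩
      have hxL : Legal L x := by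
        rcases List.mem_cons.1 hx with rfl | hx
        · exact legal_none
        · obtain ⟨l, hl, rfl⟩ := List.mem_map.1 hx
          exact legal_some.2 ((hE l).1 ⟨s, hl⟩)
      obtain ⟨st', hst'⟩ := h.valid.exists_step (wv := wv) hS hst hxL
      refine ⟨st', hst', ?_⟩
      by_cases hne : st' = st
      · exact Or.inl hne
      · refine Or.inr fun w hw => ?_
        rw [ih' x hxL st' hst' hne]
        exact (hE w).1 ⟨s, hw⟩

/-- Every step enlarges the announced language or stores a counterexample to it. -/
theorem IsTarget.step (hst : IsStage nx tr) {Wg : Memory → Set ℕ}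
    {E : ℕ → Memory → Memory → List ℕ} (hT : IsTarget φ nx wv Wg E) {st st' : Memory} {x : Datum}
    (h : Step nx wv st x st') :
    Wg st ⊆ Wg st' ∨ ∃ n, x = some n ∧ n ∉ Wg st ∧ some n ∈ st'.2.1 := by
  by_cases hne : st' = st
  · subst hne; exact Or.inl subset_rfl
  have hD := (step_stored hst h).resolve_left hne
  by_cases hx : ∃ n, x = some n ∧ n ∉ Wg st
  · obtain ⟨n, rfl, hn⟩ := hx
    exact Or.inr ⟨n, rfl, hn, by rw [hD]; exact List.mem_cons_self ..⟩
  · push Not at hx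
    refine Or.inl fun w hw => ?_
    rcases (hT.mem_iff _ _).1 hw with hw | ⟨s, st₀, h0, hs, hall⟩
    · exact (hT.mem_iff _ _).2 (Or.inl (step_stored_subset hst h hw))
    · have fin : ∀ s', w ∈ E s' st st₀ → x ∈ none :: (E s' st st₀).map some →
          (∀ x ∈ none :: (E s' st st₀).map some, ∃ st', Step nx wv st x st' ∧
            (st' = st ∨ ∀ w ∈ E s' st st₀, w ∈ Wg st')) → w ∈ Wg st' := by
        intro s' h1 h2 h3
        obtain ⟨st₁, h4, h5⟩ := h3 x h2
        obtain rfl := h4.unique hst h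
        exact (h5.resolve_left hne) w h1
      cases x with
      | none => exact fin s hs (List.mem_cons_self ..) hall
      | some n =>
        rcases (hT.mem_iff _ _).1 (hx n rfl) with hn | ⟨s', st₁, h0', hs', hall'⟩
        · exact fin s hs (List.mem_cons_of_mem _ (List.mem_map.2 ⟨n, hT.stored _ _ _ _ hn, rfl⟩))
            hall
        · obtain rfl := h0.unique hst h0'
          rcases le_total s s' with hss | hss
          · exact fin s' (hT.mono _ _ _ _ _ hss hs)
              (List.mem_cons_of_mem _ (List.mem_map.2 ⟨n, hs', rfl⟩)) hall'
          · exact fin s hs (List.mem_cons_of_mem _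
              (List.mem_map.2 ⟨n, hT.mono _ _ _ _ _ hss hs', rfl⟩)) hall

end Correctness

end BMSLearning

namespace BMSLearning

open Encodable

/-! ### Convergence of the memory on a text -/

section Convergence

variable {φ : ℕ → ℕ →. ℕ} {tr : ℕ × Datum →. ℕ} {L : Set ℕ} {nx : ℕ → ℕ × Datum → Option ℕ}
  {wv : ℕ → ℕ × ℕ → Option ℕ}

/-- The initial memory. -/
def initMemory : Memory := ([[0]], [], 0)

theorem valid_initMemory : Valid tr L initMemory.1 initMemory.2.1 where
  ne := by simp [initMemory]
  ne' := by simp [initMemory]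
  inner := by
    intro R hR r hr r' hr'
    simp only [initMemory, List.mem_singleton] at hR
    subst hR
    simp only [List.mem_singleton] at hr hr'
    subst hr hr'
    exact Conn.refl _
  pairwise := by simp [initMemory]
  reach := by
    intro R hR r hr
    simp only [initMemory, List.mem_singleton] at hR
    subst hR
    simp only [List.mem_singleton] at hr
    subst hr
    exact Conn.refl _
  legal := by simp [initMemory]
  cover := by
    intro B hB
    obtain ⟨r, hr, hrun⟩ := exists_run_closed (tr := tr) (R := [0]) (B := B) (r := 0) (by
      intro b hb
      simpa [initMemory] using (hB b hb).2) (by simp)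
    exact ⟨r, hr, B, fun x hx => (hB x hx).1, hrun, fun b hb => hb⟩

theorem exists_memories (hS : Succeeds φ tr L) (hst : IsStage nx tr) (hen : IsEnum φ wv)
    {T : ℕ → Datum} (hT : ∀ n, Legal L (T n)) : ∃ st : ℕ → Memory, st 0 = initMemory ∧
      ∀ n, Step nx wv (st n) (T n) (st (n + 1)) := by
  have key : ∀ (s : {m : Memory // Valid tr L m.1 m.2.1}) (n : ℕ),
      ∃ s' : {m : Memory // Valid tr L m.1 m.2.1}, Step nx wv s.1 (T n) s'.1 := by
    rintro ⟨s, hs⟩ n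
    obtain ⟨s', hs'⟩ := hs.exists_step (wv := wv) hS hst (hT n)
    obtain ⟨p, hp⟩ := List.exists_mem_of_ne_nil _ hs.ne
    exact ⟨⟨s', (hs.step hst hen (hT n) hs' hp).1⟩, hs'⟩
  choose g hg using key
  exact ⟨fun n => (Nat.rec ⟨initMemory, valid_initMemory⟩ (fun n s => g s n) n :
    {m : Memory // Valid tr L m.1 m.2.1}).1, rfl, fun n => hg _ n⟩

/-- On a text, the memory converges to a settled one. -/
theorem exists_settled (hS : Succeeds φ tr L) (hst : IsStage nx tr) (hen : IsEnum φ wv)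
    {T : ℕ → Datum} (hT : IsText T L) {st : ℕ → Memory} (h0 : st 0 = initMemory)
    (hstep : ∀ n, Step nx wv (st n) (T n) (st (n + 1))) :
    ∃ n₀, (∀ n, n₀ ≤ n → st n = st n₀) ∧ Settled tr nx wv L (st n₀) := by
  classical
  have hleg : ∀ n, Legal L (T n) := fun n l hl => hT ▸ ⟨n, hl⟩
  have hTL : ∀ l ∈ L, ∃ n, T n = some l := fun l hl => by rw [← hT] at hl; exact hl
  have hv : ∀ n, Valid tr L (st n).1 (st n).2.1 := by
    intro n
    induction n with
    | zero => rw [h0]; exact valid_initMemory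
    | succ n ih =>
      obtain ⟨p, hp⟩ := List.exists_mem_of_ne_nil _ ih.ne
      exact (ih.step hst hen (hleg n) (hstep n) hp).1
  have hDmono : ∀ n m, n ≤ m → ∀ d ∈ (st n).2.1, d ∈ (st m).2.1 := by
    intro n m hnm d hd
    induction m, hnm using Nat.le_induction with
    | base => exact hd
    | succ m _ ih => exact step_stored_subset hst (hstep m) ih
  have hHmono : ∀ n m, n ≤ m → ∀ R ∈ (st n).1, R ∈ (st m).1 := by
    intro n m hnm R hR
    induction m, hnm using Nat.le_induction with
    | base => exact hR
    | succ m _ ih => exact step_hist_subset hst (hstep m) R ih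
  have hseen : ∀ n m, n < m → T n ∈ (st m).2.1 ∨ ∃ R ∈ (st m).1, Closed tr R (T n) := by
    intro n m hnm
    rcases stored_or_closed_of_step hst (hstep n) (hv n).ne' with h | ⟨R, hR, h⟩
    · exact Or.inl (hDmono _ _ hnm _ h)
    · exact Or.inr ⟨R, hHmono _ _ hnm R hR, h⟩
  -- the history is eventually constant
  obtain ⟨n₀, hn₀⟩ : ∃ n₀, ∀ n, n₀ ≤ n → (st (n + 1)).1 = (st n).1 := by
    by_contra hcon
    push Not at hcon
    exact not_frequently_break hS hst hen hstep hleg (hv 0) (B := []) (by simp)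
      (fun l hl => Or.inr (hTL l hl)) hcon
  have hhist : ∀ n, n₀ ≤ n → (st n).1 = (st n₀).1 := by
    intro n hn
    induction n, hn using Nat.le_induction with
    | base => rfl
    | succ n hn ih => rw [hn₀ n hn, ih]
  have hcov : ∀ n, n₀ ≤ n → (∀ m, ∀ l, T m = some l → some l ∈ (st n).2.1 ∨
      ∃ R ∈ (st n).1, Closed tr R (some l)) → Covered tr L (st n) := by
    intro n hn h l hl
    obtain ⟨m, hm⟩ := hTL l hl
    exact h m l hm
  -- the memory is eventually constant
  obtain ⟨n₁, hn₁, hconst⟩ : ∃ n₁, n₀ ≤ n₁ ∧ ∀ n, n₁ ≤ n → st (n + 1) = st n := by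
    by_contra hcon
    push Not at hcon
    -- A stored datum not absorbed by the final newest component would turn any further revelation
    -- into a change of the history. So the search bound is frozen, and only the finitely many data
    -- tolerated at that bound can still be stored.
    by_cases hB : ∃ n, n₀ ≤ n ∧ T n ∈ (st (n + 1)).2.1 ∧ ¬ Closed tr (st n₀).1.headI (T n)
    · obtain ⟨n₁, hn₁, hD, hop⟩ := hB
      have key : ∀ n, (∀ d ∈ (st (n₁ + 1 + n)).2.1, d ∈ (st (n₁ + 1)).2.1 ∨
          d ∈ tolerated nx wv (st n₀).1 (st (n₁ + 1)).2.2) ∧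
          (st (n₁ + 1 + n)).2.2 = (st (n₁ + 1)).2.2 := by
        intro n
        induction n with
        | zero => exact ⟨fun d hd => Or.inl hd, rfl⟩
        | succ n ih =>
          obtain ⟨ih1, ih2⟩ := ih
          have hh := hhist (n₁ + 1 + n) (by omega)
          rcases step_cases hst (hstep (n₁ + 1 + n)) with ⟨h, -⟩ | ⟨h, -, -, -, ht, -⟩ |
            ⟨h, -, -, -, hcl, -⟩ | ⟨k, h₂, h, -, hlt, -⟩
          · rw [← add_assoc, h]; exact ⟨ih1, ih2⟩
          · rw [← add_assoc, h]
            refine ⟨?_, ih2⟩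
            simp only [List.mem_cons, forall_eq_or_imp]
            rw [hh, ih2] at ht
            exact ⟨Or.inr ht, ih1⟩
          · rw [hh] at hcl
            exact absurd (hcl _ (hDmono _ _ (by omega) _ hD)) hop
          · have h3 := hn₀ (n₁ + 1 + n) (by omega)
            rw [h] at h3
            dsimp only at h3
            rw [h3] at hlt
            exact absurd hlt (lt_irrefl _)
      refine not_frequently_increasing
        (f := fun n => (st (n₁ + 1 + n)).2.1.toFinset.card)
        (c := ((st (n₁ + 1)).2.1 ++ tolerated nx wv (st n₀).1 (st (n₁ + 1)).2.2).toFinset.card)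
        (fun n => card_stored_mono hst (hstep (n₁ + 1 + n))) (fun n => ?_) (fun n => ?_)
      · obtain ⟨m, hm, hne⟩ := hcon (n₁ + 1 + n) (by omega)
        obtain ⟨j, rfl⟩ := Nat.exists_eq_add_of_le hm
        refine ⟨n + j, by omega, ?_⟩
        have := card_stored_of_step hst (hstep (n₁ + 1 + n + j)) hne (hn₀ _ (by omega))
        rw [show n₁ + 1 + (n + j) = n₁ + 1 + n + j by omega,
          show n₁ + 1 + (n + j + 1) = n₁ + 1 + n + j + 1 by omega]
        omega
      · refine Finset.card_le_card fun d hd => ?_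
        simp only [List.mem_toFinset, List.mem_append] at hd ⊢
        exact (key n).1 d hd
    -- All data stored from now on are absorbed, so every change reveals new tolerated data. Only
    -- finitely many elements of `L` are not absorbed, hence the index is correct and the tolerated
    -- data are among those elements: revelations must end.
    · push Not at hB
      have hcase : ∀ n, n₀ ≤ n → Closed tr (st n₀).1.headI none ∧ (st (n + 1) = st n ∧
          (T n ∈ (st n).2.1 ∨ Closed tr (st n₀).1.headI (T n)) ∨
          (st (n + 1) = (st n₀ |>.1, T n :: (st n).2.1, encode (T n)) ∧
            Closed tr (st n₀).1.headI (T n) ∧ reveals nx wv (st n) (T n))) := by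
        intro n hn
        have hh := hhist n hn
        rcases step_cases hst (hstep n) with ⟨h, h1, h2⟩ | ⟨h, -, -, h1, -⟩ |
            ⟨h, -, h1, h2, -, h3⟩ | ⟨k, h₂, h, -, hlt, -⟩
        · rw [hh] at h1 h2
          exact ⟨h1, Or.inl ⟨h, h2.imp id And.left⟩⟩
        · rw [hh] at h1
          exact absurd (hB n hn (by rw [h]; exact List.mem_cons_self ..)) h1
        · rw [hh] at h1 h2 h
          exact ⟨h1, Or.inr ⟨h, h2, h3⟩⟩
        · have h3 := hn₀ n hn
          rw [h] at h3
          dsimp only at h3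
          rw [h3] at hlt
          exact absurd hlt (lt_irrefl _)
      have hDn : ∀ n, n₀ ≤ n → ∀ d ∈ (st n).2.1, d ∈ (st n₀).2.1 ∨
          Closed tr (st n₀).1.headI d := by
        intro n hn
        induction n, hn using Nat.le_induction with
        | base => exact fun d hd => Or.inl hd
        | succ n hn ih =>
          rcases (hcase n hn).2 with ⟨h, -⟩ | ⟨h, h1, -⟩
          · rw [h]; exact ih
          · rw [h]
            simp only [List.mem_cons, forall_eq_or_imp]
            exact ⟨Or.inr h1, ih⟩
      have hfin : {l | l ∈ L ∧ ¬ Closed tr (st n₀).1.headI (some l)}.Finite := by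
        refine Set.Finite.subset (((st n₀).2.1 ++ (List.range n₀).map T).toFinset.finite_toSet.preimage
          (f := some) (Option.some_injective ℕ).injOn) ?_
        rintro l ⟨hl, ho⟩
        obtain ⟨m, hm⟩ := hTL l hl
        simp only [Set.mem_preimage, Finset.mem_coe, List.mem_toFinset, List.mem_append,
          List.mem_map, List.mem_range]
        by_cases hmn : m < n₀
        · exact Or.inr ⟨m, hmn, hm⟩
        · have h1 := (hcase m (by omega)).2
          rw [hm] at h1
          rcases h1 with ⟨-, h1 | h1⟩ | ⟨-, h1, -⟩
          · exact Or.inl ((hDn m (by omega) _ h1).resolve_right ho)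
          · exact absurd h1 ho
          · exact absurd h1 ho
      have hidx : W φ (outIdx (st n₀).1) = L := by
        refine (hv n₀).index_correct hS (hcase n₀ le_rfl).1 ?_ hfin
        intro l hl
        by_cases hc : Closed tr (st n₀).1.headI (some l)
        · exact Or.inr ⟨_, (hv n₀).headI_mem, hc⟩
        · obtain ⟨m, hm⟩ := hTL l hl
          by_cases hmn : m < n₀
          · rw [← hm]; exact hseen m n₀ hmn
          · have h1 := (hcase m (by omega)).2
            rw [hm] at h1
            rcases h1 with ⟨-, h1 | h1⟩ | ⟨-, h1, -⟩
            · exact Or.inl ((hDn m (by omega) _ h1).resolve_right hc)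
            · exact absurd h1 hc
            · exact absurd h1 hc
      have hlt : ∀ n, n₀ ≤ n → st (n + 1) ≠ st n →
          (tolerated nx wv (st n₀).1 (st n).2.2).toFinset.card <
          (tolerated nx wv (st n₀).1 (st (n + 1)).2.2).toFinset.card := by
        intro n hn hne
        rcases (hcase n hn).2 with ⟨h, -⟩ | ⟨h, -, hr⟩
        · exact absurd h hne
        · have hle := lt_encode_of_reveals hst hen hr
          obtain ⟨y, h1, h2, -⟩ := reveals_iff.1 hr
          rw [hhist n hn] at h1 h2
          rw [h]
          refine Finset.card_lt_card (Finset.ssubset_iff_of_subset ?_ |>.2 ⟨y, ?_, ?_⟩)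
          · intro d hd
            simp only [List.mem_toFinset] at hd ⊢
            exact tolerated_mono hst hen hle.le hd
          · simpa using h1
          · simpa using h2
      refine not_frequently_increasing
        (f := fun n => (tolerated nx wv (st n₀).1 (st (n₀ + n)).2.2).toFinset.card)
        (c := (hfin.toFinset.image some : Finset Datum).card) (fun n => ?_) (fun n => ?_)
        (fun n => ?_)
      · by_cases hne : st (n₀ + n + 1) = st (n₀ + n)
        · rw [← add_assoc, hne]
        · exact (hlt _ (by omega) hne).le
      · obtain ⟨m, hm, hne⟩ := hcon (n₀ + n) (by omega)
        obtain ⟨j, rfl⟩ := Nat.exists_eq_add_of_le hm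
        refine ⟨n + j, by omega, ?_⟩
        have := hlt _ (by omega) hne
        rw [show n₀ + (n + j) = n₀ + n + j by omega,
          show n₀ + (n + j + 1) = n₀ + n + j + 1 by omega]
        exact this
      · refine Finset.card_le_card fun d hd => ?_
        obtain ⟨y, rfl, hy, ho, -⟩ := tolerated_spec (tr := tr) hst hen (List.mem_toFinset.1 hd)
        rw [hidx] at hy
        simp only [Finset.mem_image, Set.Finite.mem_toFinset, Set.mem_ofPred_eq]
        exact ⟨y, ⟨hy, ho⟩, rfl⟩
  have hc1 : ∀ n, n₁ ≤ n → st n = st n₁ := by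
    intro n hn
    induction n, hn using Nat.le_induction with
    | base => rfl
    | succ n hn ih => rw [hconst n hn, ih]
  have hcov1 : Covered tr L (st n₁) := by
    intro l hl
    obtain ⟨m, hm⟩ := hTL l hl
    have := hseen m (max (m + 1) n₁) (by omega)
    rw [hc1 _ (le_max_right ..), hm] at this
    exact this
  refine ⟨n₁, hc1, hv n₁, hcov1, ?_⟩
  by_cases hL : L.Finite
  · exact Or.inl hL
  right
  have hcase : ∀ n, n₁ ≤ n → Closed tr (st n₁).1.headI none ∧ (T n ∈ (st n₁).2.1 ∨
      Closed tr (st n₁).1.headI (T n) ∧ ¬ reveals nx wv (st n₁) (T n)) := by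
    intro n hn
    have hs := hstep n
    rw [hc1 n hn, hc1 (n + 1) (by omega)] at hs
    rcases step_cases hst hs with ⟨-, h1⟩ | ⟨h1, -⟩ | ⟨h1, -⟩ | ⟨k, h₂, h1, -⟩
    · exact h1
    all_goals exact absurd (congrArg (fun s : Memory => s.2.1.length) h1) (by simp)
  have hnone := (hcase n₁ le_rfl).1
  have hK := ((st n₁).2.1 ++ (List.range n₁).map T).toFinset.finite_toSet.preimage
    (f := some) (Option.some_injective ℕ).injOn
  have hfin : {l | l ∈ L ∧ ¬ Closed tr (st n₁).1.headI (some l)}.Finite := by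
    refine hK.subset ?_
    rintro l ⟨hl, ho⟩
    obtain ⟨m, hm⟩ := hTL l hl
    simp only [Set.mem_preimage, Finset.mem_coe, List.mem_toFinset, List.mem_append,
      List.mem_map, List.mem_range]
    by_cases hmn : m < n₁
    · exact Or.inr ⟨m, hmn, hm⟩
    · have h1 := (hcase m (by omega)).2
      rw [hm] at h1
      exact Or.inl (h1.resolve_right fun h => ho h.1)
  have hidx := (hv n₁).index_correct hS hnone hcov1 hfin
  refine ⟨hnone, fun l hl => ?_⟩
  by_cases hc : Closed tr (st n₁).1.headI (some l)
  · exact Or.inl hc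
  right
  rcases hcov1 l hl with h | h
  · exact Or.inl h
  by_contra hcon
  push Not at hcon
  -- An unsaturated memory would hide a datum that becomes tolerated at some stage `N`. All but
  -- finitely many elements of an infinite `L` appear later with codes above `N` and would reveal
  -- it.
  obtain ⟨N, hN⟩ := exists_tolerated hst hen (hist := (st n₁).1) (y := l) (by rw [hidx]; exact hl)
    (fun r hr => hS.exists_next ((hv n₁).reach _ (hv n₁).headI_mem r hr) (legal_some.2 hl)) hc h
  refine hL ((hK.union (Set.finite_lt_nat N)).subset fun l' hl' => ?_)
  by_contra hl''
  simp only [Set.mem_union, Set.mem_preimage, Finset.mem_coe, List.mem_toFinset, List.mem_append,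
    List.mem_map, List.mem_range, Set.mem_ofPred_eq, not_or, not_exists, not_and, not_lt] at hl''
  obtain ⟨⟨h1, h2⟩, h3⟩ := hl''
  obtain ⟨m, hm⟩ := hTL l' hl'
  have hmn : n₁ ≤ m := by
    by_contra hlt
    exact h2 m (by omega) hm
  have h4 := (hcase m hmn).2
  rw [hm] at h4
  refine (h4.resolve_left h1).2 (reveals_iff.2 ⟨some l, tolerated_mono hst hen ?_ hN, hcon.2,
    hcon.1⟩)
  simp only [encode_some, encode_nat]
  omega

end Convergence

end BMSLearning

namespace BMSLearning

open Encodable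

/-! ### From transition functions to learners and back -/

section Learners

theorem finite_range_of_eventually_const {β : Type*} {f : ℕ → β} {n : ℕ}
    (h : ∀ t, n ≤ t → f t = f n) : (Set.range f).Finite := by
  classical
  refine ((Finset.range (n + 1)).image f).finite_toSet.subset ?_
  rintro _ ⟨t, rfl⟩
  simp only [Finset.coe_image, Finset.coe_range, Set.mem_image, Set.mem_Iio]
  rcases le_total t n with ht | ht
  exacts [⟨t, by omega, rfl⟩, ⟨n, by omega, (h t ht).symm⟩]

/-- The learner with the given state transition function that announces `o q` whenever it enters
the state `q`. -/
def announcer {tr : ℕ × Datum →. ℕ} (htr : Partrec tr) {o : ℕ → ℕ} (ho : Computable o) :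
    BMSLearner where
  h := fun a => (tr a).map fun q => some (o q)
  s := tr
  partrec_h := htr.map ((Computable.option_some.comp ho).comp Computable.snd).to₂
  partrec_s := htr
  dom_eq := rfl

variable {tr : ℕ × Datum →. ℕ} {o : ℕ → ℕ} {T : ℕ → Datum} {q : ℕ → ℕ}

theorem BMSLearner.sStar_initSeg (M : BMSLearner) (h0 : q 0 = 0)
    (hq : ∀ t, q (t + 1) ∈ M.s (q t, T t)) (t : ℕ) :
    M.sStar (initSeg T t) = Part.some (q t) := by
  induction t with
  | zero => rw [h0]; rfl
  | succ t ih =>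
    rw [initSeg_succ, M.sStar_concat, ih, Part.bind_some]
    exact Part.eq_some_iff.2 (hq t)

theorem announcer_isLearningSeq (htr : Partrec tr) (ho : Computable o) (h0 : q 0 = 0)
    (hq : ∀ t, q (t + 1) ∈ tr (q t, T t)) :
    (announcer htr ho).IsLearningSeq T fun t => if t = 0 then none else some (o (q t)) := by
  rintro (_ | t)
  · rfl
  · have h := (announcer htr ho).sStar_initSeg (T := T) h0 hq t
    rw [initSeg_succ, BMSLearner.hStar_concat, h, Part.bind_some]
    refine Part.eq_some_iff.2 (Part.mem_map_iff _ |>.2 ⟨_, hq t, ?_⟩)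
    simp

theorem BMSLearner.usesFinitelyManyStates (M : BMSLearner) (h0 : q 0 = 0)
    (hq : ∀ t, q (t + 1) ∈ M.s (q t, T t)) (hfin : (Set.range q).Finite) :
    M.UsesFinitelyManyStates T := by
  refine hfin.subset ?_
  rintro a ⟨t, ht⟩
  rw [M.sStar_initSeg h0 hq, Part.mem_some_iff] at ht
  exact ⟨t, ht.symm⟩

/-- The learner that keeps its previous hypothesis, increased by one, in its state. -/
def recorder (M : BMSLearner) : ℕ × Datum →. ℕ := fun a =>
  (M.s (a.1.unpair.1, a.2)).bind fun q => (M.h (a.1.unpair.1, a.2)).map fun y =>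
    Nat.pair q ((y.map Nat.succ).getD a.1.unpair.2)

theorem partrec_recorder (M : BMSLearner) : Partrec (recorder M) := by
  have h1 : Computable fun a : ℕ × Datum => (a.1.unpair.1, a.2) :=
    ((Primrec.fst.comp (Primrec.unpair.comp Primrec.fst)).pair Primrec.snd).to_comp
  refine (M.partrec_s.comp h1).bind ((M.partrec_h.comp (h1.comp Computable.fst)).map ?_)
  exact (Primrec₂.natPair.comp (Primrec.snd.comp Primrec.fst) (Primrec.option_getD.comp
    (Primrec.option_map Primrec.snd (Primrec.succ.comp Primrec.snd).to₂)
    (Primrec.snd.comp (Primrec.unpair.comp (Primrec.fst.comp (Primrec.fst.comp Primrec.fst)))))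
    ).to_comp

/-- The recorded value is shifted by one, `0` meaning that no hypothesis has been made. Since `?`
keeps the record, it equals `p + 1` from `t₀` on, so recording adds only finitely many states. -/
theorem succeeds_recorder {φ : ℕ → ℕ →. ℕ} {M : BMSLearner} {L : Set ℕ}
    (hM : ∀ T, IsText T L → M.UsesFinitelyManyStates T ∧
      ∃ h, M.IsLearningSeq T h ∧ Ex (W φ) h T) : Succeeds φ (recorder M) L := by
  intro T hT
  obtain ⟨hfin, h, hh, t₀, p, hp, hW, hconst⟩ := hM T hT
  have hex : ∀ t, ∃ a, a ∈ M.sStar (initSeg T t) := by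
    intro t
    have h1 := hh (t + 1)
    rw [initSeg_succ, BMSLearner.hStar_concat, Part.eq_some_iff, Part.mem_bind_iff] at h1
    exact h1.imp fun a ha => ha.1
  choose a ha using hex
  have ha0 : a 0 = 0 := Part.mem_some_iff.1 (ha 0)
  have has : ∀ t, a (t + 1) ∈ M.s (a t, T t) := by
    intro t
    have h1 := ha (t + 1)
    rwa [initSeg_succ, BMSLearner.sStar_concat, Part.eq_some_iff.2 (ha t), Part.bind_some] at h1
  have hah : ∀ t, h (t + 1) ∈ M.h (a t, T t) := by
    intro t
    have h1 := hh (t + 1)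
    rwa [initSeg_succ, BMSLearner.hStar_concat, Part.eq_some_iff.2 (ha t), Part.bind_some,
      Part.eq_some_iff] at h1
  have hh0 : h 0 = none := (Part.some_inj.1 (hh 0)).symm
  let l : ℕ → ℕ := fun t => Nat.rec 0 (fun t b => ((h (t + 1)).map Nat.succ).getD b) t
  have hl : ∀ t, l (t + 1) = ((h (t + 1)).map Nat.succ).getD (l t) := fun t => rfl
  have hlp : ∀ t, t₀ ≤ t → l t = p + 1 := by
    intro t ht
    induction t, ht using Nat.le_induction with
    | base =>
      cases t₀ with
      | zero => rw [hh0] at hp; cases hp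
      | succ t => rw [hl, hp]; rfl
    | succ t ht ih =>
      rw [hl, ih]
      cases hc : h (t + 1) with
      | none => rfl
      | some b =>
        have := hconst (t + 1) (by omega) (by simp [hc])
        rw [hc, hp] at this
        cases this
        rfl
  have hlfin : (Set.range l).Finite :=
    finite_range_of_eventually_const fun t ht => (hlp t ht).trans (hlp t₀ le_rfl).symm
  refine ⟨fun t => Nat.pair (a t) (l t), ?_, ?_, ?_, p, t₀, ?_, ?_⟩
  · change Nat.pair (a 0) 0 = 0
    rw [ha0]; rfl
  · intro t
    refine Part.mem_bind_iff.2 ⟨a (t + 1), by simpa using has t,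
      (Part.mem_map_iff _).2 ⟨h (t + 1), by simpa using hah t, ?_⟩⟩
    simp [hl]
  · refine ((hfin.prod hlfin).image fun b => Nat.pair b.1 b.2).subset ?_
    rintro _ ⟨t, rfl⟩
    exact ⟨(a t, l t), ⟨⟨t, ha t⟩, t, rfl⟩, rfl⟩
  · exact hW.trans hT
  · intro t ht
    simpa using hlp t ht

end Learners

/-! ### The consistent normal form and the equalities -/

section Consistent

variable {φ : ℕ → ℕ →. ℕ} {tr : ℕ × Datum →. ℕ} {nx : ℕ → ℕ × Datum → Option ℕ}
  {wv : ℕ → ℕ × ℕ → Option ℕ}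

theorem stored_mono (hst : IsStage nx tr) {T : ℕ → Datum} {st : ℕ → Memory}
    (hstep : ∀ n, Step nx wv (st n) (T n) (st (n + 1))) {s t : ℕ} (h : s ≤ t) {d : Datum}
    (hd : d ∈ (st s).2.1) : d ∈ (st t).2.1 := by
  induction t, h using Nat.le_induction with
  | base => exact hd
  | succ t _ ih => exact step_stored_subset hst (hstep t) ih

/-- Every language differing from an earlier one contains it, or a datum in between is a
counterexample to the earlier one that the later one contains. -/
theorem IsTarget.chain (hst : IsStage nx tr) {Wg : Memory → Set ℕ}
    {E : ℕ → Memory → Memory → List ℕ} (hT : IsTarget φ nx wv Wg E) {T : ℕ → Datum}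
    {st : ℕ → Memory} (hstep : ∀ n, Step nx wv (st n) (T n) (st (n + 1))) {s t : ℕ} (h : s ≤ t) :
    Wg (st s) ⊆ Wg (st t) ∨
      ∃ n, n ∉ Wg (st s) ∧ some n ∈ (st t).2.1 ∧ n ∈ seqContent (initSeg T t) := by
  induction t, h using Nat.le_induction with
  | base => exact Or.inl subset_rfl
  | succ t _ ih =>
    rw [initSeg_succ]
    rcases ih with ih | ⟨n, h1, h2, h3⟩
    · rcases hT.step hst (hstep t) with h | ⟨n, h1, h2, h3⟩
      · exact Or.inl (ih.trans h)
      · exact Or.inr ⟨n, fun h => h2 (ih h), h3, by simp [seqContent, h1]⟩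
    · exact Or.inr ⟨n, h1, step_stored_subset hst (hstep t) h2, List.mem_append_left _ h3⟩

/-- Every learnable collection has a learner each of whose hypotheses contains every earlier one,
or is preceded by a datum refuting it that is kept forever. -/
theorem exists_consistent_learner (hφ : IsAcceptable φ) {C : Set (Set ℕ)}
    (hC : C ∈ TxtBMSStarEx φ NoRestriction) : ∃ M : BMSLearner, ∀ L ∈ C, ∀ T, IsText T L →
      M.UsesFinitelyManyStates T ∧ ∃ h, M.IsLearningSeq T h ∧ Ex (W φ) h T ∧
        ∀ s t, s ≤ t → ∀ a b, h s = some a → h t = some b → W φ a ⊆ W φ b ∨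
          ∃ n, n ∉ W φ a ∧ n ∈ seqContent (initSeg T t) ∧ ∀ u c, t ≤ u → h u = some c → n ∈ W φ c := by
  obtain ⟨-, M, hM⟩ := hC
  have hS : ∀ L ∈ C, Succeeds φ (recorder M) L := fun L hL => succeeds_recorder fun T hT =>
    ⟨(hM L hL T hT).1, (hM L hL T hT).2.imp fun h hh => ⟨hh.1, hh.2.2⟩⟩
  obtain ⟨nx, hnx, hnm, hns⟩ := exists_stage (partrec_recorder M)
  have hst : IsStage nx (recorder M) := ⟨hnm, hns⟩
  obtain ⟨wv, hwv, hwm, hws⟩ := exists_stage (f := fun a : ℕ × ℕ => φ a.1 a.2) hφ.partrec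
  have hen : IsEnum φ wv := by
    refine ⟨fun k k' a hk h => ?_, fun e n => ?_⟩
    · obtain ⟨q, hq⟩ := Option.isSome_iff_exists.1 h
      exact Option.isSome_iff_exists.2 ⟨q, hwm k k' a q hk hq⟩
    · simp only [Option.isSome_iff_exists]
      rw [exists_comm]
      simp only [← hws]
      exact Part.dom_iff_mem
  obtain ⟨ψ, E, hψ, hT⟩ := exists_target hnx hwv hst hen
  obtain ⟨f, hf, hfψ⟩ := hφ.translate ψ hψ
  have hWf : ∀ p, W φ (f p) = W ψ p := fun p => by
    ext x; simp only [W, PFun.mem_dom, hfψ]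
  -- State `0` has to stand for the initial memory, so codes of memories are shifted by one.
  let dec : ℕ → Memory := fun a => if decide (a = 0) = true then initMemory else
    (decode (α := Memory) (a - 1)).getD initMemory
  have hdec : Primrec dec := primrec_bite (primrec_decide_eq Primrec.id (Primrec.const 0))
    (Primrec.const _) (Primrec.option_getD.comp (Primrec.decode.comp
      (Primrec.nat_sub.comp Primrec.id (Primrec.const 1))) (Primrec.const _))
  let g : ℕ × Datum →. ℕ := fun a => Nat.rfindOpt fun k =>
    (step nx wv k (dec a.1) a.2).map fun m => encode m + 1
  have hg : Partrec g := by
    refine Partrec.rfindOpt (Primrec.to_comp ?_)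
    exact Primrec.option_map (primrec_step hnx hwv Primrec.snd
      (hdec.comp (Primrec.fst.comp Primrec.fst)) (Primrec.snd.comp Primrec.fst))
      (Primrec.succ.comp (Primrec.encode.comp Primrec.snd)).to₂
  have hgm : ∀ a x st', Step nx wv (dec a) x st' → encode st' + 1 ∈ g (a, x) := by
    rintro a x st' ⟨k, hk⟩
    refine (Nat.rfindOpt_mono ?_).2 ⟨k, ?_⟩
    · intro b m n hmn hb
      simp only [Option.mem_def, Option.map_eq_some_iff] at hb ⊢
      exact hb.imp fun c hc => ⟨step_mono hst hmn hc.1, hc.2⟩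
    · simp [hk]
  have ho : Computable fun a : ℕ => f (a - 1) :=
    hf.comp (Primrec.nat_sub.comp Primrec.id (Primrec.const 1)).to_comp
  refine ⟨announcer hg ho, fun L hL T hTL => ?_⟩
  obtain ⟨st, h0, hstep⟩ := exists_memories (hS L hL) hst hen (T := T)
    fun n l hl => hTL ▸ ⟨n, hl⟩
  obtain ⟨n₀, hn₀, hset⟩ := exists_settled (hS L hL) hst hen hTL h0 hstep
  let q : ℕ → ℕ := fun t => if t = 0 then 0 else encode (st t) + 1
  have hq0 : q 0 = 0 := rfl
  have hdq : ∀ t, dec (q t) = st t := by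
    rintro (_ | t)
    · exact h0.symm
    · simp only [dec, q, Nat.add_eq_zero_iff, one_ne_zero, and_false, decide_false, if_false,
        Bool.false_eq_true, Nat.add_sub_cancel]
      rw [encodek]; rfl
  have hq : ∀ t, q (t + 1) ∈ g (q t, T t) := fun t => hgm _ _ _ (by rw [hdq]; exact hstep t)
  have hval : ∀ t p, (if t = 0 then none else some (f (q t - 1))) = some p →
      W φ p = W ψ (encode (st t)) := by
    rintro (_ | t) p hp
    · cases hp
    · simp only [Nat.add_eq_zero_iff, one_ne_zero, and_false, if_false, Option.some.injEq] at hp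
      rw [← hp, hWf]
      rfl
  have hqc : ∀ t, n₀ + 1 ≤ t → q t = q (n₀ + 1) := fun t ht => by
    simp only [q]
    rw [if_neg (by omega), if_neg (by omega), hn₀ t (by omega), hn₀ (n₀ + 1) (by omega)]
  refine ⟨(announcer hg ho).usesFinitelyManyStates hq0 hq (finite_range_of_eventually_const hqc),
    _, announcer_isLearningSeq hg ho hq0 hq, ?_, ?_⟩
  · refine ⟨n₀ + 1, f (q (n₀ + 1) - 1), by simp, ?_, fun t ht _ => ?_⟩
    · rw [hval (n₀ + 1) _ (by simp), hn₀ (n₀ + 1) (by omega)]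
      exact (hset.target_eq (hS L hL) hst hen hT).trans hTL.symm
    · dsimp only
      rw [if_neg (by omega), if_neg (by omega), hqc t ht]
  · intro s t hs a b ha hb
    rw [hval s a ha, hval t b hb]
    -- The refuting datum is stored, and stored data belong to every later announced language.
    refine (hT.chain hst hstep hs).imp id fun ⟨n, h1, h2, h3⟩ => ⟨n, h1, h3, fun u c hu hc => ?_⟩
    rw [hval u c hc]
    exact (hT.mem_iff _ _).2 (Or.inl (stored_mono hst hstep hu h2))

theorem txtBMSStarEx_subset_noRestriction (δ : Restriction) :
    TxtBMSStarEx φ δ ⊆ TxtBMSStarEx φ NoRestriction :=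
  fun _ ⟨h, M, hM⟩ => ⟨h, M, fun L hL T hT => ⟨(hM L hL T hT).1,
    (hM L hL T hT).2.imp fun _ hh => ⟨hh.1, trivial, hh.2.2⟩⟩⟩

theorem txtBMSStarEx_eq_of_consistent (hφ : IsAcceptable φ) {δ : Restriction}
    (hδ : ∀ h T, (∀ s t, s ≤ t → ∀ a b, h s = some a → h t = some b → W φ a ⊆ W φ b ∨
      ∃ n, n ∉ W φ a ∧ n ∈ seqContent (initSeg T t) ∧ ∀ u c, t ≤ u → h u = some c → n ∈ W φ c) → δ (W φ) h T) :
    TxtBMSStarEx φ δ = TxtBMSStarEx φ NoRestriction := by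
  refine (txtBMSStarEx_subset_noRestriction δ).antisymm fun C hC => ?_
  obtain ⟨M, hM⟩ := exists_consistent_learner hφ hC
  exact ⟨hC.1, M, fun L hL T hT => ⟨(hM L hL T hT).1,
    (hM L hL T hT).2.imp fun h hh => ⟨hh.1, hδ h T hh.2.2, hh.2.1⟩⟩⟩

theorem txtBMSStarEx_wMon (hφ : IsAcceptable φ) :
    TxtBMSStarEx φ WMon = TxtBMSStarEx φ NoRestriction :=
  txtBMSStarEx_eq_of_consistent hφ fun _ _ H s t hst a b ha hb hsub =>
    (H s t hst a b ha hb).resolve_right fun ⟨_, h1, h2, _⟩ => h1 (hsub h2)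

theorem txtBMSStarEx_caut (hφ : IsAcceptable φ) :
    TxtBMSStarEx φ Caut = TxtBMSStarEx φ NoRestriction :=
  txtBMSStarEx_eq_of_consistent hφ fun _ _ H s t hst a b ha hb hsub =>
    (H s t hst a b ha hb).elim (fun h => hsub.not_subset h) fun ⟨_, h1, _, h2⟩ =>
      h1 (hsub.subset (h2 t b le_rfl hb))

/-- A permanently kept counterexample to a hypothesis prevents any return to its language. Without
counterexamples the three languages are nested, and the outer two coincide. -/
theorem txtBMSStarEx_dec (hφ : IsAcceptable φ) :
    TxtBMSStarEx φ Dec = TxtBMSStarEx φ NoRestriction := by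
  refine txtBMSStarEx_eq_of_consistent hφ fun _ _ H r s t hrs hst a b c ha hb hc hac => ?_
  rcases H r s hrs a b ha hb with h | ⟨n, h1, -, h2⟩
  · rcases H s t hst b c hb hc with h' | ⟨n, h1, -, h2⟩
    · exact h.antisymm (hac ▸ h')
    · exact absurd (h (hac ▸ h2 t c le_rfl hc)) h1
  · exact absurd (hac ▸ h2 t c hst hc) h1

theorem txtBMSStarEx_nU (hφ : IsAcceptable φ) :
    TxtBMSStarEx φ NU = TxtBMSStarEx φ NoRestriction := by
  refine (txtBMSStarEx_subset_noRestriction NU).antisymm ?_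
  rw [← txtBMSStarEx_dec hφ]
  exact fun _ ⟨h, M, hM⟩ => ⟨h, M, fun L hL T hT => ⟨(hM L hL T hT).1,
    (hM L hL T hT).2.imp fun _ hh => ⟨hh.1, fun r s t hrs hst a b c ha hb hc hac _ =>
      hh.2.1 r s t hrs hst a b c ha hb hc hac, hh.2.2⟩⟩⟩

end Consistent

end BMSLearning

namespace BMSLearning

open Encodable

/-! ### Separating the monotonicity conditions -/

section Separation

/-- For a list `l` of odd numbers: `l`, its predecessors, and the even numbers below `l`. -/
def lang (l : List ℕ) : Set ℕ := {x | x ∈ l ∨ x + 1 ∈ l ∨ Even x ∧ ∀ n ∈ l, x < n}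

/-- Add an odd datum to the list of those seen. -/
def record (l : List ℕ) (x : Datum) : List ℕ :=
  (x.map fun n => if decide (n % 2 = 1) && !decide (n ∈ l) then n :: l else l).getD l

theorem primrec₂_record : Primrec₂ record := by
  refine Primrec.option_getD.comp (Primrec.option_map Primrec.snd ?_) Primrec.fst
  exact primrec_bite (Primrec.and.comp
      (primrec_decide_eq (Primrec.nat_mod.comp Primrec.snd (Primrec.const 2)) (Primrec.const 1))
      (Primrec.not.comp (primrec_mem Primrec.snd (Primrec.fst.comp Primrec.fst))))
    (Primrec.list_cons.comp Primrec.snd (Primrec.fst.comp Primrec.fst))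
    (Primrec.fst.comp Primrec.fst)

theorem mem_record {l : List ℕ} {x : Datum} {n : ℕ} :
    n ∈ record l x ↔ n ∈ l ∨ Odd n ∧ x = some n := by
  cases x with
  | none => simp [record]
  | some m =>
    simp only [record, Option.map_some, Option.getD_some, Nat.odd_iff, Option.some.injEq]
    split_ifs with h
    · simp only [Bool.and_eq_true, decide_eq_true_eq] at h
      rw [List.mem_cons]
      constructor
      · rintro (rfl | h')
        exacts [Or.inr ⟨h.1, rfl⟩, Or.inl h']
      · rintro (h' | ⟨-, rfl⟩)
        exacts [Or.inr h', Or.inl rfl]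
    · refine ⟨Or.inl, ?_⟩
      rintro (h' | ⟨h1, rfl⟩)
      · exact h'
      · simpa [h1] using h

theorem record_eq_self {l : List ℕ} {x : Datum} (h : ∀ n, Odd n → x = some n → n ∈ l) :
    record l x = l := by
  cases x with
  | none => rfl
  | some m =>
    simp only [record, Option.map_some, Option.getD_some]
    rw [if_neg]
    simp only [Bool.and_eq_true, decide_eq_true_eq, Bool.not_eq_true', decide_eq_false_iff_not,
      not_and, not_not]
    exact fun hm => h m (Nat.odd_iff.2 hm) rfl

theorem lang_congr {l l' : List ℕ} (h : ∀ n, n ∈ l ↔ n ∈ l') : lang l = lang l' := by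
  simp only [lang, h]

theorem mem_lang_of_odd {l : List ℕ} (hl : ∀ n ∈ l, Odd n) {n : ℕ} (hn : Odd n) :
    n ∈ lang l ↔ n ∈ l := by
  refine ⟨fun h => ?_, Or.inl⟩
  rcases h with h | h | ⟨h, -⟩
  · exact h
  · have := hl _ h
    rw [Nat.odd_iff] at this hn
    omega
  · exact absurd hn (Nat.not_odd_iff_even.2 h)

theorem exists_lang_index {φ : ℕ → ℕ →. ℕ} (hφ : IsAcceptable φ) :
    ∃ f : ℕ → ℕ, Computable f ∧ ∀ l : List ℕ, W φ (f (encode l)) = lang l := by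
  let c : ℕ → ℕ → Bool := fun p x => decide (x ∈ (decode (α := List ℕ) p).getD []) ||
    (decide (x + 1 ∈ (decode (α := List ℕ) p).getD []) ||
      (decide (x % 2 = 0) && ((decode (α := List ℕ) p).getD []).all fun n => decide (x < n)))
  have hd : Primrec fun a : ℕ × ℕ => (decode (α := List ℕ) a.1).getD [] :=
    Primrec.option_getD.comp (Primrec.decode.comp Primrec.fst) (Primrec.const _)
  have hc : Primrec fun a : ℕ × ℕ => c a.1 a.2 :=
    Primrec.or.comp (primrec_mem Primrec.snd hd) (Primrec.or.comp
      (primrec_mem (Primrec.succ.comp Primrec.snd) hd) (Primrec.and.comp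
        (primrec_decide_eq (Primrec.nat_mod.comp Primrec.snd (Primrec.const 2)) (Primrec.const 0))
        (primrec_all hd (Primrec.nat_lt.comp (Primrec.snd.comp Primrec.fst) Primrec.snd).decide)))
  obtain ⟨f, hf, hfψ⟩ := hφ.translate (fun p x => cond (c p x) (Part.some 0) Part.none)
    (Partrec.cond hc.to_comp (Computable.const 0).partrec Partrec.none)
  refine ⟨f, hf, fun l => ?_⟩
  ext x
  have : x ∈ W φ (f (encode l)) ↔ c (encode l) x = true := by
    simp only [W, PFun.mem_dom, hfψ]
    cases c (encode l) x <;> simp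
  rw [this]
  simp only [c, encodek, Option.getD_some, Bool.or_eq_true, Bool.and_eq_true, decide_eq_true_eq,
    List.all_eq_true, ← Nat.even_iff]
  rfl

/-- A single learner identifies all `lang l` by recording the odd data. -/
theorem exists_recording_learner {φ : ℕ → ℕ →. ℕ} (hφ : IsAcceptable φ) :
    ∃ M : BMSLearner, ∀ l : List ℕ, (∀ n ∈ l, Odd n) → ∀ T, IsText T (lang l) →
      M.UsesFinitelyManyStates T ∧ ∃ h, M.IsLearningSeq T h ∧ Ex (W φ) h T ∧
        ∃ g : ℕ → List ℕ, (∀ s t, s ≤ t → ∀ n ∈ g s, n ∈ g t) ∧ (∀ t, ∀ n ∈ g t, n ∈ l) ∧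
          ∀ t a, h t = some a → W φ a = lang (g t) := by
  obtain ⟨f, hf, hW⟩ := exists_lang_index hφ
  let tr : ℕ × Datum → ℕ := fun a => encode (record ((decode a.1).getD []) a.2)
  have htr : Primrec tr := Primrec.encode.comp (primrec₂_record.comp (Primrec.option_getD.comp
    (Primrec.decode.comp Primrec.fst) (Primrec.const _)) Primrec.snd)
  refine ⟨announcer htr.to_comp.partrec hf, fun l hl T hT => ?_⟩
  let g : ℕ → List ℕ := fun t => Nat.rec [] (fun t b => record b (T t)) t
  have hg : ∀ t, g (t + 1) = record (g t) (T t) := fun t => rfl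
  have hmono : ∀ s t, s ≤ t → ∀ n ∈ g s, n ∈ g t := by
    intro s t h n hn
    induction t, h using Nat.le_induction with
    | base => exact hn
    | succ t _ ih => rw [hg]; exact mem_record.2 (Or.inl ih)
  have hlT : ∀ n t, Odd n → T t = some n → n ∈ l := fun n t hn ht =>
    (mem_lang_of_odd hl hn).1 (hT ▸ ⟨t, ht⟩)
  have hsub : ∀ t, ∀ n ∈ g t, n ∈ l := by
    intro t
    induction t with
    | zero => intro n hn; cases hn
    | succ t ih =>
      intro n hn
      rw [hg, mem_record] at hn
      rcases hn with hn | ⟨h1, h2⟩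
      exacts [ih n hn, hlT n t h1 h2]
  obtain ⟨t₀, ht₀⟩ : ∃ t₀, ∀ n ∈ l, n ∈ g t₀ := by
    refine exists_forall_stage (P := fun t n => n ∈ g t) (fun s t n h hn => hmono s t h n hn) l ?_
    intro n hn
    obtain ⟨t, ht⟩ : n ∈ content T := by
      rw [show content T = lang l from hT]; exact Or.inl hn
    exact ⟨t + 1, by rw [hg]; exact mem_record.2 (Or.inr ⟨hl n hn, ht⟩)⟩
  have hconst : ∀ t, t₀ ≤ t → g t = g t₀ := by
    intro t ht
    induction t, ht using Nat.le_induction with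
    | base => rfl
    | succ t ht ih =>
      rw [hg, ih, record_eq_self fun n hn h => ht₀ n (hlT n t hn h)]
  -- The empty list has code `0`, the initial state, so no shift is needed here.
  have hq0 : encode (g 0) = 0 := rfl
  have hq : ∀ t, encode (g (t + 1)) ∈ (tr : ℕ × Datum →. ℕ) (encode (g t), T t) := by
    intro t
    simp [tr, hg]
  refine ⟨BMSLearner.usesFinitelyManyStates _ hq0 hq (finite_range_of_eventually_const
    (n := t₀) fun t ht => congrArg encode (hconst t ht)), _, announcer_isLearningSeq _ hf hq0 hq, ?_,
    g, hmono, hsub, ?_⟩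
  · refine ⟨t₀ + 1, f (encode (g (t₀ + 1))), by simp, ?_, fun t ht _ => ?_⟩
    · rw [hW, show content T = lang l from hT]
      exact lang_congr fun n => ⟨hsub (t₀ + 1) n, fun h => hmono t₀ _ (Nat.le_succ _) n (ht₀ n h)⟩
    · dsimp only
      rw [if_neg (by omega), if_neg (by omega), hconst t (by omega), hconst (t₀ + 1) (by omega)]
  · intro t a ha
    split_ifs at ha
    cases ha
    exact hW _

variable {φ : ℕ → ℕ →. ℕ}

theorem re_lang (hφ : IsAcceptable φ) (l : List ℕ) : REPred fun n => n ∈ lang l := by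
  obtain ⟨f, -, hf⟩ := exists_lang_index hφ
  rw [← hf l]
  exact (hφ.partrec.comp (Computable.const (f (encode l))) Computable.id).dom_re

theorem lang_mem_noRestriction (hφ : IsAcceptable φ) :
    {L | ∃ l : List ℕ, (∀ n ∈ l, Odd n) ∧ L = lang l} ∈ TxtBMSStarEx φ NoRestriction := by
  obtain ⟨M, hM⟩ := exists_recording_learner hφ
  refine ⟨?_, M, ?_⟩
  · rintro _ ⟨l, -, rfl⟩
    exact re_lang hφ l
  · rintro _ ⟨l, hl, rfl⟩ T hT
    obtain ⟨h1, h, h2, h3, -⟩ := hM l hl T hT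
    exact ⟨h1, h, h2, trivial, h3⟩

theorem lang_mem_mon (hφ : IsAcceptable φ) :
    {L | L = lang [] ∨ ∃ n, Odd n ∧ L = lang [n]} ∈ TxtBMSStarEx φ Mon := by
  obtain ⟨M, hM⟩ := exists_recording_learner hφ
  have key : ∀ L ∈ {L | L = lang [] ∨ ∃ n, Odd n ∧ L = lang [n]}, ∃ l : List ℕ,
      (∀ n ∈ l, Odd n) ∧ L = lang l ∧ ∀ a ∈ l, ∀ b ∈ l, a = b := by
    rintro _ (rfl | ⟨n, hn, rfl⟩)
    · exact ⟨[], by simp, rfl, by simp⟩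
    · exact ⟨[n], by simpa using hn, rfl, by simp⟩
  refine ⟨fun L hL => ?_, M, fun L hL T hT => ?_⟩
  · obtain ⟨l, -, rfl, -⟩ := key L hL
    exact re_lang hφ l
  · obtain ⟨l, hl, rfl, hl1⟩ := key L hL
    obtain ⟨h1, h, h2, h3, g, hg, hgl, hgW⟩ := hM l hl T hT
    refine ⟨h1, h, h2, ?_, h3⟩
    rintro s t hst a b ha hb x ⟨hxa, hx⟩
    refine ⟨?_, hx⟩
    rw [hgW s a ha] at hxa
    rw [hgW t b hb]
    -- As `l` has at most one element, a nonempty record is all of `l` and the later hypothesis is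
    -- correct; an empty record means that the earlier one was empty too.
    by_cases hgt : ∃ m, m ∈ g t
    · obtain ⟨m, hm⟩ := hgt
      rw [lang_congr (l' := l) fun n => ⟨hgl t n, fun hn => hl1 m (hgl t m hm) n hn ▸ hm⟩]
      rwa [show content T = lang l from hT] at hx
    · rwa [lang_congr (l' := g s) fun n => ⟨fun hn => absurd ⟨n, hn⟩ hgt, hg s t hst n⟩]

/-- Learning sequences agree on common initial segments. -/
theorem BMSLearner.IsLearningSeq.congr {M : BMSLearner} {T T' : ℕ → Datum} {h h' : ℕ → Hyp}
    (hh : M.IsLearningSeq T h) (hh' : M.IsLearningSeq T' h') {t : ℕ}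
    (heq : initSeg T' t = initSeg T t) : h' t = h t :=
  Part.some_inj.1 ((hh' t).symm.trans (heq ▸ hh t))

theorem initSeg_prefix {T T' : ℕ → Datum} {s t : ℕ} (hst : s ≤ t)
    (h : initSeg T' t = initSeg T t) : initSeg T' s = initSeg T s := by
  apply List.ext_getElem (by simp [initSeg])
  intro i h1 h2
  have h3 : i < t := lt_of_lt_of_le (by simpa [initSeg] using h1) hst
  have := List.getElem_of_eq h (i := i) (by simpa [initSeg] using h3)
  simpa [initSeg] using this

/-- A text can be left after finitely many data, if these belong to the new language. -/
theorem exists_text_of_initSeg {T : ℕ → Datum} {t : ℕ} {L : Set ℕ}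
    (h : ∀ n ∈ seqContent (initSeg T t), n ∈ L) :
    ∃ T', IsText T' L ∧ initSeg T' t = initSeg T t := by
  obtain ⟨T', h1, h2⟩ := exists_text_extending (L := L) (initSeg T t)
    fun x hx n hn => h n (by subst hn; exact hx)
  rw [initSeg_length] at h2
  exact ⟨T', h1, h2⟩

theorem seqContent_subset (T : ℕ → Datum) (t : ℕ) : seqContent (initSeg T t) ⊆ content T := by
  intro n hn
  simp only [seqContent, initSeg] at hn
  obtain ⟨i, -, hi⟩ := List.mem_map.1 hn
  exact ⟨i, hi⟩

theorem exists_forall_lt_odd (σ : List Datum) : ∃ n, Odd n ∧ ∀ x ∈ seqContent σ, x < n := by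
  have : ∃ k, ∀ x, some x ∈ σ → x < k := by
    induction σ with
    | nil => exact ⟨0, by simp⟩
    | cons d σ ih =>
      obtain ⟨k, hk⟩ := ih
      refine ⟨max k (d.getD 0 + 1), fun x hx => ?_⟩
      rcases List.mem_cons.1 hx with rfl | hx
      · simp
      · exact lt_max_of_lt_left (hk x hx)
  obtain ⟨k, hk⟩ := this
  exact ⟨2 * k + 1, ⟨k, rfl⟩, fun x hx => by have := hk x hx; omega⟩

theorem lang_nil : lang [] = {x | Even x} := by
  ext x; simp [lang]

/-- A learner that identifies `lang []` and every `lang [n]` can be brought to a hypothesis for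
the former and then to one for one of the latter. -/
theorem exists_switch {M : BMSLearner} {δ : Restriction}
    (hM : ∀ L, (L = lang [] ∨ ∃ n, Odd n ∧ L = lang [n]) → ∀ T, IsText T L →
      ∃ h, M.IsLearningSeq T h ∧ δ (W φ) h T ∧ Ex (W φ) h T) :
    ∃ n T h s t a b, Odd n ∧ IsText T (lang [n]) ∧ M.IsLearningSeq T h ∧ δ (W φ) h T ∧ s ≤ t ∧
      h s = some a ∧ h t = some b ∧ W φ a = lang [] ∧ W φ b = lang [n] := by
  obtain ⟨T, hT, -⟩ := exists_text_extending (L := lang []) [] (by simp)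
  obtain ⟨h, hh, -, s, a, ha, hWa, -⟩ := hM _ (Or.inl rfl) T hT
  obtain ⟨n, hn, hlt⟩ := exists_forall_lt_odd (initSeg T s)
  obtain ⟨T', hT', hTT'⟩ := exists_text_of_initSeg (T := T) (t := s) (L := lang [n])
    fun x hx => by
      have : x ∈ lang [] := hT ▸ seqContent_subset T s hx
      rw [lang_nil] at this
      exact Or.inr (Or.inr ⟨this, by simpa using hlt x hx⟩)
  obtain ⟨h', hh', hδ, t, b, hb, hWb, hc⟩ := hM _ (Or.inr ⟨n, hn, rfl⟩) T' hT'
  have ha' : h' s = some a := (hh.congr hh' hTT').trans ha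
  rcases le_total s t with hst | hst
  · exact ⟨n, T', h', s, t, a, b, hn, hT', hh', hδ, hst, ha', hb, hWa.trans hT, hWb.trans hT'⟩
  -- If the learner had converged on the new text by time `s`, its hypothesis there is already
  -- final, and `s` serves for both times.
  · have hb' : h' s = some b := (hc s hst (by rw [ha']; exact Option.some_ne_none a)).trans hb
    exact ⟨n, T', h', s, s, a, b, hn, hT', hh', hδ, le_rfl, ha', hb', hWa.trans hT, hWb.trans hT'⟩

theorem succ_mem_lang_nil {n : ℕ} (hn : Odd n) : n + 1 ∈ lang [] := by
  rw [lang_nil]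
  exact hn.add_one

theorem succ_notMem_lang_singleton (n : ℕ) : n + 1 ∉ lang [n] := by
  simp only [lang, List.mem_singleton, forall_eq, Set.mem_ofPred_eq]
  omega

/-- The number `n + 1` is even, so it is given up in the switch from `lang []` to `lang [n]`. -/
theorem lang_notMem_sMon :
    {L | L = lang [] ∨ ∃ n, Odd n ∧ L = lang [n]} ∉ TxtBMSStarEx φ SMon := by
  rintro ⟨-, M, hM⟩
  obtain ⟨n, T, h, s, t, a, b, hn, -, -, hδ, hst, ha, hb, hWa, hWb⟩ :=
    exists_switch fun L hL T hT => (hM L hL T hT).2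
  have hsub := hδ s t hst a b ha hb
  rw [hWa, hWb] at hsub
  exact succ_notMem_lang_singleton n (hsub (succ_mem_lang_nil hn))

/-- After the switch to `lang [n]`, the text is continued to one for `lang [n, n + 2]`. This
language contains `n + 1`, the predecessor of `n + 2`, so the loss of `n + 1` in the switch now
violates monotonicity. -/
theorem lang_notMem_mon :
    {L | ∃ l : List ℕ, (∀ n ∈ l, Odd n) ∧ L = lang l} ∉ TxtBMSStarEx φ Mon := by
  rintro ⟨-, M, hM⟩
  obtain ⟨n, T, h, s, t, a, b, hn, hT, hh, -, hst, ha, hb, hWa, hWb⟩ :=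
    exists_switch (φ := φ) (M := M) (δ := Mon) fun L hL T hT => (hM L (by
      rcases hL with rfl | ⟨n, hn, rfl⟩
      exacts [⟨[], by simp, rfl⟩, ⟨[n], by simpa using hn, rfl⟩]) T hT).2
  have hsub : lang [n] ⊆ lang [n, n + 2] := by
    intro x hx
    simp only [lang, List.mem_cons, List.not_mem_nil, or_false, forall_eq_or_imp, forall_eq,
      Set.mem_ofPred_eq] at hx ⊢
    rcases hx with h | h | ⟨h1, h2⟩
    exacts [Or.inl (Or.inl h), Or.inr (Or.inl (Or.inl h)), Or.inr (Or.inr ⟨h1, h2, by omega⟩)]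
  obtain ⟨T', hT', hTT'⟩ := exists_text_of_initSeg (T := T) (t := t) (L := lang [n, n + 2])
    fun x hx => hsub (hT ▸ seqContent_subset T t hx)
  obtain ⟨-, h', hh', hMon, -⟩ := hM _ ⟨[n, n + 2], by simp [hn, Nat.odd_add], rfl⟩ T' hT'
  have h1 := hMon s t hst a b ((hh.congr hh' (initSeg_prefix hst hTT')).trans ha)
    ((hh.congr hh' hTT').trans hb)
  rw [hWa, hWb, show content T' = lang [n, n + 2] from hT'] at h1
  exact succ_notMem_lang_singleton n
    (h1 ⟨succ_mem_lang_nil hn, Or.inr (Or.inl (by simp))⟩).1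

theorem txtBMSStarEx_sMon_subset_mon : TxtBMSStarEx φ SMon ⊆ TxtBMSStarEx φ Mon :=
  fun _ ⟨h, M, hM⟩ => ⟨h, M, fun L hL T hT => ⟨(hM L hL T hT).1,
    (hM L hL T hT).2.imp fun _ hh => ⟨hh.1, fun s t hst a b ha hb =>
      Set.inter_subset_inter_left _ (hh.2.1 s t hst a b ha hb), hh.2.2⟩⟩⟩

end Separation

end BMSLearning

theorem mainTheorem2 (φ : ℕ → ℕ →. ℕ) (hφ : BMSLearning.IsAcceptable φ) :
    (BMSLearning.TxtBMSStarEx φ BMSLearning.NU =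
      BMSLearning.TxtBMSStarEx φ BMSLearning.NoRestriction) ∧
    (BMSLearning.TxtBMSStarEx φ BMSLearning.Dec =
        BMSLearning.TxtBMSStarEx φ BMSLearning.WMon ∧
      BMSLearning.TxtBMSStarEx φ BMSLearning.WMon =
        BMSLearning.TxtBMSStarEx φ BMSLearning.Caut ∧
      BMSLearning.TxtBMSStarEx φ BMSLearning.Caut =
        BMSLearning.TxtBMSStarEx φ BMSLearning.NoRestriction) ∧
    (BMSLearning.TxtBMSStarEx φ BMSLearning.Mon ⊂
      BMSLearning.TxtBMSStarEx φ BMSLearning.NoRestriction) ∧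
    (BMSLearning.TxtBMSStarEx φ BMSLearning.SMon ⊂
      BMSLearning.TxtBMSStarEx φ BMSLearning.Mon) := by
  open BMSLearning in
  exact ⟨txtBMSStarEx_nU hφ,
    ⟨(txtBMSStarEx_dec hφ).trans (txtBMSStarEx_wMon hφ).symm,
      (txtBMSStarEx_wMon hφ).trans (txtBMSStarEx_caut hφ).symm, txtBMSStarEx_caut hφ⟩,
    ⟨txtBMSStarEx_subset_noRestriction Mon, fun h => lang_notMem_mon (h (lang_mem_noRestriction hφ))⟩,
    ⟨txtBMSStarEx_sMon_subset_mon, fun h => lang_notMem_sMon (h (lang_mem_mon hφ))⟩⟩
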